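/- Let $\mathbb{K}$ be a field of characteristic zero and let $D$ be any set. **The natural Hopf algebra.** Let $\mathcal{S}_D := \{\alpha_{d,n} : d \in D, n \in \mathbb{N}\}$ be the signature where $\alpha_{d,n}$ has arity $n$. An $\mathcal{S}_D$-term is either the leaf $\perp$ or a generator of arity $n$ with an ordered sequence of $n$ subterms; terms form the free operad $\mathfrak{T}\mathcal{S}_D$, with unit $\perp$, where $y[z_1,\dots,z_m]$ is obtained by grafting $z_1,\dots,z_m$ onto the $m=\mathrm{ar}(y)$ leaves of $y$. A forest is a word of terms, $\mathrm{rd}(w)$ is the word obtained from $w$ by deleting its letters $\perp$, and $w$ is reduced if $\mathrm{rd}(w)=w$. Let $\mathbf{N}\mathfrak{T}\mathcal{S}_D$ be the $\mathbb{K}$-space with basis $(\mathsf{E}_f)$ indexed by reduced forests, with product $\mathsf{E}_f \mathsf{E}_{f'} = \mathsf{E}_{ff'}$, with the coproduct that is the algebra morphism such that $$\Delta \mathsf{E}_x = \sum_{x = y[z_1,\dots,z_{\mathrm{ar}(y)}]} \mathsf{E}_{\mathrm{rd}(y)} \otimes \mathsf{E}_{\mathrm{rd}(z_1 \cdots z_{\mathrm{ar}(y)})}$$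 for any term $x \neq \perp$, and with counit $\mathsf{E}_f \mapsto [f = \epsilon]$. **Realizations.** For an alphabet $A$, let $\mathbb{K}\langle A\rangle$ be the algebra of noncommutative polynomials on $A$ of finite degree and possibly infinite support. An $\mathcal{S}_D$-forest-like alphabet is a set $A$ with unary relations $\mathrm{R}$ and $\mathrm{D}_{\alpha_{d,n}}$ and binary relations $\prec_j$, $j \geq 1$. The disjoint sum $A' \mathbin{+\!\!+} A''$ is $A' \sqcup A''$ with the relations of $A'$ and of $A''$ and, in addition, $a' \prec_j a''$ for all $j$, $a' \in A'$, and $a'' \in \mathrm{R}''$. For a reduced forest $f$, whose internal nodes are numbered in left to right preorder, $\mathsf{r}_A(\mathsf{E}_f)$ is the sum of all words $w$ on $A$ whose length is the number of internal nodes of $f$ and such that $w_i \in \mathrm{R}$ if $i$ is a root, $w_i \in \mathrm{D}_{g}$ if $i$ is decorated by $g$, and $w_i \prec_j w_{i'}$ if $i'$ is the $j$-th child of $i$. Let $\mathbb{A}_{D,\mathbb{N}} := \{\mathbf{a}_{d,i} : d \in D, i \in \mathbb{N}\}$ be the alphabet such that all letters are in $\mathrm{R}$, $\mathrm{D}_{\alpha_{d,n}}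 = \{\mathbf{a}_{d,i} : i \in \mathbb{N}\}$, and $\mathbf{a}_{d,i} \prec_j \mathbf{a}_{d',i'}$ if and only if $i < i'$. **Foissy's Hopf algebra.** $\mathbf{NCK}_D$ is the $\mathbb{K}$-space with basis $(\mathsf{E}_F)$ indexed by $D$-decorated planar forests (words of nonempty planar rooted trees with nodes decorated on $D$), with concatenation as product, with the coproduct that is the algebra morphism such that $\Delta \mathsf{E}_t = \sum_c \mathsf{E}_{P^c(t)} \otimes \mathsf{E}_{R^c(t)}$ for any tree $t$, where $c$ runs over all admissible cuts of $t$ (the empty and the total cut included), $P^c(t)$ is the pruned forest, and $R^c(t)$ is the remaining trunk, and with counit $\mathsf{E}_F \mapsto [F = \epsilon]$. Let $\Delta^{\mathrm{op}}$ be $\Delta$ followed by the exchange of the two tensor factors. For a forest $F$, let $\widehat{F}$ be the reduced $\mathcal{S}_D$-forest obtained by replacing each node decorated by $d$ and having $n$ children by $\alpha_{d,n}$, and for any $\mathcal{S}_D$-forest-like alphabet $A$, let $\bar{\mathsf{r}}_A : \mathbf{NCK}_D \to \mathbb{K}\langle A\rangle$ be the linear map such that $\bar{\mathsf{r}}_A(\mathsf{E}_F)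 = \mathsf{r}_A(\mathsf{E}_{\widehat{F}})$. **Theorem.** 1. $\mathbf{N}\mathfrak{T}\mathcal{S}_D$ and $\mathbf{NCK}_D$ are Hopf algebras. 2. The map $\mathsf{r}_{\mathbb{A}_{D,\mathbb{N}}} : \mathbf{N}\mathfrak{T}\mathcal{S}_D \to \mathbb{K}\langle \mathbb{A}_{D,\mathbb{N}} \rangle$ is an algebra morphism, and its image $\mathsf{r}_{\mathbb{A}_{D,\mathbb{N}}}(\mathbf{N}\mathfrak{T}\mathcal{S}_D)$ has a (necessarily unique) Hopf algebra structure such that $\mathsf{r}_{\mathbb{A}_{D,\mathbb{N}}}$ is a Hopf algebra morphism onto it. This Hopf algebra is isomorphic to $\mathbf{NCK}_D$. Moreover, $\bar{\mathsf{r}}_{\mathbb{A}_{D,\mathbb{N}}}$ is an isomorphism from $\mathbf{NCK}_D$, with the coproduct $\Delta^{\mathrm{op}}$, to this Hopf algebra. 3. This gives a polynomial realization of $\mathbf{NCK}_D$. Precisely, let $\mathcal{A}$ be the class of the $\mathcal{S}_D$-forest-like alphabets such that $\mathrm{D}_{\alpha_{d,n}}$ does not depend on $n$ and $\prec_j$ does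 not depend on $j$. This class contains $\mathbb{A}_{D,\mathbb{N}}$ and is closed under $\mathbin{+\!\!+}$, which is associative. For any $A \in \mathcal{A}$, the map $\bar{\mathsf{r}}_A$ sends forests with $n$ nodes to homogeneous polynomials of degree $n$. For any $A, A' \in \mathcal{A}$ and $x \in \mathbf{NCK}_D$, $$\theta_{A,A'}\bigl(\bar{\mathsf{r}}_{A \mathbin{+\!\!+} A'}(x)\bigr) = (\bar{\mathsf{r}}_A \otimes \bar{\mathsf{r}}_{A'})(\Delta^{\mathrm{op}} x),$$ where $\theta_{A,A'}$ sends each word on $A \sqcup A'$ to the tensor product of its restrictions to $A$ and to $A'$. Finally, $\bar{\mathsf{r}}_{\mathbb{A}_{D,\mathbb{N}}}$ is injective. All this also holds when $\Delta^{\mathrm{op}}$ is replaced by $\Delta$ and $A \mathbin{+\!\!+} A'$ is replaced by $A' \mathbin{+\!\!+} A$. -/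

import Mathlib

open scoped TensorProduct

universe u v w

noncomputable section

namespace ForestHopf

/-! ## Hopf algebras -/

/-- The comultiplication and counit carried by the algebra `A` make it a Hopf algebra over `K`. -/
structure IsHopf (K : Type v) (A : Type w) [Field K] [Ring A] [Algebra K A]
    [CoalgebraStruct K A] : Prop where
  coassoc : (TensorProduct.assoc K A A A).toLinearMap ∘ₗ
      (CoalgebraStruct.comul (R := K) (A := A)).rTensor A ∘ₗ CoalgebraStruct.comul =
    (CoalgebraStruct.comul (R := K) (A := A)).lTensor A ∘ₗ CoalgebraStruct.comul
  rTensor_counit : (CoalgebraStruct.counit (R := K) (A := A)).rTensor A ∘ₗ CoalgebraStruct.comul =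
    TensorProduct.mk K K A 1
  lTensor_counit : (CoalgebraStruct.counit (R := K) (A := A)).lTensor A ∘ₗ CoalgebraStruct.comul =
    (TensorProduct.mk K A K).flip 1
  counit_one : CoalgebraStruct.counit (R := K) (1 : A) = 1
  counit_mul : ∀ a b : A, CoalgebraStruct.counit (R := K) (a * b) =
    CoalgebraStruct.counit (R := K) a * CoalgebraStruct.counit (R := K) b
  comul_one : CoalgebraStruct.comul (R := K) (1 : A) = 1
  comul_mul : ∀ a b : A, CoalgebraStruct.comul (R := K) (a * b) =
    CoalgebraStruct.comul (R := K) a * CoalgebraStruct.comul (R := K) b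
  antipode : ∃ S : A →ₗ[K] A,
    LinearMap.mul' K A ∘ₗ S.rTensor A ∘ₗ CoalgebraStruct.comul =
      Algebra.linearMap K A ∘ₗ CoalgebraStruct.counit ∧
    LinearMap.mul' K A ∘ₗ S.lTensor A ∘ₗ CoalgebraStruct.comul =
      Algebra.linearMap K A ∘ₗ CoalgebraStruct.counit

/-- `IsHopf` is Mathlib's notion of Hopf algebra, for the given operations. -/
@[reducible] def IsHopf.toHopfAlgebra {K : Type v} {A : Type w} [Field K] [Ring A]
    [alg : Algebra K A] [co : CoalgebraStruct K A] (h : IsHopf K A) : HopfAlgebra K A :=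
  { alg, co with
    coassoc := h.coassoc
    rTensor_counit_comp_comul := h.rTensor_counit
    lTensor_counit_comp_comul := h.lTensor_counit
    counit_one := h.counit_one
    mul_compr₂_counit := by ext a b; exact h.counit_mul a b
    comul_one := h.comul_one
    mul_compr₂_comul := by ext a b; exact h.comul_mul a b
    antipode := h.antipode.choose
    mul_antipode_rTensor_comul := h.antipode.choose_spec.1
    mul_antipode_lTensor_comul := h.antipode.choose_spec.2 }

/-! ## Noncommutative polynomials with possibly infinite support -/

/-- Noncommutative formal series on the alphabet `A`: arbitrary families of coefficients indexed
by words, with the concatenation (Cauchy) product. -/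
def NCSeries (K : Type v) (A : Type u) : Type (max u v) := List A → K

namespace NCSeries

variable {K : Type v} {A : Type u} [Field K]

instance : AddCommGroup (NCSeries K A) := inferInstanceAs (AddCommGroup (List A → K))
instance : Module K (NCSeries K A) := inferInstanceAs (Module K (List A → K))

instance : One (NCSeries K A) := ⟨fun w => match w with | [] => 1 | _ :: _ => 0⟩

/-- `(f g)(w)` is the sum of `f(u) g(u')` over all factorizations `w = u u'`. -/
instance : Mul (NCSeries K A) :=
  ⟨fun f g w => ∑ i ∈ Finset.range (w.length + 1), f (w.take i) * g (w.drop i)⟩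

theorem mul_apply (f g : NCSeries K A) (w : List A) :
    (f * g) w = ∑ i ∈ Finset.range (w.length + 1), f (w.take i) * g (w.drop i) := rfl

theorem add_apply (f g : NCSeries K A) (w : List A) : (f + g) w = f w + g w := rfl

theorem smul_apply (k : K) (f : NCSeries K A) (w : List A) : (k • f) w = k * f w := rfl

theorem mul_nil (f g : NCSeries K A) : (f * g) [] = f [] * g [] := by simp [mul_apply]

/-- The series of the coefficients of the words starting with `a`. -/
def quot (f : NCSeries K A) (a : A) : NCSeries K A := fun u => f (a :: u)

theorem mul_cons (f g : NCSeries K A) (a : A) (w : List A) :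
    (f * g) (a :: w) = (f.quot a * g) w + f [] * g (a :: w) := by
  simp only [mul_apply, List.length_cons]
  rw [Finset.sum_range_succ']
  simp [quot]

theorem mul_assoc_apply (w : List A) : ∀ f g h : NCSeries K A,
    ((f * g) * h) w = (f * (g * h)) w := by
  induction w with
  | nil => intro f g h; simp only [mul_nil]; ring
  | cons a w ih =>
    intro f g h
    have key : (f * g).quot a = f.quot a * g + f [] • g.quot a :=
      funext fun u => mul_cons f g a u
    have dist : ∀ x y z : NCSeries K A, ((x + y) * z) w = (x * z) w + (y * z) w := by
      intro x y z
      simp only [mul_apply, add_apply, add_mul, Finset.sum_add_distrib]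
    have sm : ∀ (k : K) (x y : NCSeries K A), ((k • x) * y) w = k * (x * y) w := by
      intro k x y
      simp only [mul_apply, smul_apply, Finset.mul_sum, mul_assoc]
    rw [mul_cons, key, dist, sm, ih, mul_cons f (g * h), mul_cons g h, mul_nil]
    ring

theorem one_mul' (f : NCSeries K A) : 1 * f = f := by
  funext w
  cases w with
  | nil => rw [mul_nil]; exact one_mul _
  | cons a w =>
    rw [mul_cons]
    have h1 : ((1 : NCSeries K A).quot a * f) w = 0 := by
      rw [mul_apply]
      exact Finset.sum_eq_zero fun i _ => zero_mul _
    rw [h1, zero_add]; exact one_mul _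

theorem mul_one' (f : NCSeries K A) : f * 1 = f := by
  suffices H : ∀ (w : List A) (f : NCSeries K A), (f * 1) w = f w from funext fun w => H w f
  intro w
  induction w with
  | nil => intro f; rw [mul_nil]; exact mul_one _
  | cons a w ih =>
    intro f
    rw [mul_cons, ih]
    have : (1 : NCSeries K A) (a :: w) = 0 := rfl
    rw [this, mul_zero, add_zero]
    rfl

instance : Ring (NCSeries K A) :=
  { (inferInstance : AddCommGroup (NCSeries K A)) with
    mul := (· * ·)
    one := 1
    mul_assoc := fun f g h => funext fun w => mul_assoc_apply w f g h
    one_mul := one_mul'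
    mul_one := mul_one'
    zero_mul := fun f => funext fun w => Finset.sum_eq_zero fun i _ => zero_mul _
    mul_zero := fun f => funext fun w => Finset.sum_eq_zero fun i _ => mul_zero _
    left_distrib := fun f g h => funext fun w => by
      simp only [mul_apply, add_apply, mul_add, Finset.sum_add_distrib]
    right_distrib := fun f g h => funext fun w => by
      simp only [mul_apply, add_apply, add_mul, Finset.sum_add_distrib] }

instance : Algebra K (NCSeries K A) :=
  Algebra.ofModule
    (fun k f g => funext fun w => by
      simp only [mul_apply, smul_apply, Finset.mul_sum, mul_assoc])
    (fun k f g => funext fun w => by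
      simp only [mul_apply, smul_apply, Finset.mul_sum, mul_left_comm])

end NCSeries

/-- The algebra of `A`-polynomials: series of finite degree, possibly with infinite support. -/
def NCPoly (K : Type v) (A : Type u) [Field K] : Subalgebra K (NCSeries K A) where
  carrier := {f | ∃ n : ℕ, ∀ w : List A, n < w.length → f w = 0}
  mul_mem' := by
    rintro f g ⟨m, hf⟩ ⟨n, hg⟩
    refine ⟨m + n, fun w hw => Finset.sum_eq_zero fun i hi => ?_⟩
    have hi' : i ≤ w.length := Nat.lt_succ_iff.mp (Finset.mem_range.mp hi)
    by_cases h : m < i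
    · rw [hf (w.take i) (by rw [List.length_take]; omega), zero_mul]
    · rw [hg (w.drop i) (by rw [List.length_drop]; omega), mul_zero]
  add_mem' := by
    rintro f g ⟨m, hf⟩ ⟨n, hg⟩
    refine ⟨m + n, fun w hw => ?_⟩
    rw [NCSeries.add_apply, hf w (by omega), hg w (by omega), add_zero]
  algebraMap_mem' := by
    intro k
    refine ⟨0, fun w hw => ?_⟩
    rw [Algebra.algebraMap_eq_smul_one, NCSeries.smul_apply]
    cases w with
    | nil => exact absurd hw (lt_irrefl _)
    | cons a w => exact mul_zero k

/-- The coefficient of a word in a polynomial. -/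
def NCPoly.coeff {K : Type v} {A : Type u} [Field K] (f : NCPoly K A) (w : List A) : K := f.1 w

/-- Homogeneous polynomials of degree `n`. -/
def NCPoly.IsHomogeneous {K : Type v} {A : Type u} [Field K] (f : NCPoly K A) (n : ℕ) : Prop :=
  ∀ w : List A, NCPoly.coeff f w ≠ 0 → w.length = n

/-- The evaluation of `K⟨A⟩ ⊗ K⟨A'⟩` as families of coefficients indexed by pairs of words. -/
def evalTensor {K : Type v} {A A' : Type u} [Field K] :
    (NCPoly K A ⊗[K] NCPoly K A') →ₗ[K] (List A × List A' → K) :=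
  TensorProduct.lift
    (LinearMap.mk₂ K (fun f g p => NCPoly.coeff f p.1 * NCPoly.coeff g p.2)
      (fun _ _ _ => funext fun _ => add_mul _ _ _)
      (fun _ _ _ => funext fun _ => mul_assoc _ _ _)
      (fun _ _ _ => funext fun _ => mul_add _ _ _)
      (fun _ _ _ => funext fun _ => mul_left_comm _ _ _))

/-- `K⟨A⟩ ⊗ K⟨A'⟩` is thereby a subspace of the space of families of coefficients indexed by pairs
of words. -/
theorem evalTensor_injective {K : Type v} {A A' : Type u} [Field K] :
    Function.Injective (evalTensor (K := K) (A := A) (A' := A')) := by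
  classical
  rw [injective_iff_map_eq_zero]
  intro t ht
  let b := Module.Basis.ofVectorSpace K (NCPoly K A)
  let e := TensorProduct.equivFinsuppOfBasisLeft (N := NCPoly K A') b
  obtain ⟨F, rfl⟩ := e.symm.surjective t
  suffices F = 0 by rw [this, map_zero]
  change evalTensor ((TensorProduct.equivFinsuppOfBasisLeft b).symm F) = 0 at ht
  rw [TensorProduct.equivFinsuppOfBasisLeft_symm_apply] at ht
  have hv : ∀ v : List A', ∑ i ∈ F.support, NCPoly.coeff (F i) v • b i = 0 := by
    intro v
    apply Subtype.ext
    funext u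
    have h := congrFun ht (u, v)
    rw [Finsupp.sum, map_sum, Finset.sum_apply] at h
    rw [AddSubmonoidClass.coe_finsetSum]
    refine Eq.trans ?_ h
    refine (Finset.sum_apply u _ (fun i => (NCPoly.coeff (F i) v • b i).1)).trans ?_
    exact Finset.sum_congr rfl fun i _ => mul_comm _ _
  ext1 i
  by_cases hi : i ∈ F.support
  · apply Subtype.ext
    funext v
    exact linearIndependent_iff'.mp b.linearIndependent F.support _ (hv v) i hi
  · simpa using hi

/-- The subword made of the letters of the first summand. -/
def leftPart {A A' : Type u} (w : List (A ⊕ A')) : List A := w.filterMap Sum.getLeft?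

/-- The subword made of the letters of the second summand. -/
def rightPart {A A' : Type u} (w : List (A ⊕ A')) : List A' := w.filterMap Sum.getRight?

/-- Only finitely many words have given restrictions to the two summands. -/
theorem finite_restrictions {A A' : Type u} (p : List A × List A') :
    {w : List (A ⊕ A') | leftPart w = p.1 ∧ rightPart w = p.2}.Finite := by
  suffices H : ∀ (n : ℕ) (p : List A × List A'), p.1.length + p.2.length = n →
      {w : List (A ⊕ A') | leftPart w = p.1 ∧ rightPart w = p.2}.Finite from H _ p rfl
  intro n
  induction n with
  | zero =>
    rintro ⟨u, v⟩ h
    refine (Set.finite_singleton []).subset ?_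
    rintro w ⟨h1, h2⟩
    have hu : u = [] := List.length_eq_zero_iff.mp (by simp at h; simpa using h.1)
    have hv : v = [] := List.length_eq_zero_iff.mp (by simp at h; simpa using h.2)
    subst hu hv
    cases w with
    | nil => rfl
    | cons x w => cases x <;> simp [leftPart, rightPart] at h1 h2
  | succ n ih =>
    rintro ⟨u, v⟩ h
    have hL : (⋃ a ∈ {a | a ∈ u}, (List.cons (Sum.inl a : A ⊕ A')) ''
        {w | leftPart w = u.tail ∧ rightPart w = v}).Finite := by
      refine Set.Finite.biUnion u.finite_toSet fun a ha => Set.Finite.image _ (ih (u.tail, v) ?_)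
      have := List.length_pos_of_mem ha
      simp at h ⊢; omega
    have hR : (⋃ a ∈ {a | a ∈ v}, (List.cons (Sum.inr a : A ⊕ A')) ''
        {w | leftPart w = u ∧ rightPart w = v.tail}).Finite := by
      refine Set.Finite.biUnion v.finite_toSet fun a ha => Set.Finite.image _ (ih (u, v.tail) ?_)
      have := List.length_pos_of_mem ha
      simp at h ⊢; omega
    refine (hL.union hR).subset ?_
    rintro w ⟨h1, h2⟩
    cases w with
    | nil => simp [leftPart, rightPart] at h1 h2; subst h1 h2; simp at h
    | cons x w =>
      cases x with
      | inl a =>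
        left
        simp only [leftPart, rightPart, List.filterMap_cons, Sum.getLeft?_inl,
          Sum.getRight?_inl] at h1 h2
        subst h1 h2
        simp [leftPart, rightPart]
      | inr a =>
        right
        simp only [leftPart, rightPart, List.filterMap_cons, Sum.getLeft?_inr,
          Sum.getRight?_inr] at h1 h2
        subst h1 h2
        simp [leftPart, rightPart]

/-- The alphabet-splitting map, which sends a word `w` on `A ⊔ A'` to the tensor product of its
restrictions to `A` and to `A'`. As polynomials may have infinite support, its values are read as
families of coefficients indexed by pairs of words. The sum is finite by `finite_restrictions`. -/
def theta {K : Type v} {A A' : Type u} [Field K] (f : NCPoly K (A ⊕ A')) : List A × List A' → K :=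
  fun p => ∑ w ∈ (finite_restrictions p).toFinset, NCPoly.coeff f w

/-! ## Terms, free operads, and their natural Hopf algebras -/

/-- Terms on the signature `S`, where `S n` is the set of generators of arity `n`. -/
inductive Term (S : ℕ → Type u) : Type u
  | leaf : Term S
  | node (n : ℕ) (g : S n) (c : Fin n → Term S) : Term S

namespace Term

variable {S : ℕ → Type u}

/-- The arity of a term in the free operad: its number of leaves. -/
def ar : Term S → ℕ
  | leaf => 1
  | node _ _ c => ∑ i, ar (c i)

/-- The degree of a term: its number of internal nodes. -/
def dg : Term S → ℕ
  | leaf => 0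
  | node _ _ c => 1 + ∑ i, dg (c i)

/-- The number of leaves of the subterms on the left of the `i`-th subterm. -/
def leafPos {n : ℕ} (c : Fin n → Term S) (i : Fin n) : ℕ := ∑ k ∈ Finset.Iio i, ar (c k)

/-- Full composition of the free operad, whose unit is `leaf`: for a word `z` of length `ar y`,
`comp y z` grafts the root of the `k`-th letter of `z` onto the `k`-th leaf of `y`. (It is not used
for words of other lengths.) -/
def comp : Term S → List (Term S) → Term S
  | leaf, z => z.headD leaf
  | node n g c, z => node n g fun i => comp (c i) ((z.drop (leafPos c i)).take (ar (c i)))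

open Classical in
/-- The finite set of all pairs `(y, z)`, where `y` is a term and `z` is a word of `ar y` terms,
such that `x = y[z 1, …, z (ar y)]`, see `mem_factorizations`. -/
def factorizations : Term S → Finset (Term S × List (Term S))
  | leaf => {(leaf, [leaf])}
  | node n g c => insert (leaf, [node n g c])
      ((Fintype.piFinset fun i => factorizations (c i)).image fun p =>
        (node n g fun i => (p i).1, (List.ofFn fun i => (p i).2).flatten))

theorem slice_flatten {α : Type u} {n : ℕ} (l : Fin n → List α) (i : Fin n) :
    ((List.ofFn l).flatten.drop (∑ k ∈ Finset.Iio i, (l k).length)).take (l i).length = l i := by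
  induction n with
  | zero => exact i.elim0
  | succ n ih =>
    rw [List.ofFn_succ, List.flatten_cons]
    refine Fin.cases ?_ (fun i => ?_) i
    · have : Finset.Iio (0 : Fin (n + 1)) = ∅ := by ext k; simp
      simp [this]
    · have : Finset.Iio i.succ = insert 0 ((Finset.Iio i).map (Fin.succEmb n)) := by
        ext k
        refine Fin.cases ?_ (fun k => ?_) k <;> simp
      rw [this, Finset.sum_insert (by simp), Finset.sum_map, ← List.drop_drop,
        List.drop_left]
      exact ih (fun j => l j.succ) i

theorem flatten_slices {α : Type u} {n : ℕ} (m : Fin n → ℕ) (z : List α)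
    (hz : z.length = ∑ i, m i) :
    (List.ofFn fun i => (z.drop (∑ k ∈ Finset.Iio i, m k)).take (m i)).flatten = z := by
  induction n generalizing z with
  | zero => simp at hz; simp [hz]
  | succ n ih =>
    rw [List.ofFn_succ, List.flatten_cons]
    have h0 : Finset.Iio (0 : Fin (n + 1)) = ∅ := by ext k; simp
    have hs : ∀ i : Fin n, ∑ k ∈ Finset.Iio i.succ, m k =
        m 0 + ∑ k ∈ Finset.Iio i, m k.succ := by
      intro i
      have : Finset.Iio i.succ = insert 0 ((Finset.Iio i).map (Fin.succEmb n)) := by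
        ext k
        refine Fin.cases ?_ (fun k => ?_) k <;> simp
      rw [this, Finset.sum_insert (by simp), Finset.sum_map]
      rfl
    rw [Fin.sum_univ_succ] at hz
    have := ih (fun i => m i.succ) (z.drop (m 0)) (by rw [List.length_drop]; omega)
    simp only [h0, Finset.sum_empty, List.drop_zero, hs, ← List.drop_drop]
    rw [this, List.take_append_drop]

theorem mem_factorizations (x : Term S) (y : Term S) (z : List (Term S)) :
    (y, z) ∈ factorizations x ↔ z.length = ar y ∧ comp y z = x := by
  have hleaf : ∀ (z : List (Term S)) (x : Term S),
      (z.length = ar (leaf : Term S) ∧ comp leaf z = x) ↔ z = [x] := by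
    intro z x
    constructor
    · rintro ⟨h1, h2⟩
      obtain ⟨t, rfl⟩ := List.length_eq_one_iff.mp h1
      simpa [comp] using h2
    · rintro rfl
      exact ⟨rfl, rfl⟩
  induction x generalizing y z with
  | leaf =>
    cases y with
    | leaf => rw [hleaf]; simp [factorizations]
    | node n g c => simp [factorizations, comp]
  | node n g c ih =>
    cases y with
    | leaf => rw [hleaf]; simp [factorizations]
    | node m h d =>
      simp only [factorizations, Finset.mem_insert, Finset.mem_image, Fintype.mem_piFinset,
        Prod.mk.injEq, reduceCtorEq, false_and, false_or, comp, ar]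
      constructor
      · rintro ⟨q, hq, hqe, rfl⟩
        simp only [node.injEq] at hqe
        obtain ⟨rfl, h3, h4⟩ := hqe
        obtain rfl := eq_of_heq h3
        obtain rfl := eq_of_heq h4
        have hq' := fun i => (ih i (q i).1 (q i).2).mp (hq i)
        refine ⟨?_, ?_⟩
        · rw [List.length_flatten, List.map_ofFn, List.sum_ofFn]
          exact Finset.sum_congr rfl fun i _ => (hq' i).1
        · congr 1
          funext i
          have := slice_flatten (fun i => (q i).2) i
          simp only [(hq' _).1] at this
          rw [leafPos, this, (hq' i).2]
      · rintro ⟨hl, he⟩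
        simp only [node.injEq] at he
        obtain ⟨rfl, h3, h4⟩ := he
        obtain rfl := eq_of_heq h3
        have h5 := eq_of_heq h4
        refine ⟨fun i => (d i, (z.drop (leafPos d i)).take (ar (d i))), fun i => ?_, rfl,
          flatten_slices (fun i => ar (d i)) z hl⟩
        refine (ih i _ _).mpr ?_
        refine ⟨?_, congrFun h5 i⟩
        have := congrArg List.length (flatten_slices (fun i => ar (d i)) z hl)
        rw [List.length_take, List.length_drop, min_eq_left]
        have hsub : ∑ k ∈ insert i (Finset.Iio i), ar (d k) ≤ ∑ k, ar (d k) :=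
          Finset.sum_le_sum_of_subset (Finset.subset_univ _)
        rw [Finset.sum_insert (by simp)] at hsub
        rw [leafPos]
        omega

/-- The decorations of the internal nodes, in left to right preorder. -/
def decs : Term S → List (Σ n, S n)
  | leaf => []
  | node n g c => ⟨n, g⟩ :: (List.ofFn fun i => decs (c i)).flatten

/-- The preorder position (starting from `0`, the position of the root) at which the internal nodes
of the `i`-th subterm start. -/
def childPos {n : ℕ} (c : Fin n → Term S) (i : Fin n) : ℕ := 1 + ∑ k ∈ Finset.Iio i, dg (c k)

/-- `t.Edge j a b`: in `t`, the internal node `b` is the `j`-th child of the internal node `a`.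
Internal nodes are identified with their preorder positions; positions and `j` start from `0`. -/
def Edge : Term S → ℕ → ℕ → ℕ → Prop
  | leaf, _, _, _ => False
  | node n _ c, j, a, b =>
      (∃ i : Fin n, i.val = j ∧ c i ≠ leaf ∧ a = 0 ∧ b = childPos c i) ∨
      ∃ (i : Fin n) (a' b' : ℕ), Edge (c i) j a' b' ∧ a = childPos c i + a' ∧ b = childPos c i + b'

end Term

/-- Terms different from the unit of the free operad. -/
abbrev ProperTerm (S : ℕ → Type u) : Type u := {t : Term S // t ≠ Term.leaf}

/-- Reduced forests: words on the terms different from the unit. -/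
abbrev RForest (S : ℕ → Type u) : Type u := FreeMonoid (ProperTerm S)

open Classical in
/-- The reduction of a word of terms: the subword of its letters different from the unit. -/
def rd {S : ℕ → Type u} (l : List (Term S)) : RForest S :=
  FreeMonoid.ofList (l.filterMap fun t => if h : t ≠ Term.leaf then some ⟨t, h⟩ else none)

namespace RForest

variable {S : ℕ → Type u}

/-- The underlying word of terms. -/
def terms (f : RForest S) : List (Term S) := f.toList.map Subtype.val

/-- The degree: the total number of internal nodes. -/
def dg (f : RForest S) : ℕ := (f.terms.map Term.dg).sum

/-- The decorations of the internal nodes, in preorder. -/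
def decs (f : RForest S) : List (Σ n, S n) := f.terms.flatMap Term.decs

/-- The preorder position (from `0`) at which the internal nodes of the `k`-th term start. -/
def pos (f : RForest S) (k : ℕ) : ℕ := ((f.terms.take k).map Term.dg).sum

/-- The internal node `a` is a root. -/
def IsRoot (f : RForest S) (a : ℕ) : Prop := ∃ k, k < f.terms.length ∧ a = f.pos k

/-- The internal node `b` is the `j`-th child of the internal node `a` (everything from `0`). -/
def Edge (f : RForest S) (j a b : ℕ) : Prop :=
  ∃ (k : ℕ) (t : Term S) (a' b' : ℕ), f.terms[k]? = some t ∧ t.Edge j a' b' ∧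
    a = f.pos k + a' ∧ b = f.pos k + b'

end RForest

/-- The vector space with elementary basis indexed by reduced forests on `S`; its product is the
concatenation of reduced forests. With the operations below, it is the natural Hopf algebra of the
free operad on `S`. -/
def NatHopf (K : Type v) (S : ℕ → Type u) [Field K] : Type (max u v) := MonoidAlgebra K (RForest S)

namespace NatHopf

variable (K : Type v) (S : ℕ → Type u) [Field K]

instance : Ring (NatHopf K S) := inferInstanceAs (Ring (MonoidAlgebra K (RForest S)))
instance : Algebra K (NatHopf K S) := inferInstanceAs (Algebra K (MonoidAlgebra K (RForest S)))

/-- The elementary basis. -/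
def E : Module.Basis (RForest S) K (NatHopf K S) := MonoidAlgebra.basis (RForest S) K

/-- The algebra morphism with given values on the basis elements indexed by one-letter words. -/
def lift {B : Type w} [Ring B] [Algebra K B] (φ : ProperTerm S → B) : NatHopf K S →ₐ[K] B :=
  MonoidAlgebra.lift K B (RForest S) (FreeMonoid.lift φ)

/-- The coproduct is the algebra morphism such that `Δ E_x` is the sum, over all factorizations
`x = y[z 1, …, z (ar y)]`, of `E_{rd y} ⊗ E_{rd z}`. The counit is the coefficient of the empty
forest. -/
instance : CoalgebraStruct K (NatHopf K S) where
  comul := (lift K S fun x =>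
    ∑ p ∈ Term.factorizations x.1, E K S (rd [p.1]) ⊗ₜ[K] E K S (rd p.2)).toLinearMap
  counit := (lift K S fun _ => (0 : K)).toLinearMap

end NatHopf

/-! ## Forest-like alphabets and the realization -/

/-- An `S`-forest-like structure on the alphabet `A`: the root relation, the decoration relations,
and the edge relations, where `edge j` is the relation for the `j`-th child counted from `0`. -/
structure ForestLike (S : ℕ → Type u) (A : Type u) : Type u where
  root : A → Prop
  dec : (n : ℕ) → S n → A → Prop
  edge : ℕ → A → A → Prop

namespace ForestLike

variable {S : ℕ → Type u}

/-- The disjoint sum of two forest-like alphabets. -/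
def sum {A A' : Type u} (B : ForestLike S A) (B' : ForestLike S A') : ForestLike S (A ⊕ A') where
  root x := match x with
    | .inl a => B.root a
    | .inr a => B'.root a
  dec n g x := match x with
    | .inl a => B.dec n g a
    | .inr a => B'.dec n g a
  edge j x y := match x, y with
    | .inl a, .inl b => B.edge j a b
    | .inr a, .inr b => B'.edge j a b
    | .inl _, .inr b => B'.root b
    | .inr _, .inl _ => False

/-- The disjoint sum taken in the opposite order, `B' ++ B`, seen on `A ⊔ A'`. -/
def sumOpp {A A' : Type u} (B : ForestLike S A) (B' : ForestLike S A') : ForestLike S (A ⊕ A') where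
  root x := (B'.sum B).root x.swap
  dec n g x := (B'.sum B).dec n g x.swap
  edge j x y := (B'.sum B).edge j x.swap y.swap

/-- The bijection `e` identifies two forest-like alphabets. -/
structure IsIso {A A' : Type u} (e : A ≃ A') (B : ForestLike S A) (B' : ForestLike S A') :
    Prop where
  root_iff : ∀ a, B.root a ↔ B'.root (e a)
  dec_iff : ∀ n g a, B.dec n g a ↔ B'.dec n g (e a)
  edge_iff : ∀ j a b, B.edge j a b ↔ B'.edge j (e a) (e b)

/-- The word `w` is compatible with the reduced forest `f`. -/
structure Compatible {A : Type u} (B : ForestLike S A) (f : RForest S) (w : List A) : Prop where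
  length_eq : w.length = f.dg
  root : ∀ (i : ℕ) (x : A), w[i]? = some x → f.IsRoot i → B.root x
  dec : ∀ (i : ℕ) (x : A) (n : ℕ) (g : S n),
    w[i]? = some x → f.decs[i]? = some ⟨n, g⟩ → B.dec n g x
  edge : ∀ (j i i' : ℕ) (x x' : A),
    w[i]? = some x → w[i']? = some x' → f.Edge j i i' → B.edge j x x'

variable (K : Type v) [Field K]

open Classical in
/-- The `A`-realization of `f`: the sum of all `f`-compatible words. -/
def forestPoly {A : Type u} (B : ForestLike S A) (f : RForest S) : NCPoly K A :=
  ⟨fun w => if B.Compatible f w then 1 else 0,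
    f.dg, fun _ hw => if_neg fun h => absurd h.length_eq (ne_of_gt hw)⟩

/-- The realization map of the natural Hopf algebra of the free operad on `S`. -/
def realize {A : Type u} (B : ForestLike S A) : NatHopf K S →ₗ[K] NCPoly K A :=
  (NatHopf.E K S).constr K (B.forestPoly K)

end ForestLike

/-- `IsPolynomialRealization Δ gr C s r U`: for the space `H` with coproduct `Δ` and homogeneous
components `gr n`, the class `C` of `S`-forest-like alphabets, with the associative sum operation
`s`, the graded maps `r`, and the alphabet `U`, form a polynomial realization. -/
structure IsPolynomialRealization {K : Type v} [Field K] {S : ℕ → Type u} {H : Type w}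
    [AddCommGroup H] [Module K H] (Δ : H →ₗ[K] H ⊗[K] H) (gr : ℕ → Submodule K H)
    (C : ∀ {A : Type u}, ForestLike S A → Prop)
    (s : ∀ {A A' : Type u}, ForestLike S A → ForestLike S A' → ForestLike S (A ⊕ A'))
    (r : ∀ {A : Type u}, ForestLike S A → H →ₗ[K] NCPoly K A)
    {A₀ : Type u} (U : ForestLike S A₀) : Prop where
  sum_mem : ∀ {A A' : Type u} (B : ForestLike S A) (B' : ForestLike S A'),
    C B → C B' → C (s B B')
  sum_assoc : ∀ {A A' A'' : Type u} (B : ForestLike S A) (B' : ForestLike S A')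
    (B'' : ForestLike S A''), C B → C B' → C B'' →
    ForestLike.IsIso (Equiv.sumAssoc A A' A'') (s (s B B') B'') (s B (s B' B''))
  graded : ∀ {A : Type u} (B : ForestLike S A), C B →
    ∀ n, ∀ x ∈ gr n, NCPoly.IsHomogeneous (r B x) n
  doubling : ∀ {A A' : Type u} (B : ForestLike S A) (B' : ForestLike S A'), C B → C B' →
    ∀ x, theta (r (s B B') x) = evalTensor (TensorProduct.map (r B) (r B') (Δ x))
  mem : C U
  injective : Function.Injective (r U)

/-! ## Decorated planar forests -/

/-- Nonempty planar rooted trees with nodes decorated on `D`: a root decorated by `d` with an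
ordered sequence of `n` subtrees. -/
inductive PTree (D : Type u) : Type u
  | node (d : D) (n : ℕ) (c : Fin n → PTree D) : PTree D

namespace PTree

variable {D : Type u}

/-- The tree with root decorated by `d` and list of subtrees `l`. -/
def graft (d : D) (l : List (PTree D)) : PTree D := node d l.length l.get

/-- The number of nodes. -/
def size : PTree D → ℕ
  | node _ _ c => 1 + ∑ i, size (c i)

/-- Admissible cuts of a tree. Such a cut is either the total cut (`none`), or keeps the root and
then induces an admissible cut of each subtree of the root, where the total cut of a subtree stands
for cutting the edge between the root and this subtree. -/
def Cut : PTree D → Type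
  | node _ n c => Option (∀ i : Fin n, Cut (c i))

/-- There are finitely many admissible cuts. -/
@[reducible] def cutFintype : (t : PTree D) → Fintype (Cut t)
  | node _ n c =>
    letI : ∀ i : Fin n, Fintype (Cut (c i)) := fun i => cutFintype (c i)
    inferInstanceAs (Fintype (Option (∀ i : Fin n, Cut (c i))))

instance (t : PTree D) : Fintype (Cut t) := cutFintype t

/-- The pruned part `P^c(t)`: the forest of the subtrees above the cut, from left to right. -/
def pruned : (t : PTree D) → Cut t → List (PTree D)
  | node d n c, none => [node d n c]
  | node _ _ c, some k => (List.ofFn fun i => pruned (c i) (k i)).flatten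

/-- The trunk `R^c(t)`: the tree containing the root that remains, or the empty forest if the cut
is total. -/
def trunk : (t : PTree D) → Cut t → List (PTree D)
  | node _ _ _, none => []
  | node d _ c, some k => [graft d (List.ofFn fun i => trunk (c i) (k i)).flatten]

end PTree

/-- `D`-decorated planar forests. -/
abbrev PForest (D : Type u) : Type u := FreeMonoid (PTree D)

/-- The number of nodes of a forest. -/
def PForest.size {D : Type u} (F : PForest D) : ℕ := (F.toList.map PTree.size).sum

/-- The vector space with basis indexed by `D`-decorated planar forests; its product is the
concatenation of forests. With the operations below, it is Foissy's Hopf algebra of `D`-decorated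
planar forests. -/
def NCK (K : Type v) (D : Type u) [Field K] : Type (max u v) := MonoidAlgebra K (PForest D)

namespace NCK

variable (K : Type v) (D : Type u) [Field K]

instance : Ring (NCK K D) := inferInstanceAs (Ring (MonoidAlgebra K (PForest D)))
instance : Algebra K (NCK K D) := inferInstanceAs (Algebra K (MonoidAlgebra K (PForest D)))

/-- The basis of forests. -/
def E : Module.Basis (PForest D) K (NCK K D) := MonoidAlgebra.basis (PForest D) K

/-- The algebra morphism with given values on trees. -/
def lift {B : Type w} [Ring B] [Algebra K B] (φ : PTree D → B) : NCK K D →ₐ[K] B :=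
  MonoidAlgebra.lift K B (PForest D) (FreeMonoid.lift φ)

/-- The coproduct is the algebra morphism such that `Δ t` is the sum of `P^c(t) ⊗ R^c(t)` over all
admissible cuts `c` of the tree `t`. The counit is the coefficient of the empty forest. -/
instance : CoalgebraStruct K (NCK K D) where
  comul := (lift K D fun t =>
    ∑ c : PTree.Cut t, E K D (FreeMonoid.ofList (PTree.pruned t c)) ⊗ₜ[K]
      E K D (FreeMonoid.ofList (PTree.trunk t c))).toLinearMap
  counit := (lift K D fun _ => (0 : K)).toLinearMap

/-- The coproduct with its two tensor factors exchanged: on trees, the sum of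
`R^c(t) ⊗ P^c(t)`. -/
def comulOpp : NCK K D →ₗ[K] NCK K D ⊗[K] NCK K D :=
  (TensorProduct.comm K (NCK K D) (NCK K D)).toLinearMap ∘ₗ CoalgebraStruct.comul

/-- The homogeneous component of degree `n`, spanned by the forests with `n` nodes. -/
def component (n : ℕ) : Submodule K (NCK K D) := Submodule.span K (E K D '' {F | F.size = n})

end NCK

/-! ## The realization of decorated planar forests -/

/-- The signature with one generator `α_{d,n}` of arity `n` for all `d` in `D` and all `n`. -/
def sigD (D : Type u) : ℕ → Type u := fun _ => D

/-- The alphabet of the letters `a_{d,i}`: all letters are roots, `a_{d,i}` is decorated by all the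
`α_{d,n}`, and there is a `j`-edge from `a_{d,i}` to `a_{d',i'}` when `i < i'`. -/
def alphD (D : Type u) : ForestLike (sigD D) (D × ℕ) where
  root _ := True
  dec _ d a := a.1 = d
  edge _ a b := a.2 < b.2

/-- The term obtained by replacing each node decorated by `d` and having `n` children by
`α_{d,n}`. -/
def PTree.toTerm {D : Type u} : PTree D → Term (sigD D)
  | node d n c => Term.node n d fun i => toTerm (c i)

theorem PTree.toTerm_ne_leaf {D : Type u} (t : PTree D) : t.toTerm ≠ Term.leaf := by
  cases t; simp [PTree.toTerm]

/-- The forest of terms associated with a decorated planar forest. -/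
def PForest.toRForest {D : Type u} : PForest D →* RForest (sigD D) :=
  FreeMonoid.map fun t => ⟨t.toTerm, t.toTerm_ne_leaf⟩

/-- The realization map of decorated planar forests, `E_F ↦ r_A(E_f)` where `f` is the forest of
terms associated with `F`. -/
def realizeNCK (K : Type v) [Field K] {D : Type u} {A : Type u} (B : ForestLike (sigD D) A) :
    NCK K D →ₗ[K] NCPoly K A :=
  (NCK.E K D).constr K fun F => B.realize K (NatHopf.E K (sigD D) (PForest.toRForest F))

/-- Alphabets whose decoration relations for `α_{d,n}` do not depend on `n` and whose `j`-edge
relations do not depend on `j`. -/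
def IsUniform {D : Type u} {A : Type u} (B : ForestLike (sigD D) A) : Prop :=
  (∀ (d : D) (n n' : ℕ), B.dec n d = B.dec n' d) ∧ ∀ j j' : ℕ, B.edge j = B.edge j'

end ForestHopf

end

open ForestHopf

noncomputable section

namespace ForestHopf

/-! Both coproducts are controlled by one-node operators that are cocycles. Grafting a root `B =
graftMap d` on planar forests satisfies `Δ B = B ⊗ 1 + (id ⊗ B) Δ` (`comulHom_graftMap`), because a
cut is either total or a family of cuts of the subtrees. For terms, a factorization of a node is
either trivial (`y` is the leaf) or factorizes each subterm, so that `Δ N = leaf ⊗ N + (N ⊗ id) Δ`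
(`wordComul_nodeMap`). The operator `N` needs to know the arity, hence it lives on words in which
leaves are kept as group-like letters; identities proved there descend along `reduction`, which
sends the leaf to `1`. Coassociativity and the counit laws follow by induction on roots. The number
of nodes gives a connected filtration, so the geometric series for the convolution inverse of `id`
is locally finite and yields the antipode (`IsHopf.of_filtration`).

Deleting leaves is a surjective algebra morphism `toNCK` from the natural Hopf algebra to planar
forests. It turns `N` into `B`, and comparing the two cocycle identities shows that it intertwines
`Δ` with `Δ^op` (`comulOpp_toNCK`).

On a uniform alphabet, arities, child indices and leaves have no effect on compatibility, so the
realization factors through `toNCK` (`realizeNCK_toNCK`). On `alphD D` the remaining map is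
injective: each forest has a least compatible word, labelling nodes by their depths, and this word
determines the forest (`realizeNCK_alphD_injective`). The image is therefore a copy of planar
forests with `Δ^op`. Planar forests are isomorphic to their coopposite by the antipode composed with
the mirror involution (`exists_coopposite_equiv`), so the image is also isomorphic to planar forests
with `Δ`.

For the doubling formula, color the nodes of a forest according to the summand containing their
letters in a compatible word on a disjoint sum. No edge goes from the second summand to the first,
so the first color is the trunk of an admissible cut and the second is its pruned part;
interleavings of the two subwords are what `theta` forgets. `splitSum_fits` proves this by reading
words letter by letter. -/

/-! ## Bialgebras with a connected filtration, and coopposites -/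

section Antipode

open TensorProduct WithConv Coalgebra

variable {K : Type v} {H : Type w} [Field K] [Ring H]

/-- A bialgebra with an antipode satisfies `IsHopf`. -/
theorem IsHopf.of_bialgebra [Bialgebra K H] (S : WithConv (H →ₗ[K] H))
    (h1 : S * toConv LinearMap.id = 1) (h2 : toConv LinearMap.id * S = 1) : IsHopf K H where
  coassoc := Coalgebra.coassoc
  rTensor_counit := Coalgebra.rTensor_counit_comp_comul
  lTensor_counit := Coalgebra.lTensor_counit_comp_comul
  counit_one := Bialgebra.counit_one
  counit_mul := Bialgebra.counit_mul
  comul_one := Bialgebra.comul_one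
  comul_mul := Bialgebra.comul_mul
  antipode := ⟨S.ofConv, congrArg ofConv h1, congrArg ofConv h2⟩

variable [Bialgebra K H]

/-- Convolution powers of `id - η ∘ ε` vanish on the corresponding steps of a filtration that is
compatible with the coproduct and connected. -/
theorem conv_pow_eq_zero {ι : Type*} (b : ι → H) (size : ι → ℕ)
    (h0 : ∀ i, size i = 0 → b i = algebraMap K H (counit (R := K) (b i)))
    (hΔ : ∀ i, comul (R := K) (b i) ∈
      Submodule.span K {z | ∃ j k, size j + size k ≤ size i ∧ z = b j ⊗ₜ[K] b k})
    (n : ℕ) : ∀ i, size i < n →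
      ((toConv (LinearMap.id : H →ₗ[K] H) - 1) ^ n : WithConv (H →ₗ[K] H)) (b i) = 0 := by
  induction n with
  | zero => intro i hi; exact absurd hi (Nat.not_lt_zero _)
  | succ n ih =>
    intro i hi
    rw [pow_succ', LinearMap.convMul_apply]
    suffices H : ∀ z ∈ Submodule.span K {z | ∃ j k, size j + size k ≤ size i ∧
        z = b j ⊗ₜ[K] b k}, LinearMap.mul' K H (TensorProduct.map
          (toConv (LinearMap.id : H →ₗ[K] H) - 1 : WithConv (H →ₗ[K] H)).ofConv
          ((toConv (LinearMap.id : H →ₗ[K] H) - 1) ^ n : WithConv (H →ₗ[K] H)).ofConv z) = 0 from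
      H _ (hΔ i)
    intro z hz
    induction hz using Submodule.span_induction with
    | zero => simp
    | add x y _ _ hx hy => rw [map_add, map_add, hx, hy, add_zero]
    | smul a x _ hx => rw [map_smul, map_smul, hx, smul_zero]
    | mem z hz =>
      obtain ⟨j, k, hjk, rfl⟩ := hz
      rw [TensorProduct.map_tmul, LinearMap.mul'_apply]
      -- The single factor `id - η ∘ ε` acts on `b j`. It kills `b j` when `size j = 0`; otherwise
      -- `size k` is smaller than `size i` and the induction hypothesis kills the other factor.
      rcases Nat.eq_zero_or_pos (size j) with hj | hj
      · have : (toConv (LinearMap.id : H →ₗ[K] H) - 1 : WithConv (H →ₗ[K] H)).ofConv (b j) = 0 :=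
          sub_eq_zero.mpr (h0 j hj)
        rw [this, zero_mul]
      · rw [ih k (by omega), mul_zero]

/-- A bialgebra with a connected filtration is a Hopf algebra. -/
theorem IsHopf.of_filtration {ι : Type*} (b : Module.Basis ι K H) (size : ι → ℕ)
    (h0 : ∀ i, size i = 0 → b i = algebraMap K H (counit (R := K) (b i)))
    (hΔ : ∀ i, comul (R := K) (b i) ∈
      Submodule.span K {z | ∃ j k, size j + size k ≤ size i ∧ z = b j ⊗ₜ[K] b k}) :
    IsHopf K H := by
  -- The antipode is the convolution inverse of `id = 1 - J`, that is, the series of the powers of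
  -- `J`. On `b i` the powers beyond `size i` vanish, so `T (size i + 1)` is already the full sum.
  let J : WithConv (H →ₗ[K] H) := 1 - toConv LinearMap.id
  have hJ : ∀ n i, size i < n → (J ^ n) (b i) = 0 := by
    intro n i hi
    have : J = -(toConv LinearMap.id - 1) := (neg_sub _ _).symm
    rw [this, neg_pow]
    rcases neg_one_pow_eq_or (WithConv (H →ₗ[K] H)) n with h | h
    · rw [h, one_mul]; exact conv_pow_eq_zero b size h0 hΔ n i hi
    · rw [h, neg_one_mul]
      exact (congrArg Neg.neg (conv_pow_eq_zero b size h0 hΔ n i hi)).trans neg_zero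
  let T : ℕ → WithConv (H →ₗ[K] H) := fun n => ∑ k ∈ Finset.range n, J ^ k
  have hT : ∀ i n, size i < n → (T n) (b i) = (T (size i + 1)) (b i) := by
    intro i n hn
    induction n with
    | zero => omega
    | succ n ih =>
      rcases Nat.lt_succ_iff_lt_or_eq.mp hn with h | h
      · rw [← ih h]
        have : T (n + 1) = T n + J ^ n := Finset.sum_range_succ _ _
        rw [this]
        exact (congrArg ((T n) (b i) + ·) (hJ n i h)).trans (add_zero _)
      · rw [h]
  let S : WithConv (H →ₗ[K] H) := toConv (b.constr K fun i => (T (size i + 1)) (b i))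
  have hS : ∀ i n, size i < n → S (b i) = (T n) (b i) := fun i n hn =>
    (b.constr_basis K _ i).trans (hT i n hn).symm
  -- On the filtration step containing `Δ (b i)`, the locally defined `S` agrees with one fixed
  -- partial sum, to which the finite geometric identity applies.
  have key : ∀ (i : ι) (z : H ⊗[K] H), z ∈ Submodule.span K
      {z | ∃ j k, size j + size k ≤ size i ∧ z = b j ⊗ₜ[K] b k} →
      TensorProduct.map S.ofConv LinearMap.id z =
        TensorProduct.map (T (size i + 1)).ofConv LinearMap.id z ∧
      TensorProduct.map LinearMap.id S.ofConv z =
        TensorProduct.map LinearMap.id (T (size i + 1)).ofConv z := by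
    intro i z hz
    induction hz using Submodule.span_induction with
    | zero => simp
    | add x y _ _ hx hy => simp only [map_add, hx, hy, and_self]
    | smul a x _ hx => simp only [map_smul, hx, and_self]
    | mem z hz =>
      obtain ⟨j, k, hjk, rfl⟩ := hz
      simp only [TensorProduct.map_tmul]
      rw [hS j (size i + 1) (by omega), hS k (size i + 1) (by omega)]
      exact ⟨rfl, rfl⟩
  have hid : (toConv LinearMap.id : WithConv (H →ₗ[K] H)) = 1 - J := by simp [J]
  refine IsHopf.of_bialgebra S ?_ ?_
  · refine WithConv.ext (b.ext fun i => ?_)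
    have h1 : (S * toConv LinearMap.id : WithConv (H →ₗ[K] H)) (b i) =
        (T (size i + 1) * toConv LinearMap.id : WithConv (H →ₗ[K] H)) (b i) := by
      rw [LinearMap.convMul_apply, LinearMap.convMul_apply, (key i _ (hΔ i)).1]
    refine h1.trans ?_
    -- What remains is `1 - J ^ (size i + 1)`, whose second term vanishes on `b i`.
    rw [hid, geom_sum_mul_neg]
    exact (congrArg (_ - ·) (hJ _ i (Nat.lt_succ_self _))).trans (sub_zero _)
  · refine WithConv.ext (b.ext fun i => ?_)
    have h1 : (toConv LinearMap.id * S : WithConv (H →ₗ[K] H)) (b i) =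
        (toConv LinearMap.id * T (size i + 1) : WithConv (H →ₗ[K] H)) (b i) := by
      rw [LinearMap.convMul_apply, LinearMap.convMul_apply, (key i _ (hΔ i)).2]
    refine h1.trans ?_
    rw [hid, mul_neg_geom_sum]
    exact (congrArg (_ - ·) (hJ _ i (Nat.lt_succ_self _))).trans (sub_zero _)

end Antipode

/-! ### Antipodes and isomorphisms with the coopposite. -/

section Coopposite

open TensorProduct WithConv Coalgebra HopfAlgebra

variable {K : Type v} {H : Type w} [Field K] [Ring H] [HopfAlgebra K H]

/-- The antipode is an antimorphism of coalgebras. -/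
theorem comul_antipode (x : H) : comul (R := K) (antipode K x) =
    TensorProduct.map (antipode K) (antipode K)
      (TensorProduct.comm K H H (comul (R := K) x)) := by
  let i1 : H →ₐ[K] H ⊗[K] H := Algebra.TensorProduct.includeLeft
  let i2 : H →ₐ[K] H ⊗[K] H := Algebra.TensorProduct.includeRight
  let S : H →ₗ[K] H := antipode K
  have hS : toConv S * toConv LinearMap.id = 1 := LinearMap.antipode_mul_id
  have hi : ∀ i : H →ₐ[K] H ⊗[K] H,
      toConv (i.toLinearMap ∘ₗ S) * toConv i.toLinearMap = 1 := by
    intro i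
    have := LinearMap.algHom_comp_convMul_distrib i (toConv S) (toConv LinearMap.id)
    rw [hS, LinearMap.algHom_comp_convOne] at this
    exact (congrArg toConv this).symm
  -- In the convolution algebra of maps from `H` to `H ⊗ H`, the coproduct is the product of the two
  -- inclusions. Its inverse is thus the product, in reverse order, of the inclusions composed with
  -- the antipode.
  have hc : (toConv comul : WithConv (H →ₗ[K] H ⊗[K] H)) =
      toConv i1.toLinearMap * toConv i2.toLinearMap := by
    ext y
    rw [LinearMap.convMul_apply]
    generalize comul (R := K) y = z
    induction z using TensorProduct.induction_on with
    | zero => simp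
    | tmul a b => simp [i1, i2]
    | add a b ha hb => rw [map_add, map_add, ← ha, ← hb]
  have hg : toConv (TensorProduct.map S S ∘ₗ (TensorProduct.comm K H H).toLinearMap ∘ₗ comul) =
      toConv (i2.toLinearMap ∘ₗ S) * toConv (i1.toLinearMap ∘ₗ S) := by
    ext y
    rw [LinearMap.convMul_apply]
    simp only [LinearMap.comp_apply, LinearEquiv.coe_coe]
    generalize comul (R := K) y = z
    induction z using TensorProduct.induction_on with
    | zero => simp
    | tmul a b => simp [i1, i2]
    | add a b ha hb => rw [map_add, map_add, map_add, map_add, ← ha, ← hb]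
  -- The right side of the theorem is a left inverse of `Δ`, and `Δ ∘ S` is a right inverse, so they
  -- coincide.
  have hl : toConv (TensorProduct.map S S ∘ₗ (TensorProduct.comm K H H).toLinearMap ∘ₗ comul) *
      (toConv comul : WithConv (H →ₗ[K] H ⊗[K] H)) = 1 := by
    rw [hg, hc, mul_assoc, ← mul_assoc (toConv (i1.toLinearMap ∘ₗ S)), hi, one_mul, hi]
  have := left_inv_eq_right_inv hl (LinearMap.comul_right_inv (R := K) (C := H))
  exact (LinearMap.congr_fun (congrArg ofConv this) x).symm

/-- If a Hopf algebra has an involution `m` which is an antimorphism of algebras and a morphism of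
coalgebras, then it is isomorphic to its coopposite. -/
theorem exists_coopposite_equiv (m : H →ₗ[K] H) (hmm : ∀ x, m (m x) = x)
    (hmul : ∀ x y, m (x * y) = m y * m x)
    (hcounit : ∀ x, counit (R := K) (m x) = counit (R := K) x)
    (hcomul : ∀ x, comul (R := K) (m x) = TensorProduct.map m m (comul (R := K) x)) :
    ∃ ψ : H ≃ₐ[K] H, (∀ x, counit (R := K) (ψ x) = counit (R := K) x) ∧
      ∀ x, comul (R := K) (ψ x) = TensorProduct.map ψ.toLinearMap ψ.toLinearMap
        (TensorProduct.comm K H H (comul (R := K) x)) := by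
  have hone : m 1 = 1 := by
    have := hmul (m 1) 1
    rwa [mul_one, hmm, mul_one, eq_comm] at this
  -- Both `antipode` and `m` reverse products, so `f` preserves them; only `antipode` exchanges the
  -- factors of the coproduct, so `f` does too.
  let f : H →ₐ[K] H := AlgHom.ofLinearMap (antipode K ∘ₗ m)
    (by simp [hone]) (fun x y => by simp [hmul, antipode_mul_antidistrib])
  have hf : ∀ x, f x = antipode K (m x) := fun x => rfl
  have hff : ∀ x, f (f x) = x := by
    -- Bijectivity of the antipode is not assumed. Instead, `S * (f ∘ f) = f ∘ (id * S) ∘ m = 1` for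
    -- convolution, and `id` is also inverse to `S`, whence `f ∘ f = id`.
    have h1 : toConv (antipode K (A := H)) * toConv (f.toLinearMap ∘ₗ f.toLinearMap) = 1 := by
      ext x
      have h2 : ∀ z : H ⊗[K] H, LinearMap.mul' K H (TensorProduct.map (antipode K (A := H))
          (f.toLinearMap ∘ₗ f.toLinearMap) z) = f (LinearMap.mul' K H
            (TensorProduct.map LinearMap.id (antipode K (A := H)) (TensorProduct.map m m z))) := by
        intro z
        induction z using TensorProduct.induction_on with
        | zero => simp
        | tmul a b => simp [hf, hmm, hmul, antipode_mul_antidistrib]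
        | add a b ha hb => simp only [map_add, ha, hb]
      rw [LinearMap.convMul_apply]
      rw [h2, ← hcomul]
      have h3 := LinearMap.congr_fun (congrArg ofConv
        (LinearMap.id_mul_antipode (R := K) (C := H))) (m x)
      have h4 := (LinearMap.convMul_apply (toConv LinearMap.id) (toConv (antipode K (A := H)))
        (m x)).symm.trans h3
      rw [h4]
      simp [LinearMap.convOne_def, hcounit]
    have h2 := left_inv_eq_right_inv
      (LinearMap.id_mul_antipode (R := K) (C := H)) h1
    intro x
    exact (LinearMap.congr_fun (congrArg ofConv h2) x).symm
  refine ⟨AlgEquiv.ofAlgHom f f (AlgHom.ext hff) (AlgHom.ext hff), fun x => ?_, fun x => ?_⟩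
  · change counit (R := K) (f x) = _
    rw [hf, counit_antipode, hcounit]
  · change comul (R := K) (f x) = TensorProduct.map f.toLinearMap f.toLinearMap _
    rw [hf, comul_antipode, hcomul]
    generalize comul (R := K) x = z
    induction z using TensorProduct.induction_on with
    | zero => simp
    | tmul a b => simp [hf]
    | add a b ha hb => simp only [map_add, ha, hb]

end Coopposite

/-! ### Transport of Hopf structures along an isomorphism. -/

section Transport

variable {K : Type v} {H : Type w} {H' : Type u} [Field K] [Ring H] [Ring H'] [Algebra K H]
  [Algebra K H'] [CoalgebraStruct K H]

/-- The coalgebra operations obtained by transport along a linear isomorphism. -/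
@[reducible] def transportCoalgebra (χ : H ≃ₗ[K] H') : CoalgebraStruct K H' where
  comul := TensorProduct.map χ.toLinearMap χ.toLinearMap ∘ₗ CoalgebraStruct.comul ∘ₗ
    χ.symm.toLinearMap
  counit := CoalgebraStruct.counit ∘ₗ χ.symm.toLinearMap

open TensorProduct in
/-- Being a Hopf algebra is invariant under isomorphism. -/
theorem IsHopf.transport (h : IsHopf K H) [CoalgebraStruct K H'] (χ : H ≃ₐ[K] H')
    (hcounit : ∀ x, CoalgebraStruct.counit (R := K) (χ x) = CoalgebraStruct.counit (R := K) x)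
    (hcomul : ∀ x, CoalgebraStruct.comul (R := K) (χ x) =
      TensorProduct.map χ.toLinearMap χ.toLinearMap (CoalgebraStruct.comul (R := K) x)) :
    IsHopf K H' := by
  have surj : ∀ y, ∃ x, χ x = y := χ.surjective
  obtain ⟨S, hS1, hS2⟩ := h.antipode
  refine ⟨?_, ?_, ?_, ?_, ?_, ?_, ?_, χ.toLinearMap ∘ₗ S ∘ₗ χ.symm.toLinearMap, ?_, ?_⟩
  · ext y
    obtain ⟨x, rfl⟩ := surj y
    have h1 : ∀ z : H ⊗[K] H, TensorProduct.assoc K H' H' H'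
        ((CoalgebraStruct.comul (R := K) (A := H')).rTensor H'
          (TensorProduct.map χ.toLinearMap χ.toLinearMap z)) =
        TensorProduct.map χ.toLinearMap (TensorProduct.map χ.toLinearMap χ.toLinearMap)
          (TensorProduct.assoc K H H H ((CoalgebraStruct.comul (R := K) (A := H)).rTensor H z)) := by
      intro z
      induction z using TensorProduct.induction_on with
      | zero => simp
      | tmul a b =>
        simp only [TensorProduct.map_tmul, LinearMap.rTensor_tmul]
        erw [hcomul]
        generalize CoalgebraStruct.comul (R := K) a = t
        induction t using TensorProduct.induction_on with
        | zero => simp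
        | tmul a b => simp
        | add a b ha hb => simp only [map_add, add_tmul, ha, hb]
      | add a b ha hb => simp only [map_add, ha, hb]
    have h2 : ∀ z : H ⊗[K] H, (CoalgebraStruct.comul (R := K) (A := H')).lTensor H'
          (TensorProduct.map χ.toLinearMap χ.toLinearMap z) =
        TensorProduct.map χ.toLinearMap (TensorProduct.map χ.toLinearMap χ.toLinearMap)
          ((CoalgebraStruct.comul (R := K) (A := H)).lTensor H z) := by
      intro z
      induction z using TensorProduct.induction_on with
      | zero => simp
      | tmul a b =>
        simp only [TensorProduct.map_tmul, LinearMap.lTensor_tmul]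
        erw [hcomul]
      | add a b ha hb => simp only [map_add, ha, hb]
    have := LinearMap.congr_fun h.coassoc x
    simp only [LinearMap.comp_apply, LinearEquiv.coe_coe] at this ⊢
    rw [hcomul, h1, h2, this]
  · ext y
    obtain ⟨x, rfl⟩ := surj y
    have h1 : ∀ z : H ⊗[K] H, (CoalgebraStruct.counit (R := K) (A := H')).rTensor H'
          (TensorProduct.map χ.toLinearMap χ.toLinearMap z) =
        χ.toLinearMap.lTensor K ((CoalgebraStruct.counit (R := K) (A := H)).rTensor H z) := by
      intro z
      induction z using TensorProduct.induction_on with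
      | zero => simp
      | tmul a b => simp [hcounit]
      | add a b ha hb => simp only [map_add, ha, hb]
    have := LinearMap.congr_fun h.rTensor_counit x
    simp only [LinearMap.comp_apply] at this ⊢
    rw [hcomul, h1, this]
    simp
  · ext y
    obtain ⟨x, rfl⟩ := surj y
    have h1 : ∀ z : H ⊗[K] H, (CoalgebraStruct.counit (R := K) (A := H')).lTensor H'
          (TensorProduct.map χ.toLinearMap χ.toLinearMap z) =
        χ.toLinearMap.rTensor K ((CoalgebraStruct.counit (R := K) (A := H)).lTensor H z) := by
      intro z
      induction z using TensorProduct.induction_on with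
      | zero => simp
      | tmul a b => simp [hcounit]
      | add a b ha hb => simp only [map_add, ha, hb]
    have := LinearMap.congr_fun h.lTensor_counit x
    simp only [LinearMap.comp_apply] at this ⊢
    rw [hcomul, h1, this]
    simp
  · rw [← map_one χ, hcounit, h.counit_one]
  · intro a b
    obtain ⟨a, rfl⟩ := surj a
    obtain ⟨b, rfl⟩ := surj b
    rw [← map_mul, hcounit, hcounit, hcounit, h.counit_mul]
  · rw [← map_one χ, hcomul, h.comul_one]
    simp [Algebra.TensorProduct.one_def]
  · intro a b
    obtain ⟨a, rfl⟩ := surj a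
    obtain ⟨b, rfl⟩ := surj b
    rw [← map_mul, hcomul, hcomul, hcomul, h.comul_mul]
    exact map_mul (Algebra.TensorProduct.map χ.toAlgHom χ.toAlgHom) _ _
  · ext y
    obtain ⟨x, rfl⟩ := surj y
    have h1 : ∀ z : H ⊗[K] H, LinearMap.mul' K H' ((χ.toLinearMap ∘ₗ S ∘ₗ
        χ.symm.toLinearMap).rTensor H' (TensorProduct.map χ.toLinearMap χ.toLinearMap z)) =
        χ (LinearMap.mul' K H (S.rTensor H z)) := by
      intro z
      induction z using TensorProduct.induction_on with
      | zero => simp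
      | tmul a b => simp
      | add a b ha hb => simp only [map_add, ha, hb]
    have := LinearMap.congr_fun hS1 x
    simp only [LinearMap.comp_apply] at this ⊢
    rw [hcomul]
    refine (h1 _).trans ?_
    rw [this, hcounit]
    simp
  · ext y
    obtain ⟨x, rfl⟩ := surj y
    have h1 : ∀ z : H ⊗[K] H, LinearMap.mul' K H' ((χ.toLinearMap ∘ₗ S ∘ₗ
        χ.symm.toLinearMap).lTensor H' (TensorProduct.map χ.toLinearMap χ.toLinearMap z)) =
        χ (LinearMap.mul' K H (S.lTensor H z)) := by
      intro z
      induction z using TensorProduct.induction_on with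
      | zero => simp
      | tmul a b => simp
      | add a b ha hb => simp only [map_add, ha, hb]
    have := LinearMap.congr_fun hS2 x
    simp only [LinearMap.comp_apply] at this ⊢
    rw [hcomul]
    refine (h1 _).trans ?_
    rw [this, hcounit]
    simp

end Transport

/-! ## Products of finite sums -/

section Products

variable {K : Type v} {A : Type w} [Field K] [Ring A] [Algebra K A]

/-- An ordered product of `n` factors is multilinear in them, so it distributes over sums without
commutativity. This turns products of coproducts into sums over families of cuts or of
factorizations. -/
theorem prod_ofFn_sum_finset {n : ℕ} {ι : Fin n → Type*} (s : ∀ i, Finset (ι i))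
    (f : ∀ i, ι i → A) :
    (List.ofFn fun i => ∑ j ∈ s i, f i j).prod =
      ∑ p ∈ Fintype.piFinset s, (List.ofFn fun i => f i (p i)).prod := by
  have := (MultilinearMap.mkPiAlgebraFin ℤ n A).map_sum_finset f s
  simpa only [MultilinearMap.mkPiAlgebraFin_apply] using this

theorem prod_ofFn_sum {n : ℕ} {ι : Fin n → Type*} [∀ i, Fintype (ι i)] (f : ∀ i, ι i → A) :
    (List.ofFn fun i => ∑ j, f i j).prod = ∑ p : ∀ i, ι i, (List.ofFn fun i => f i (p i)).prod := by
  have := (MultilinearMap.mkPiAlgebraFin ℤ n A).map_sum f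
  simpa only [MultilinearMap.mkPiAlgebraFin_apply] using this

theorem prod_ofFn_tmul {A' : Type*} [Ring A'] [Algebra K A'] {n : ℕ} (a : Fin n → A)
    (b : Fin n → A') :
    (List.ofFn fun i => a i ⊗ₜ[K] b i).prod = (List.ofFn a).prod ⊗ₜ[K] (List.ofFn b).prod := by
  induction n with
  | zero => simp [Algebra.TensorProduct.one_def]
  | succ n ih =>
    rw [List.ofFn_succ, List.prod_cons, ih, Algebra.TensorProduct.tmul_mul_tmul,
      List.ofFn_succ (f := a), List.ofFn_succ (f := b), List.prod_cons, List.prod_cons]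

end Products

theorem map_ofList_flatten {X : Type*} {B : Type*} [Monoid B] (φ : FreeMonoid X →* B)
    (l : List (List X)) :
    φ (FreeMonoid.ofList l.flatten) = (l.map fun k => φ (FreeMonoid.ofList k)).prod := by
  induction l with
  | nil => simp
  | cons a l ih => rw [List.flatten_cons, FreeMonoid.ofList_append, map_mul, ih]; simp

/-! ## Planar forests -/

/-- The arities `n` and `(List.ofFn c).length` are not syntactically equal; passing through the
equivalence of lists with pairs of a length and a tuple avoids casts. It lets trees be treated by
lists of subtrees after a case analysis. -/
theorem PTree.node_eq_graft {D : Type u} (d : D) (n : ℕ) (c : Fin n → PTree D) :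
    PTree.node d n c = PTree.graft d (List.ofFn c) := by
  have h := List.equivSigmaTuple.apply_symm_apply (⟨n, c⟩ : Σ n, Fin n → PTree D)
  exact (congrArg (fun p : Σ n, Fin n → PTree D => PTree.node d p.1 p.2) h).symm

theorem PTree.size_graft {D : Type u} (d : D) (l : List (PTree D)) :
    (PTree.graft d l).size = 1 + (l.map PTree.size).sum := by
  rw [PTree.graft, PTree.size, ← List.sum_ofFn]
  congr 2
  rw [← Function.comp_def, ← List.map_ofFn, List.ofFn_get]

/-- Induction on planar forests: adding a root, and concatenation. -/
theorem PForest.induction {D : Type u} {P : PForest D → Prop} (one : P 1)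
    (graft : ∀ d F, P F → P (FreeMonoid.of (PTree.graft d F.toList)))
    (mul : ∀ t F, P (FreeMonoid.of t) → P F → P (FreeMonoid.of t * F)) (F : PForest D) : P F := by
  have list : ∀ l : List (PTree D), (∀ t ∈ l, P (FreeMonoid.of t)) → P (FreeMonoid.ofList l) := by
    intro l
    induction l with
    | nil => intro _; exact one
    | cons t l ih =>
      intro h
      exact mul t _ (h t List.mem_cons_self) (ih fun s hs => h s (List.mem_cons_of_mem _ hs))
  have tree : ∀ t : PTree D, P (FreeMonoid.of t) := by
    intro t
    induction t with
    | node d n c ih =>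
      rw [PTree.node_eq_graft]
      refine graft d (FreeMonoid.ofList (List.ofFn c)) (list _ fun t ht => ?_)
      obtain ⟨i, rfl⟩ := List.mem_ofFn.mp ht
      exact ih i
  exact list F.toList fun t _ => tree t

namespace PForest

variable {D : Type u}

theorem size_of (t : PTree D) : PForest.size (FreeMonoid.of t) = t.size := by
  simp [PForest.size]

theorem size_mul (F G : PForest D) : (F * G).size = F.size + G.size := by
  simp [PForest.size]

theorem size_of_graft (d : D) (F : PForest D) :
    PForest.size (FreeMonoid.of (PTree.graft d F.toList)) = 1 + F.size := by
  rw [size_of, PTree.size_graft]; rfl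

/-- Connectedness of the filtration: every tree has at least its root. -/
theorem eq_one_of_size_eq_zero (F : PForest D) (h : F.size = 0) : F = 1 := by
  rcases hF : F.toList with _ | ⟨t, l⟩
  · exact hF
  · cases t
    rw [PForest.size, hF] at h
    simp [PTree.size] at h

end PForest

/-! ## The Hopf algebra of planar forests -/

namespace NCK

variable {K : Type v} {D : Type u} [Field K]

theorem E_one : E K D 1 = 1 := MonoidAlgebra.basis_apply _ _

theorem E_mul (F G : PForest D) : E K D (F * G) = E K D F * E K D G := by
  change MonoidAlgebra.basis _ _ _ = MonoidAlgebra.basis _ _ _ * MonoidAlgebra.basis _ _ _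
  simp only [MonoidAlgebra.basis_apply]
  exact ((MonoidAlgebra.single_mul_single ..).trans (by rw [mul_one])).symm

/-- The basis, as a morphism of monoids. -/
def EHom : PForest D →* NCK K D where
  toFun := E K D
  map_one' := E_one
  map_mul' := E_mul

theorem lift_E {B : Type w} [Ring B] [Algebra K B] (φ : PTree D → B) (F : PForest D) :
    lift K D φ (E K D F) = FreeMonoid.lift φ F := by
  change MonoidAlgebra.lift K B (PForest D) (FreeMonoid.lift φ) (MonoidAlgebra.basis _ _ _) = _
  rw [MonoidAlgebra.basis_apply, MonoidAlgebra.lift_single, one_smul]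

theorem lift_E_of {B : Type w} [Ring B] [Algebra K B] (φ : PTree D → B) (t : PTree D) :
    lift K D φ (E K D (FreeMonoid.of t)) = φ t := by
  rw [lift_E, FreeMonoid.lift_eval_of]

/-- Linear maps that are multiplicative on the basis are algebra morphisms. -/
def algHomOfBasis {B : Type w} [Ring B] [Algebra K B] (f : NCK K D →ₗ[K] B)
    (h1 : f (E K D 1) = 1)
    (hm : ∀ F G, f (E K D (F * G)) = f (E K D F) * f (E K D G)) : NCK K D →ₐ[K] B :=
  AlgHom.ofLinearMap f (by rw [← h1, E_one]) (by
    have : (LinearMap.mul K (NCK K D)).compr₂ f = (LinearMap.mul K B).compl₁₂ f f :=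
      (E K D).ext fun F => (E K D).ext fun G => by
        simp only [LinearMap.compr₂_apply, LinearMap.mul_apply', LinearMap.compl₁₂_apply]
        rw [← E_mul, hm]
    exact fun x y => LinearMap.congr_fun₂ this x y)

theorem linearMap_ext {M : Type*} [AddCommGroup M] [Module K M] {f g : NCK K D →ₗ[K] M}
    (h : ∀ F, f (E K D F) = g (E K D F)) : f = g := (E K D).ext h

theorem algHom_ext {B : Type w} [Ring B] [Algebra K B] {f g : NCK K D →ₐ[K] B}
    (h : ∀ F, f (E K D F) = g (E K D F)) : f = g :=
  AlgHom.toLinearMap_injective (linearMap_ext h)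

variable (K D) in
/-- The coproduct, as an algebra morphism. -/
def comulHom : NCK K D →ₐ[K] NCK K D ⊗[K] NCK K D :=
  lift K D fun t => ∑ c : PTree.Cut t, E K D (FreeMonoid.ofList (PTree.pruned t c)) ⊗ₜ[K]
      E K D (FreeMonoid.ofList (PTree.trunk t c))

variable (K D) in
/-- The counit, as an algebra morphism. -/
def counitHom : NCK K D →ₐ[K] K := lift K D fun _ => (0 : K)

theorem comul_apply (x : NCK K D) : CoalgebraStruct.comul (R := K) x = comulHom K D x := rfl

/-- The grafting operator, which adds a root decorated by `d` to a forest. -/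
def graftMap (d : D) : NCK K D →ₗ[K] NCK K D :=
  (E K D).constr K fun F => E K D (FreeMonoid.of (PTree.graft d F.toList))

theorem graftMap_E (d : D) (F : PForest D) :
    graftMap d (E K D F) = E K D (FreeMonoid.of (PTree.graft d F.toList)) :=
  (E K D).constr_basis K _ F

/-- Multiplicativity lets each tree be cut independently. The index set is the set of non-total cuts
of the tree obtained by adding a root, which is what the cocycle identity uses. -/
theorem comulHom_ofFn {n : ℕ} (c : Fin n → PTree D) :
    comulHom K D (E K D (FreeMonoid.ofList (List.ofFn c))) =
      ∑ k : ∀ i, PTree.Cut (c i),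
        E K D (FreeMonoid.ofList (List.ofFn fun i => PTree.pruned (c i) (k i)).flatten) ⊗ₜ[K]
          E K D (FreeMonoid.ofList (List.ofFn fun i => PTree.trunk (c i) (k i)).flatten) := by
  rw [comulHom, lift_E, FreeMonoid.lift_apply, FreeMonoid.toList_ofList, List.map_ofFn,
    Function.comp_def, prod_ofFn_sum]
  refine Finset.sum_congr rfl fun k _ => ?_
  rw [prod_ofFn_tmul]
  congr 1
  · refine Eq.trans ?_ (map_ofList_flatten EHom _).symm
    rw [List.map_ofFn]; rfl
  · refine Eq.trans ?_ (map_ofList_flatten EHom _).symm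
    rw [List.map_ofFn]; rfl

/-- The grafting operators are Hochschild cocycles. -/
theorem comulHom_graftMap (d : D) (x : NCK K D) : comulHom K D (graftMap d x) =
    graftMap d x ⊗ₜ[K] 1 + (graftMap d).lTensor (NCK K D) (comulHom K D x) := by
  suffices H : (comulHom K D).toLinearMap ∘ₗ graftMap d =
      (TensorProduct.mk K (NCK K D) (NCK K D)).flip 1 ∘ₗ graftMap d +
        (graftMap d).lTensor (NCK K D) ∘ₗ (comulHom K D).toLinearMap from LinearMap.congr_fun H x
  refine linearMap_ext fun F => ?_
  simp only [LinearMap.comp_apply, LinearMap.add_apply, LinearMap.flip_apply,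
    TensorProduct.mk_apply, AlgHom.toLinearMap_apply, graftMap_E]
  have h1 := comulHom_ofFn (K := K) (List.get F.toList)
  rw [List.ofFn_get, FreeMonoid.ofList_toList] at h1
  rw [h1, comulHom, lift_E_of, map_sum]
  simp only [LinearMap.lTensor_tmul, graftMap_E]
  -- The total cut gives the term with `1` on the right; the other cuts keep the new root, hence
  -- graft the trunk factor.
  refine (Fintype.sum_option (α := ∀ i, PTree.Cut (List.get F.toList i)) _).trans ?_
  rw [← E_one]
  rfl

theorem counitHom_graftMap (d : D) (x : NCK K D) : counitHom K D (graftMap d x) = 0 := by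
  suffices H : (counitHom K D).toLinearMap ∘ₗ graftMap d = 0 from LinearMap.congr_fun H x
  refine linearMap_ext fun F => ?_
  simp only [LinearMap.comp_apply, graftMap_E, AlgHom.toLinearMap_apply, counitHom, lift_E_of,
    LinearMap.zero_apply]

/-- Two algebra morphisms agree if their equality is preserved by the grafting operators. -/
theorem algHom_ext_graft {B : Type w} [Ring B] [Algebra K B] {f g : NCK K D →ₐ[K] B}
    (h : ∀ d x, f x = g x → f (graftMap d x) = g (graftMap d x)) : f = g := by
  refine algHom_ext fun F => ?_
  induction F using PForest.induction with
  | one => rw [E_one, map_one, map_one]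
  | graft d F ih => rw [← graftMap_E]; exact h d _ ih
  | mul t F ht hF => rw [E_mul, map_mul, map_mul, ht, hF]

-- Write `B` for grafting. By the cocycle identity, the left side at `B x` is `Δ(B x) ⊗ 1` plus `id
-- ⊗ id ⊗ B` applied to the left side at `x`. The right side is `B x ⊗ 1 ⊗ 1 + (id ⊗ B) Δ x ⊗ 1`
-- plus the same operator applied to the right side at `x`. The last parts agree by induction, the
-- others by the cocycle identity once more.
open Algebra.TensorProduct in
theorem comulHom_coassoc :
    (Algebra.TensorProduct.assoc K K K (NCK K D) (NCK K D) (NCK K D)).toAlgHom.comp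
      ((Algebra.TensorProduct.map (comulHom K D) (AlgHom.id K _)).comp (comulHom K D)) =
    (Algebra.TensorProduct.map (AlgHom.id K _) (comulHom K D)).comp (comulHom K D) := by
  refine algHom_ext_graft fun d x hx => ?_
  simp only [AlgHom.comp_apply] at hx ⊢
  rw [comulHom_graftMap, map_add, map_add, map_add]
  have h1 : ∀ z : NCK K D ⊗[K] NCK K D,
      (Algebra.TensorProduct.assoc K K K (NCK K D) (NCK K D) (NCK K D)).toAlgHom
        (Algebra.TensorProduct.map (comulHom K D) (AlgHom.id K _)
          ((graftMap d).lTensor (NCK K D) z)) =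
      ((graftMap d).lTensor (NCK K D)).lTensor (NCK K D)
        ((Algebra.TensorProduct.assoc K K K (NCK K D) (NCK K D) (NCK K D)).toAlgHom
          (Algebra.TensorProduct.map (comulHom K D) (AlgHom.id K _) z)) := by
    intro z
    induction z using TensorProduct.induction_on with
    | zero => simp
    | tmul a b =>
      simp only [LinearMap.lTensor_tmul, Algebra.TensorProduct.map_tmul, AlgHom.id_apply]
      generalize comulHom K D a = t
      induction t using TensorProduct.induction_on with
      | zero => simp
      | tmul a b => simp
      | add a b ha hb => simp only [map_add, TensorProduct.add_tmul, ha, hb]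
    | add a b ha hb => simp only [map_add, ha, hb]
  have h2 : ∀ z : NCK K D ⊗[K] NCK K D,
      Algebra.TensorProduct.map (AlgHom.id K _) (comulHom K D)
          ((graftMap d).lTensor (NCK K D) z) =
      Algebra.TensorProduct.assoc K K K (NCK K D) (NCK K D) (NCK K D)
        ((graftMap d).lTensor (NCK K D) z ⊗ₜ 1) +
      ((graftMap d).lTensor (NCK K D)).lTensor (NCK K D)
        (Algebra.TensorProduct.map (AlgHom.id K _) (comulHom K D) z) := by
    intro z
    induction z using TensorProduct.induction_on with
    | zero => simp
    | tmul a b =>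
      simp only [LinearMap.lTensor_tmul, Algebra.TensorProduct.map_tmul, AlgHom.id_apply,
        comulHom_graftMap, TensorProduct.tmul_add, Algebra.TensorProduct.assoc_tmul]
    | add a b ha hb =>
      simp only [map_add, TensorProduct.add_tmul, ha, hb]; abel
  rw [h1, hx, h2]
  simp only [Algebra.TensorProduct.map_tmul, comulHom_graftMap, map_one, AlgHom.id_apply,
    TensorProduct.add_tmul, map_add, Algebra.TensorProduct.one_def]
  rw [add_assoc]
  simp

theorem counitHom_rTensor :
    (Algebra.TensorProduct.map (counitHom K D) (AlgHom.id K _)).comp (comulHom K D) =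
      Algebra.TensorProduct.includeRight := by
  refine algHom_ext_graft fun d x hx => ?_
  simp only [AlgHom.comp_apply, Algebra.TensorProduct.includeRight_apply] at hx ⊢
  have h : ∀ z : NCK K D ⊗[K] NCK K D, Algebra.TensorProduct.map (counitHom K D) (AlgHom.id K _)
      ((graftMap d).lTensor (NCK K D) z) = (graftMap d).lTensor K
        (Algebra.TensorProduct.map (counitHom K D) (AlgHom.id K _) z) := by
    intro z
    induction z using TensorProduct.induction_on with
    | zero => simp
    | tmul a b => simp
    | add a b ha hb => simp only [map_add, ha, hb]
  rw [comulHom_graftMap, map_add, h, hx]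
  simp [counitHom_graftMap]

/-- Unlike on the other side, no induction hypothesis is needed: the counit kills every grafted
tree, and only the total cut `B x ⊗ 1` survives. -/
theorem counitHom_lTensor :
    (Algebra.TensorProduct.map (AlgHom.id K _) (counitHom K D)).comp (comulHom K D) =
      (Algebra.TensorProduct.includeLeft : NCK K D →ₐ[K] NCK K D ⊗[K] K) := by
  refine algHom_ext_graft fun d x _ => ?_
  simp only [AlgHom.comp_apply, Algebra.TensorProduct.includeLeft_apply]
  have h : ∀ z : NCK K D ⊗[K] NCK K D, Algebra.TensorProduct.map (AlgHom.id K _) (counitHom K D)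
      ((graftMap d).lTensor (NCK K D) z) = 0 := by
    intro z
    induction z using TensorProduct.induction_on with
    | zero => simp
    | tmul a b => simp [counitHom_graftMap]
    | add a b ha hb => simp only [map_add, ha, hb, add_zero]
  rw [comulHom_graftMap, map_add, h]
  simp

variable (K D) in
/-- The bialgebra of planar forests. -/
@[reducible] def bialgebra : Bialgebra K (NCK K D) :=
  Bialgebra.ofAlgHom (comulHom K D) (counitHom K D) comulHom_coassoc counitHom_rTensor
    counitHom_lTensor

end NCK

/-- The span of the tensor products of basis elements of total size at most `n`. -/
def tensorFiltration {K : Type v} {H : Type w} [Field K] [Ring H] [Algebra K H] {ι : Type*}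
    (b : ι → H) (size : ι → ℕ) (n : ℕ) : Submodule K (H ⊗[K] H) :=
  Submodule.span K {z | ∃ j k, size j + size k ≤ n ∧ z = b j ⊗ₜ[K] b k}

/-- Since sizes add under products of basis indices, the compatibility of a multiplicative coproduct
with the filtration has to be checked on one-letter forests only. -/
theorem mul_mem_tensorFiltration {K : Type v} {H : Type w} [Field K] [Ring H] [Algebra K H]
    {ι : Type*} [Mul ι] {b : ι → H} {size : ι → ℕ} (hb : ∀ i j, b (i * j) = b i * b j)
    (hs : ∀ i j, size (i * j) = size i + size j) {m n : ℕ} {x y : H ⊗[K] H}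
    (hx : x ∈ tensorFiltration (K := K) b size m) (hy : y ∈ tensorFiltration (K := K) b size n) :
    x * y ∈ tensorFiltration (K := K) b size (m + n) := by
  have h := Submodule.mul_mem_mul hx hy
  rw [tensorFiltration, tensorFiltration, Submodule.span_mul_span] at h
  refine Submodule.span_mono ?_ h
  rintro _ ⟨_, ⟨j, k, hjk, rfl⟩, _, ⟨j', k', hjk', rfl⟩, rfl⟩
  refine ⟨j * j', k * k', by rw [hs, hs]; omega, ?_⟩
  change _ * _ = _
  rw [Algebra.TensorProduct.tmul_mul_tmul, hb, hb]

namespace NCK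

variable {K : Type v} {D : Type u} [Field K]

/-- Each of the two terms of the cocycle identity adds exactly one node in one tensor factor,
matching the node added to the forest. -/
theorem comulHom_mem (F : PForest D) :
    comulHom K D (E K D F) ∈ tensorFiltration (K := K) (E K D) PForest.size F.size := by
  induction F using PForest.induction with
  | one =>
    rw [E_one, map_one, Algebra.TensorProduct.one_def, ← E_one]
    exact Submodule.subset_span ⟨1, 1, le_of_eq rfl, rfl⟩
  | graft d F ih =>
    rw [← graftMap_E, comulHom_graftMap, PForest.size_of_graft]
    refine Submodule.add_mem _ ?_ ?_
    · rw [graftMap_E, ← E_one]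
      exact Submodule.subset_span ⟨_, 1, by rw [PForest.size_of_graft]; rfl, rfl⟩
    · have h := Submodule.mem_map_of_mem (f := (graftMap d).lTensor (NCK K D)) ih
      rw [tensorFiltration, Submodule.map_span] at h
      refine Submodule.span_mono ?_ h
      rintro _ ⟨_, ⟨j, k, hjk, rfl⟩, rfl⟩
      refine ⟨j, FreeMonoid.of (PTree.graft d k.toList), ?_, ?_⟩
      · rw [PForest.size_of_graft]; omega
      · rw [LinearMap.lTensor_tmul, graftMap_E]
  | mul t F ht hF =>
    rw [E_mul, map_mul, PForest.size_mul]
    exact mul_mem_tensorFiltration E_mul PForest.size_mul ht hF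

variable (K D) in
/-- Foissy's algebra of planar forests is a Hopf algebra. -/
theorem isHopf : IsHopf K (NCK K D) := by
  let _ := bialgebra K D
  refine IsHopf.of_filtration (E K D) PForest.size (fun F hF => ?_) comulHom_mem
  rw [PForest.eq_one_of_size_eq_zero F hF, E_one, Bialgebra.counit_one, map_one]

end NCK

/-! ### The mirror involution and the coopposite of planar forests. -/

/-- The mirror image of a planar tree. -/
def PTree.mirror {D : Type u} : PTree D → PTree D
  | node d n c => node d n fun i => mirror (c i.rev)

theorem PTree.mirror_mirror {D : Type u} (t : PTree D) : t.mirror.mirror = t := by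
  induction t with
  | node d n c ih => simp [mirror, ih]

theorem ofFn_comp_rev {X : Type*} {n : ℕ} (f : Fin n → X) :
    (List.ofFn fun i => f i.rev) = (List.ofFn f).reverse := by
  refine List.ext_getElem (by simp) fun i h1 h2 => ?_
  simp only [List.getElem_ofFn, List.getElem_reverse]
  congr 1
  ext
  simp [Fin.val_rev]
  omega

theorem PTree.mirror_graft {D : Type u} (d : D) (l : List (PTree D)) :
    (PTree.graft d l).mirror = PTree.graft d (l.reverse.map PTree.mirror) := by
  rw [PTree.graft, PTree.mirror, PTree.node_eq_graft, ofFn_comp_rev (fun i => (l.get i).mirror),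
    ← Function.comp_def, ← List.map_ofFn, List.ofFn_get, List.map_reverse]

/-- The mirror image of a planar forest. -/
def PForest.mirror {D : Type u} (F : PForest D) : PForest D :=
  FreeMonoid.ofList (F.toList.reverse.map PTree.mirror)

namespace NCK

variable {K : Type v} {D : Type u} [Field K]

/-- The linear map exchanging a forest and its mirror image. -/
def mirrorMap : NCK K D →ₗ[K] NCK K D := (E K D).constr K fun F => E K D F.mirror

theorem mirrorMap_E (F : PForest D) : mirrorMap (E K D F) = E K D F.mirror :=
  (E K D).constr_basis K _ F

theorem mirrorMap_mirrorMap (x : NCK K D) : mirrorMap (mirrorMap x) = x := by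
  suffices H : mirrorMap ∘ₗ mirrorMap = (LinearMap.id : NCK K D →ₗ[K] NCK K D) from
    LinearMap.congr_fun H x
  refine linearMap_ext fun F => ?_
  simp only [LinearMap.comp_apply, mirrorMap_E, LinearMap.id_apply]
  congr 1
  simp [PForest.mirror, Function.comp_def, PTree.mirror_mirror]

theorem mirrorMap_mul (x y : NCK K D) : mirrorMap (x * y) = mirrorMap y * mirrorMap x := by
  have : (LinearMap.mul K (NCK K D)).compr₂ mirrorMap =
      (LinearMap.mul K (NCK K D)).flip.compl₁₂ mirrorMap mirrorMap :=
    (E K D).ext fun F => (E K D).ext fun G => by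
      simp only [LinearMap.compr₂_apply, LinearMap.mul_apply', LinearMap.compl₁₂_apply,
        LinearMap.flip_apply]
      rw [← E_mul, mirrorMap_E, mirrorMap_E, mirrorMap_E, ← E_mul]
      simp [PForest.mirror]
  exact LinearMap.congr_fun₂ this x y

theorem mirrorMap_one : mirrorMap (1 : NCK K D) = 1 := by
  rw [← E_one, mirrorMap_E]; rfl

theorem mirrorMap_graftMap (d : D) (x : NCK K D) :
    mirrorMap (graftMap d x) = graftMap d (mirrorMap x) := by
  suffices H : mirrorMap ∘ₗ graftMap d = graftMap (K := K) d ∘ₗ mirrorMap from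
    LinearMap.congr_fun H x
  refine linearMap_ext fun F => ?_
  simp only [LinearMap.comp_apply, mirrorMap_E, graftMap_E]
  congr 1
  simp [PForest.mirror, PTree.mirror_graft]

theorem counit_mirrorMap (x : NCK K D) :
    counitHom K D (mirrorMap x) = counitHom K D x := by
  suffices H : (counitHom K D).toLinearMap ∘ₗ mirrorMap = (counitHom K D).toLinearMap from
    LinearMap.congr_fun H x
  refine linearMap_ext fun F => ?_
  simp only [LinearMap.comp_apply, AlgHom.toLinearMap_apply]
  induction F using PForest.induction with
  | one => rw [E_one, mirrorMap_one]
  | graft d F ih => rw [← graftMap_E, mirrorMap_graftMap, counitHom_graftMap, counitHom_graftMap]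
  | mul t F ht hF => rw [E_mul, mirrorMap_mul, map_mul, map_mul, ht, hF, mul_comm]

/-- Reflection reverses left and right but respects what lies above or below a cut, so the tensor
factors are not exchanged. It commutes with grafting, which handles the cocycle identity; for
products, its tensor square is an antimorphism, like the reflection itself. -/
theorem comul_mirrorMap (x : NCK K D) :
    comulHom K D (mirrorMap x) = TensorProduct.map mirrorMap mirrorMap (comulHom K D x) := by
  have anti : ∀ a b : NCK K D ⊗[K] NCK K D, TensorProduct.map mirrorMap mirrorMap (a * b) =
      TensorProduct.map mirrorMap mirrorMap b * TensorProduct.map mirrorMap mirrorMap a := by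
    intro a b
    induction a using TensorProduct.induction_on with
    | zero => simp
    | add a a' ha ha' => rw [add_mul, map_add, map_add, mul_add, ha, ha']
    | tmul a a' =>
      induction b using TensorProduct.induction_on with
      | zero => simp
      | add b b' hb hb' => rw [mul_add, map_add, map_add, add_mul, hb, hb']
      | tmul b b' => simp [mirrorMap_mul]
  suffices H : (comulHom K D).toLinearMap ∘ₗ mirrorMap =
      TensorProduct.map mirrorMap mirrorMap ∘ₗ (comulHom K D).toLinearMap from
    LinearMap.congr_fun H x
  refine linearMap_ext fun F => ?_
  simp only [LinearMap.comp_apply, AlgHom.toLinearMap_apply]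
  induction F using PForest.induction with
  | one =>
    rw [E_one, mirrorMap_one, map_one, Algebra.TensorProduct.one_def, TensorProduct.map_tmul,
      mirrorMap_one]
  | graft d F ih =>
    rw [← graftMap_E, mirrorMap_graftMap, comulHom_graftMap, comulHom_graftMap, ih, map_add,
      TensorProduct.map_tmul, mirrorMap_graftMap, mirrorMap_one]
    congr 1
    generalize comulHom K D (E K D F) = z
    induction z using TensorProduct.induction_on with
    | zero => simp
    | add a b ha hb => simp only [map_add, ha, hb]
    | tmul a b => simp [mirrorMap_graftMap]
  | mul t F ht hF => rw [E_mul, mirrorMap_mul, map_mul, map_mul, anti, ht, hF]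

variable (K D) in
/-- The Hopf algebra of planar forests is isomorphic to its coopposite. -/
theorem exists_equiv_coopposite : ∃ ψ : NCK K D ≃ₐ[K] NCK K D,
    (∀ x, CoalgebraStruct.counit (R := K) (ψ x) = CoalgebraStruct.counit (R := K) x) ∧
    ∀ x, CoalgebraStruct.comul (R := K) (ψ x) =
      TensorProduct.map ψ.toLinearMap ψ.toLinearMap (comulOpp K D x) := by
  let _ := (isHopf K D).toHopfAlgebra
  exact exists_coopposite_equiv (mirrorMap : NCK K D →ₗ[K] NCK K D) mirrorMap_mirrorMap
    mirrorMap_mul counit_mirrorMap comul_mirrorMap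

end NCK

/-! ## The bialgebra of words of terms -/

/-- The algebra with basis the words on `X`. -/
abbrev WordAlg (K : Type v) (X : Type u) [Field K] : Type (max u v) :=
  MonoidAlgebra K (FreeMonoid X)

namespace WordAlg

variable {K : Type v} {X : Type u} [Field K]

/-- The basis element indexed by a word. -/
def word : FreeMonoid X →* WordAlg K X := MonoidAlgebra.of K (FreeMonoid X)

/-- The algebra morphism with given values on letters. -/
def lift {B : Type w} [Ring B] [Algebra K B] (φ : X → B) : WordAlg K X →ₐ[K] B :=
  MonoidAlgebra.lift K B (FreeMonoid X) (FreeMonoid.lift φ)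

theorem lift_word {B : Type w} [Ring B] [Algebra K B] (φ : X → B) (F : FreeMonoid X) :
    lift φ (word (K := K) F) = FreeMonoid.lift φ F := MonoidAlgebra.lift_of _ _

theorem lift_word_of {B : Type w} [Ring B] [Algebra K B] (φ : X → B) (x : X) :
    lift φ (word (K := K) (FreeMonoid.of x)) = φ x := by
  rw [lift_word, FreeMonoid.lift_eval_of]

theorem lift_word_ofFn {B : Type w} [Ring B] [Algebra K B] (φ : X → B) {n : ℕ} (c : Fin n → X) :
    lift φ (word (K := K) (FreeMonoid.ofList (List.ofFn c))) =
      (List.ofFn fun i => φ (c i)).prod := by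
  rw [lift_word, FreeMonoid.lift_apply, FreeMonoid.toList_ofList, List.map_ofFn,
    Function.comp_def]

theorem linearMap_ext {M : Type*} [AddCommGroup M] [Module K M] {f g : WordAlg K X →ₗ[K] M}
    (h : ∀ F, f (word F) = g (word F)) : f = g :=
  (MonoidAlgebra.basis (FreeMonoid X) K).ext fun F => by
    rw [MonoidAlgebra.basis_apply]; exact h F

end WordAlg

open WordAlg

section Words

variable {K : Type v} {S : ℕ → Type u} [Field K]

/-- Structural induction for algebra morphisms. The hypothesis at a node concerns the whole word of
its subterms rather than each subterm, because `nodeMap` acts on words. -/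
theorem wordAlg_term_ext {B : Type w} [Ring B] [Algebra K B] {f h : WordAlg K (Term S) →ₐ[K] B}
    (hleaf : f (word (FreeMonoid.of Term.leaf)) = h (word (FreeMonoid.of Term.leaf)))
    (hnode : ∀ n (g : S n) (c : Fin n → Term S),
      f (word (FreeMonoid.ofList (List.ofFn c))) = h (word (FreeMonoid.ofList (List.ofFn c))) →
      f (word (FreeMonoid.of (Term.node n g c))) = h (word (FreeMonoid.of (Term.node n g c)))) :
    f = h := by
  have list : ∀ l : List (Term S),
      (∀ t ∈ l, f (word (FreeMonoid.of t)) = h (word (FreeMonoid.of t))) →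
      f (word (FreeMonoid.ofList l)) = h (word (FreeMonoid.ofList l)) := by
    intro l
    induction l with
    | nil => intro _; rw [FreeMonoid.ofList_nil, map_one, map_one, map_one]
    | cons t l ih =>
      intro H
      rw [FreeMonoid.ofList_cons, map_mul, map_mul, map_mul, H t List.mem_cons_self,
        ih fun s hs => H s (List.mem_cons_of_mem _ hs)]
  have term : ∀ t : Term S, f (word (FreeMonoid.of t)) = h (word (FreeMonoid.of t)) := by
    intro t
    induction t with
    | leaf => exact hleaf
    | node n g c ih =>
      refine hnode n g c (list _ fun t ht => ?_)
      obtain ⟨i, rfl⟩ := List.mem_ofFn.mp ht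
      exact ih i
  exact AlgHom.toLinearMap_injective (linearMap_ext fun F => list F.toList fun t _ => term t)

variable (K S) in
/-- The coproduct of words of terms, which does not delete the leaves. -/
def wordComul : WordAlg K (Term S) →ₐ[K] WordAlg K (Term S) ⊗[K] WordAlg K (Term S) :=
  WordAlg.lift fun x => ∑ p ∈ Term.factorizations x,
    word (FreeMonoid.of p.1) ⊗ₜ[K] word (FreeMonoid.ofList p.2)

/-- The operator which grafts the words of length `n` on a root `g`. -/
def nodeMap (n : ℕ) (g : S n) : WordAlg K (Term S) →ₗ[K] WordAlg K (Term S) :=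
  (MonoidAlgebra.basis (FreeMonoid (Term S)) K).constr K fun F =>
    if h : n = F.toList.length then
      word (FreeMonoid.of (Term.node n g fun i => F.toList.get (i.cast h)))
    else 0

theorem nodeMap_word (n : ℕ) (g : S n) (F : FreeMonoid (Term S)) :
    nodeMap (K := K) n g (word F) = if h : n = F.toList.length then
      word (FreeMonoid.of (Term.node n g fun i => F.toList.get (i.cast h))) else 0 := by
  have h : word (K := K) F = MonoidAlgebra.basis (FreeMonoid (Term S)) K F :=
    (MonoidAlgebra.basis_apply K F).symm
  rw [nodeMap, h, Module.Basis.constr_basis]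

theorem nodeMap_ofFn (n : ℕ) (g : S n) (c : Fin n → Term S) :
    nodeMap (K := K) n g (word (FreeMonoid.ofList (List.ofFn c))) =
      word (FreeMonoid.of (Term.node n g c)) := by
  rw [nodeMap_word, dif_pos (by simp)]
  congr 3
  funext i
  simp
  rfl

theorem nodeMap_ofFn_ne {m n : ℕ} (h : n ≠ m) (g : S n) (c : Fin m → Term S) :
    nodeMap (K := K) n g (word (FreeMonoid.ofList (List.ofFn c))) = 0 := by
  rw [nodeMap_word, dif_neg (by simpa using h)]

theorem wordComul_leaf : wordComul K S (word (FreeMonoid.of Term.leaf)) =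
    word (FreeMonoid.of Term.leaf) ⊗ₜ[K] word (FreeMonoid.of Term.leaf) := by
  rw [wordComul, lift_word_of, Term.factorizations, Finset.sum_singleton]
  rfl

theorem wordComul_ofFn {n : ℕ} (c : Fin n → Term S) :
    wordComul K S (word (FreeMonoid.ofList (List.ofFn c))) =
      ∑ p ∈ Fintype.piFinset fun i => Term.factorizations (c i),
        word (FreeMonoid.ofList (List.ofFn fun i => (p i).1)) ⊗ₜ[K]
          word (FreeMonoid.ofList (List.ofFn fun i => (p i).2).flatten) := by
  rw [wordComul, lift_word_ofFn, prod_ofFn_sum_finset]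
  refine Finset.sum_congr rfl fun p _ => ?_
  rw [prod_ofFn_tmul]
  congr 1
  · have : (fun i => word (K := K) (FreeMonoid.of (p i).1)) =
        fun i => word (FreeMonoid.ofList [(p i).1]) := rfl
    rw [this]
    have h := map_ofList_flatten (word (K := K)) ((List.ofFn fun i => (p i).1).map fun t => [t])
    rw [List.map_ofFn, List.map_ofFn] at h
    refine h.symm.trans ?_
    congr 2
    rw [← Function.comp_def, ← List.map_ofFn]
    rw [← List.flatMap_def, List.flatMap_singleton']
  · refine Eq.trans ?_ (map_ofList_flatten word _).symm
    rw [List.map_ofFn]; rfl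

/-- A factorization of a node either has the leaf as its lower part, or keeps the root and consists
of one factorization per subterm; in the latter case only the lower factor receives the root. -/
theorem wordComul_node (n : ℕ) (g : S n) (c : Fin n → Term S) :
    wordComul K S (word (FreeMonoid.of (Term.node n g c))) =
      word (FreeMonoid.of Term.leaf) ⊗ₜ[K] word (FreeMonoid.of (Term.node n g c)) +
        (nodeMap n g).rTensor _ (wordComul K S (word (FreeMonoid.ofList (List.ofFn c)))) := by
  classical
  rw [wordComul_ofFn, wordComul, lift_word_of, Term.factorizations]
  rw [Finset.sum_insert]
  · congr 1
    rw [map_sum, Finset.sum_image]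
    · refine Finset.sum_congr rfl fun p _ => ?_
      rw [LinearMap.rTensor_tmul, nodeMap_ofFn]
    -- Distinct families give distinct factorizations: equal lower parts have equal arities, and
    -- these lengths tell where to cut the common concatenated word.
    · intro p hp q hq hpq
      simp only [Prod.mk.injEq, Term.node.injEq, heq_eq_eq, true_and] at hpq
      have hp' := fun i => (Term.mem_factorizations _ _ _).mp (Fintype.mem_piFinset.mp hp i)
      have hq' := fun i => (Term.mem_factorizations _ _ _).mp (Fintype.mem_piFinset.mp hq i)
      funext i
      refine Prod.ext (congrFun hpq.1 i) ?_
      have h1 := Term.slice_flatten (fun i => (p i).2) i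
      have h2 := Term.slice_flatten (fun i => (q i).2) i
      have h3 : ∀ i, (p i).2.length = (q i).2.length := fun i => by
        rw [(hp' i).1, (hq' i).1, congrFun hpq.1 i]
      rw [← h1, ← h2, hpq.2]
      simp only [h3]
  · simp

/-- The cocycle identity for all words, including those of the wrong length, so that it can be used
under tensor products and not just on terms. -/
theorem wordComul_nodeMap (n : ℕ) (g : S n) (x : WordAlg K (Term S)) :
    wordComul K S (nodeMap n g x) =
      word (FreeMonoid.of Term.leaf) ⊗ₜ[K] nodeMap n g x +
        (nodeMap n g).rTensor _ (wordComul K S x) := by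
  suffices H : (wordComul K S).toLinearMap ∘ₗ nodeMap n g =
      TensorProduct.mk K _ _ (word (FreeMonoid.of Term.leaf)) ∘ₗ nodeMap n g +
        (nodeMap n g).rTensor _ ∘ₗ (wordComul K S).toLinearMap from LinearMap.congr_fun H x
  refine linearMap_ext fun F => ?_
  simp only [LinearMap.comp_apply, LinearMap.add_apply, TensorProduct.mk_apply,
    AlgHom.toLinearMap_apply]
  obtain ⟨m, c, rfl⟩ : ∃ (m : ℕ) (c : Fin m → Term S), F = FreeMonoid.ofList (List.ofFn c) :=
    ⟨_, F.toList.get, by rw [List.ofFn_get]; rfl⟩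
  rcases eq_or_ne n m with rfl | h
  · rw [nodeMap_ofFn, wordComul_node]
  -- The lower parts of a word of `m` terms again form a word of `m` letters, since leaves are kept;
  -- `nodeMap n g` therefore kills both sides.
  · rw [nodeMap_ofFn_ne h, map_zero, TensorProduct.tmul_zero, zero_add, wordComul_ofFn, map_sum]
    refine (Finset.sum_eq_zero fun p _ => ?_).symm
    rw [LinearMap.rTensor_tmul, nodeMap_ofFn_ne h, TensorProduct.zero_tmul]

/-- The argument for planar forests with the tensor factors exchanged. The group-like leaf plays the
role of `1`, and the node operator acts on the leftmost factor. -/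
theorem wordComul_coassoc :
    (Algebra.TensorProduct.assoc K K K (WordAlg K (Term S)) (WordAlg K (Term S))
      (WordAlg K (Term S))).toAlgHom.comp
      ((Algebra.TensorProduct.map (wordComul K S) (AlgHom.id K _)).comp (wordComul K S)) =
    (Algebra.TensorProduct.map (AlgHom.id K _) (wordComul K S)).comp (wordComul K S) := by
  refine wordAlg_term_ext ?_ fun n g c hc => ?_
  · simp [wordComul_leaf]
  · simp only [AlgHom.comp_apply] at hc ⊢
    generalize hC : word (K := K) (FreeMonoid.ofList (List.ofFn c)) = C at hc
    have hN : word (K := K) (FreeMonoid.of (Term.node n g c)) = nodeMap n g C := by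
      rw [← hC, nodeMap_ofFn]
    rw [hN, wordComul_nodeMap, map_add, map_add, map_add]
    have h1 : ∀ z : WordAlg K (Term S) ⊗[K] WordAlg K (Term S),
        (Algebra.TensorProduct.assoc K K K (WordAlg K (Term S)) (WordAlg K (Term S))
          (WordAlg K (Term S))).toAlgHom (Algebra.TensorProduct.map (wordComul K S) (AlgHom.id K _)
            ((nodeMap n g).rTensor _ z)) =
        word (FreeMonoid.of Term.leaf) ⊗ₜ[K] (nodeMap n g).rTensor _ z +
        (nodeMap n g).rTensor _
          ((Algebra.TensorProduct.assoc K K K (WordAlg K (Term S)) (WordAlg K (Term S))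
            (WordAlg K (Term S))).toAlgHom
              (Algebra.TensorProduct.map (wordComul K S) (AlgHom.id K _) z)) := by
      intro z
      induction z using TensorProduct.induction_on with
      | zero => simp
      | tmul a b =>
        simp only [LinearMap.rTensor_tmul, Algebra.TensorProduct.map_tmul, AlgHom.id_apply,
          wordComul_nodeMap, TensorProduct.add_tmul, map_add]
        congr 1
        generalize wordComul K S a = t
        induction t using TensorProduct.induction_on with
        | zero => simp
        | tmul a b => simp
        | add a b ha hb => simp only [map_add, TensorProduct.add_tmul, ha, hb]
      | add a b ha hb =>
        simp only [map_add, TensorProduct.tmul_add, ha, hb]; abel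
    have h2 : ∀ z : WordAlg K (Term S) ⊗[K] WordAlg K (Term S),
        Algebra.TensorProduct.map (AlgHom.id K _) (wordComul K S) ((nodeMap n g).rTensor _ z) =
        (nodeMap n g).rTensor _
          (Algebra.TensorProduct.map (AlgHom.id K _) (wordComul K S) z) := by
      intro z
      induction z using TensorProduct.induction_on with
      | zero => simp
      | tmul a b => simp
      | add a b ha hb => simp only [map_add, ha, hb]
    rw [h1, hc, h2]
    simp only [Algebra.TensorProduct.map_tmul, wordComul_leaf, AlgHom.id_apply,
      wordComul_nodeMap, TensorProduct.tmul_add]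
    rw [← add_assoc]
    simp

end Words

/-! ## The natural Hopf algebra of a free operad -/

section Reduction

variable {S : ℕ → Type u}

theorem rd_nil : rd ([] : List (Term S)) = 1 := rfl

theorem rd_cons (t : Term S) (l : List (Term S)) : rd (t :: l) = rd [t] * rd l := by
  by_cases h : t = Term.leaf <;> simp [rd, h]

theorem rd_leaf : rd [(Term.leaf : Term S)] = 1 := by simp [rd]

theorem rd_of_ne (t : Term S) (h : t ≠ Term.leaf) : rd [t] = FreeMonoid.of ⟨t, h⟩ := by
  simp [rd, h]

theorem RForest.dg_mul (f f' : RForest S) :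
    RForest.dg (f * f') = RForest.dg f + RForest.dg f' := by
  simp [RForest.dg, RForest.terms]

theorem RForest.dg_of (t : ProperTerm S) : RForest.dg (FreeMonoid.of t) = t.1.dg := by
  simp [RForest.dg, RForest.terms]

theorem RForest.eq_one_of_dg_eq_zero (f : RForest S) (h : RForest.dg f = 0) : f = 1 := by
  rcases hf : f.toList with _ | ⟨⟨t, ht⟩, l⟩
  · exact hf
  · cases t with
    | leaf => exact absurd rfl ht
    | node n g c =>
      rw [RForest.dg, RForest.terms, hf] at h
      simp [Term.dg] at h

theorem dg_rd (l : List (Term S)) : RForest.dg (rd l) = (l.map Term.dg).sum := by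
  induction l with
  | nil => rfl
  | cons t l ih =>
    rw [rd_cons, RForest.dg_mul, ih, List.map_cons, List.sum_cons]
    congr 1
    by_cases h : t = Term.leaf
    · rw [h, rd_leaf]; rfl
    · rw [rd_of_ne t h, RForest.dg_of]

/-- Grafting replaces leaves, which have degree zero, so the internal nodes are shared out between
the two parts. This homogeneity provides the filtration for the antipode. -/
theorem Term.dg_of_mem_factorizations (x : Term S) (p : Term S × List (Term S))
    (hp : p ∈ Term.factorizations x) : p.1.dg + (p.2.map Term.dg).sum = x.dg := by
  classical
  induction x generalizing p with
  | leaf =>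
    rw [Term.factorizations, Finset.mem_singleton] at hp
    subst hp
    simp [Term.dg]
  | node n g c ih =>
    rw [Term.factorizations, Finset.mem_insert, Finset.mem_image] at hp
    rcases hp with rfl | ⟨q, hq, rfl⟩
    · simp [Term.dg]
    · simp only [Term.dg]
      rw [← Finset.sum_congr rfl fun i _ => ih i (q i) (Fintype.mem_piFinset.mp hq i),
        Finset.sum_add_distrib, List.map_flatten, List.sum_flatten, List.map_ofFn, List.map_ofFn,
        List.sum_ofFn, add_assoc]
      rfl

end Reduction

namespace NatHopf

variable {K : Type v} {S : ℕ → Type u} [Field K]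

theorem E_one : E K S 1 = 1 := MonoidAlgebra.basis_apply _ _

theorem E_mul (f f' : RForest S) : E K S (f * f') = E K S f * E K S f' := by
  change MonoidAlgebra.basis _ _ _ = MonoidAlgebra.basis _ _ _ * MonoidAlgebra.basis _ _ _
  simp only [MonoidAlgebra.basis_apply]
  exact ((MonoidAlgebra.single_mul_single ..).trans (by rw [mul_one])).symm

theorem lift_E_of {B : Type w} [Ring B] [Algebra K B] (φ : ProperTerm S → B) (t : ProperTerm S) :
    lift K S φ (E K S (FreeMonoid.of t)) = φ t := by
  change MonoidAlgebra.lift K B (RForest S) (FreeMonoid.lift φ) (MonoidAlgebra.basis _ _ _) = _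
  rw [MonoidAlgebra.basis_apply, MonoidAlgebra.lift_single, one_smul, FreeMonoid.lift_eval_of]

theorem algHom_ext {B : Type w} [Ring B] [Algebra K B] {f h : NatHopf K S →ₐ[K] B}
    (H : ∀ t, f (E K S (FreeMonoid.of t)) = h (E K S (FreeMonoid.of t))) : f = h := by
  refine AlgHom.toLinearMap_injective ((E K S).ext fun F => ?_)
  simp only [AlgHom.toLinearMap_apply]
  induction F using FreeMonoid.inductionOn' with
  | one => rw [E_one, map_one, map_one]
  | of_mul t F ih => rw [E_mul, map_mul, map_mul, H, ih]

variable (K S) in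
/-- The coproduct, as an algebra morphism. -/
def comulHom : NatHopf K S →ₐ[K] NatHopf K S ⊗[K] NatHopf K S :=
  lift K S fun x =>
    ∑ p ∈ Term.factorizations x.1, E K S (rd [p.1]) ⊗ₜ[K] E K S (rd p.2)

variable (K S) in
/-- The counit, as an algebra morphism. -/
def counitHom : NatHopf K S →ₐ[K] K := lift K S fun _ => (0 : K)

variable (K S) in
/-- The reduction of words of terms. -/
def reduction : WordAlg K (Term S) →ₐ[K] NatHopf K S := WordAlg.lift fun t => E K S (rd [t])

theorem reduction_word (l : List (Term S)) :
    reduction K S (word (FreeMonoid.ofList l)) = E K S (rd l) := by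
  induction l with
  | nil => rw [FreeMonoid.ofList_nil, map_one, map_one, rd_nil, E_one]
  | cons t l ih =>
    rw [FreeMonoid.ofList_cons, map_mul, map_mul, ih, rd_cons, E_mul, reduction, lift_word_of]

theorem reduction_of (t : ProperTerm S) :
    reduction K S (word (FreeMonoid.of t.1)) = E K S (FreeMonoid.of t) := by
  rw [reduction, lift_word_of, rd_of_ne t.1 t.2]

theorem reduction_leaf : reduction K S (word (FreeMonoid.of Term.leaf)) = 1 := by
  rw [reduction, lift_word_of, rd_leaf, E_one]

/-- Deleting leaves after the unreduced coproduct is the definition of the reduced one on proper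
terms; on the leaf both sides are `1 ⊗ 1`. -/
theorem comulHom_comp_reduction : (comulHom K S).comp (reduction K S) =
    (Algebra.TensorProduct.map (reduction K S) (reduction K S)).comp (wordComul K S) := by
  refine wordAlg_term_ext ?_ fun n g c _ => ?_
  · simp [wordComul_leaf, reduction_leaf, Algebra.TensorProduct.one_def]
  · simp only [AlgHom.comp_apply]
    rw [reduction_of ⟨Term.node n g c, by simp⟩, comulHom, lift_E_of, wordComul, lift_word_of,
      map_sum]
    refine Finset.sum_congr rfl fun p _ => ?_
    rw [Algebra.TensorProduct.map_tmul, reduction_word, reduction, lift_word_of]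

theorem comulHom_reduction (x : WordAlg K (Term S)) : comulHom K S (reduction K S x) =
    Algebra.TensorProduct.map (reduction K S) (reduction K S) (wordComul K S x) :=
  DFunLike.congr_fun comulHom_comp_reduction x

/-- Every generator lifts to a one-letter word, so identities may be checked on words, where arities
are still visible. -/
theorem algHom_ext_reduction {B : Type w} [Ring B] [Algebra K B] {f h : NatHopf K S →ₐ[K] B}
    (H : f.comp (reduction K S) = h.comp (reduction K S)) : f = h :=
  algHom_ext fun t => by
    rw [← reduction_of]
    exact DFunLike.congr_fun H _

theorem comulHom_coassoc :
    (Algebra.TensorProduct.assoc K K K (NatHopf K S) (NatHopf K S) (NatHopf K S)).toAlgHom.comp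
      ((Algebra.TensorProduct.map (comulHom K S) (AlgHom.id K _)).comp (comulHom K S)) =
    (Algebra.TensorProduct.map (AlgHom.id K _) (comulHom K S)).comp (comulHom K S) := by
  refine algHom_ext_reduction (AlgHom.ext fun x => ?_)
  simp only [AlgHom.comp_apply, comulHom_reduction]
  have h1 : ∀ z : WordAlg K (Term S) ⊗[K] WordAlg K (Term S),
      (Algebra.TensorProduct.assoc K K K (NatHopf K S) (NatHopf K S) (NatHopf K S)).toAlgHom
        (Algebra.TensorProduct.map (comulHom K S) (AlgHom.id K _)
          (Algebra.TensorProduct.map (reduction K S) (reduction K S) z)) =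
      Algebra.TensorProduct.map (reduction K S)
        (Algebra.TensorProduct.map (reduction K S) (reduction K S))
        ((Algebra.TensorProduct.assoc K K K (WordAlg K (Term S)) (WordAlg K (Term S))
          (WordAlg K (Term S))).toAlgHom
            (Algebra.TensorProduct.map (wordComul K S) (AlgHom.id K _) z)) := by
    intro z
    induction z using TensorProduct.induction_on with
    | zero => simp
    | tmul a b =>
      simp only [Algebra.TensorProduct.map_tmul, AlgHom.id_apply, comulHom_reduction]
      generalize wordComul K S a = t
      induction t using TensorProduct.induction_on with
      | zero => simp
      | tmul a b => simp
      | add a b ha hb => simp only [map_add, TensorProduct.add_tmul, ha, hb]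
    | add a b ha hb => simp only [map_add, ha, hb]
  have h2 : ∀ z : WordAlg K (Term S) ⊗[K] WordAlg K (Term S),
      Algebra.TensorProduct.map (AlgHom.id K _) (comulHom K S)
          (Algebra.TensorProduct.map (reduction K S) (reduction K S) z) =
      Algebra.TensorProduct.map (reduction K S)
        (Algebra.TensorProduct.map (reduction K S) (reduction K S))
        (Algebra.TensorProduct.map (AlgHom.id K _) (wordComul K S) z) := by
    intro z
    induction z using TensorProduct.induction_on with
    | zero => simp
    | tmul a b => simp [comulHom_reduction]
    | add a b ha hb => simp only [map_add, ha, hb]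
  rw [h1, h2]
  exact congrArg _ (DFunLike.congr_fun wordComul_coassoc x)

theorem counitHom_of (t : ProperTerm S) : counitHom K S (E K S (FreeMonoid.of t)) = 0 := by
  rw [counitHom, lift_E_of]

theorem counitHom_reduction_nodeMap (n : ℕ) (g : S n) (x : WordAlg K (Term S)) :
    counitHom K S (reduction K S (nodeMap n g x)) = 0 := by
  suffices H : (counitHom K S).toLinearMap ∘ₗ (reduction K S).toLinearMap ∘ₗ nodeMap n g = 0 from
    LinearMap.congr_fun H x
  refine linearMap_ext fun F => ?_
  simp only [LinearMap.comp_apply, nodeMap_word, AlgHom.toLinearMap_apply, LinearMap.zero_apply]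
  split_ifs with h
  · rw [reduction_of ⟨Term.node n g _, by simp⟩, counitHom_of]
  · rw [map_zero, map_zero]

theorem counitHom_rTensor :
    (Algebra.TensorProduct.map (counitHom K S) (AlgHom.id K _)).comp (comulHom K S) =
      Algebra.TensorProduct.includeRight := by
  refine algHom_ext_reduction (wordAlg_term_ext ?_ fun n g c _ => ?_)
  · simp [reduction_leaf, Algebra.TensorProduct.one_def]
  · simp only [AlgHom.comp_apply, comulHom_reduction, Algebra.TensorProduct.includeRight_apply]
    have h : ∀ z : WordAlg K (Term S) ⊗[K] WordAlg K (Term S),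
        Algebra.TensorProduct.map (counitHom K S) (AlgHom.id K _)
          (Algebra.TensorProduct.map (reduction K S) (reduction K S)
            ((nodeMap n g).rTensor _ z)) = 0 := by
      intro z
      induction z using TensorProduct.induction_on with
      | zero => simp
      | tmul a b => simp [counitHom_reduction_nodeMap]
      | add a b ha hb => simp only [map_add, ha, hb, add_zero]
    rw [wordComul_node, map_add, map_add, h]
    simp [reduction_leaf]

/-- The induction has to run under `nodeMap n g` in the first tensor factor, and this operator makes
no sense once leaves are deleted. So only the second factor is reduced here. -/
theorem wordComul_counit :
    (Algebra.TensorProduct.map (AlgHom.id K (WordAlg K (Term S)))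
      ((counitHom K S).comp (reduction K S))).comp (wordComul K S) =
      (Algebra.TensorProduct.includeLeft :
        WordAlg K (Term S) →ₐ[K] WordAlg K (Term S) ⊗[K] K) := by
  refine wordAlg_term_ext ?_ fun n g c hc => ?_
  · simp [wordComul_leaf, reduction_leaf]
  · simp only [AlgHom.comp_apply, Algebra.TensorProduct.includeLeft_apply] at hc ⊢
    have h : ∀ z : WordAlg K (Term S) ⊗[K] WordAlg K (Term S),
        Algebra.TensorProduct.map (AlgHom.id K (WordAlg K (Term S)))
          ((counitHom K S).comp (reduction K S)) ((nodeMap n g).rTensor _ z) =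
        (nodeMap n g).rTensor K (Algebra.TensorProduct.map (AlgHom.id K (WordAlg K (Term S)))
          ((counitHom K S).comp (reduction K S)) z) := by
      intro z
      induction z using TensorProduct.induction_on with
      | zero => simp
      | tmul a b => simp
      | add a b ha hb => simp only [map_add, ha, hb]
    rw [wordComul_node, map_add, h, hc, LinearMap.rTensor_tmul, nodeMap_ofFn,
      Algebra.TensorProduct.map_tmul, AlgHom.comp_apply,
      reduction_of ⟨Term.node n g c, by simp⟩, counitHom_of, TensorProduct.tmul_zero, zero_add]

theorem counitHom_lTensor :
    (Algebra.TensorProduct.map (AlgHom.id K _) (counitHom K S)).comp (comulHom K S) =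
      (Algebra.TensorProduct.includeLeft : NatHopf K S →ₐ[K] NatHopf K S ⊗[K] K) := by
  refine algHom_ext_reduction (AlgHom.ext fun x => ?_)
  have h : ∀ z : WordAlg K (Term S) ⊗[K] WordAlg K (Term S),
      Algebra.TensorProduct.map (AlgHom.id K _) (counitHom K S)
        (Algebra.TensorProduct.map (reduction K S) (reduction K S) z) =
      (reduction K S).toLinearMap.rTensor K
        (Algebra.TensorProduct.map (AlgHom.id K (WordAlg K (Term S)))
          ((counitHom K S).comp (reduction K S)) z) := by
    intro z
    induction z using TensorProduct.induction_on with
    | zero => simp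
    | tmul a b => simp
    | add a b ha hb => simp only [map_add, ha, hb]
  simp only [AlgHom.comp_apply, comulHom_reduction]
  rw [h]
  have := DFunLike.congr_fun (wordComul_counit (K := K) (S := S)) x
  simp only [AlgHom.comp_apply] at this
  rw [this]
  simp

variable (K S) in
/-- The natural bialgebra of the free operad. -/
@[reducible] def bialgebra : Bialgebra K (NatHopf K S) :=
  Bialgebra.ofAlgHom (comulHom K S) (counitHom K S) comulHom_coassoc counitHom_rTensor
    counitHom_lTensor

theorem comulHom_mem (f : RForest S) :
    comulHom K S (E K S f) ∈ tensorFiltration (K := K) (E K S) RForest.dg f.dg := by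
  induction f using FreeMonoid.inductionOn' with
  | one =>
    rw [E_one, map_one, Algebra.TensorProduct.one_def, ← E_one]
    exact Submodule.subset_span ⟨1, 1, le_of_eq rfl, rfl⟩
  | of_mul t f ih =>
    rw [E_mul, map_mul, RForest.dg_mul]
    refine mul_mem_tensorFiltration E_mul RForest.dg_mul ?_ ih
    rw [comulHom, lift_E_of, RForest.dg_of]
    refine Submodule.sum_mem _ fun p hp => Submodule.subset_span ⟨_, _, ?_, rfl⟩
    have := Term.dg_of_mem_factorizations _ p hp
    rw [dg_rd, dg_rd, ← this]
    simp

variable (K S) in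
/-- The natural Hopf algebra of a free operad is a Hopf algebra. -/
theorem isHopf : IsHopf K (NatHopf K S) := by
  let _ := bialgebra K S
  refine IsHopf.of_filtration (E K S) RForest.dg (fun f hf => ?_) comulHom_mem
  rw [RForest.eq_one_of_dg_eq_zero f hf, E_one, Bialgebra.counit_one, map_one]

end NatHopf

open WordAlg

/-! ## From terms to planar forests -/

/-- The decoration of a generator. -/
def decoration {D : Type u} {n : ℕ} (g : sigD D n) : D := g

/-- The generator with a given decoration. -/
def generator {D : Type u} (n : ℕ) (d : D) : sigD D n := d

theorem decoration_generator {D : Type u} (n : ℕ) (d : D) : decoration (generator n d) = d := rfl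

/-- The planar forest with at most one tree obtained by deleting the leaves of a term. -/
def Term.toForest {D : Type u} : Term (sigD D) → List (PTree D)
  | leaf => []
  | node _ d c => [PTree.graft (decoration d) (List.ofFn fun i => toForest (c i)).flatten]

theorem Term.toForest_node {D : Type u} {n : ℕ} (d : sigD D n) (c : Fin n → Term (sigD D)) :
    (node n d c).toForest = [PTree.graft (decoration d) (List.ofFn fun i => (c i).toForest).flatten] :=
  rfl

theorem PTree.toTerm_node {D : Type u} (d : D) (n : ℕ) (c : Fin n → PTree D) :
    (node d n c).toTerm = Term.node n (generator n d) fun i => (c i).toTerm := rfl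

theorem PTree.toForest_toTerm {D : Type u} (t : PTree D) : t.toTerm.toForest = [t] := by
  induction t with
  | node d n c ih =>
    rw [toTerm_node, Term.toForest_node, decoration_generator, PTree.node_eq_graft]
    simp only [ih]
    rw [← Function.comp_def (fun t => [t]) c, ← List.map_ofFn, ← List.flatMap_def,
      List.flatMap_singleton']

/-- The planar forest obtained by deleting the leaves of a reduced forest. -/
def RForest.toPForest {D : Type u} : RForest (sigD D) →* PForest D :=
  FreeMonoid.lift fun t => FreeMonoid.ofList t.1.toForest

theorem PForest.toPForest_toRForest {D : Type u} (F : PForest D) :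
    RForest.toPForest (PForest.toRForest F) = F := by
  suffices H : RForest.toPForest.comp (PForest.toRForest (D := D)) = MonoidHom.id _ from
    DFunLike.congr_fun H F
  refine FreeMonoid.hom_eq fun t => ?_
  simp only [MonoidHom.comp_apply, PForest.toRForest, FreeMonoid.map_of, RForest.toPForest,
    FreeMonoid.lift_eval_of, PTree.toForest_toTerm]
  rfl

namespace NatHopf

variable {K : Type v} {D : Type u} [Field K]

variable (K D) in
/-- The algebra morphism deleting leaves. -/
def toNCK : NatHopf K (sigD D) →ₐ[K] NCK K D :=
  lift K (sigD D) fun t => NCK.E K D (FreeMonoid.ofList t.1.toForest)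

theorem toNCK_E (f : RForest (sigD D)) :
    toNCK K D (E K (sigD D) f) = NCK.E K D (RForest.toPForest f) := by
  induction f using FreeMonoid.inductionOn' with
  | one => rw [E_one, map_one, map_one, NCK.E_one]
  | of_mul t f ih =>
    rw [E_mul, map_mul, ih, map_mul, NCK.E_mul, toNCK, lift_E_of, RForest.toPForest,
      FreeMonoid.lift_eval_of]

theorem toNCK_surjective : Function.Surjective (toNCK K D) := by
  rw [← AlgHom.coe_toLinearMap, ← LinearMap.range_eq_top, eq_top_iff, ← (NCK.E K D).span_eq,
    Submodule.span_le]
  rintro _ ⟨F, rfl⟩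
  exact ⟨E K (sigD D) (PForest.toRForest F), by
    rw [AlgHom.toLinearMap_apply, toNCK_E, PForest.toPForest_toRForest]⟩

variable (K D) in
/-- The algebra morphism deleting leaves, on words of terms. -/
def wordToNCK : WordAlg K (Term (sigD D)) →ₐ[K] NCK K D :=
  WordAlg.lift fun t => NCK.E K D (FreeMonoid.ofList t.toForest)

theorem toNCK_reduction (x : WordAlg K (Term (sigD D))) :
    toNCK K D (reduction K (sigD D) x) = wordToNCK K D x := by
  suffices H : (toNCK K D).comp (reduction K (sigD D)) = wordToNCK K D from
    DFunLike.congr_fun H x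
  refine wordAlg_term_ext ?_ fun n g c _ => ?_
  · rw [AlgHom.comp_apply, reduction_leaf, map_one, wordToNCK, lift_word_of, ← NCK.E_one]
    rfl
  · rw [AlgHom.comp_apply, reduction_of ⟨Term.node n g c, by simp⟩, toNCK, lift_E_of, wordToNCK,
      lift_word_of]

theorem wordToNCK_ofFn {n : ℕ} (c : Fin n → Term (sigD D)) :
    wordToNCK K D (word (FreeMonoid.ofList (List.ofFn c))) =
      NCK.E K D (FreeMonoid.ofList (List.ofFn fun i => (c i).toForest).flatten) := by
  rw [wordToNCK, lift_word_ofFn]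
  refine Eq.trans ?_ (map_ofList_flatten NCK.EHom _).symm
  rw [List.map_ofFn]; rfl

theorem wordToNCK_node {n : ℕ} (d : sigD D n) (c : Fin n → Term (sigD D)) :
    wordToNCK K D (word (FreeMonoid.of (Term.node n d c))) =
      NCK.graftMap (decoration d) (wordToNCK K D (word (FreeMonoid.ofList (List.ofFn c)))) := by
  rw [wordToNCK_ofFn, NCK.graftMap_E, wordToNCK, lift_word_of]
  rfl

variable (K D) in
/-- The opposite coproduct of planar forests, as an algebra morphism. -/
def comulOppHom : NCK K D →ₐ[K] NCK K D ⊗[K] NCK K D :=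
  (Algebra.TensorProduct.comm K (NCK K D) (NCK K D)).toAlgHom.comp (NCK.comulHom K D)

/-- Exchanging the factors puts the cocycle identity in the form of `wordComul_node`, with `1` in
place of the leaf. -/
theorem comulOppHom_graftMap (d : D) (x : NCK K D) : comulOppHom K D (NCK.graftMap d x) =
    1 ⊗ₜ[K] NCK.graftMap d x + (NCK.graftMap d).rTensor (NCK K D) (comulOppHom K D x) := by
  have h : ∀ z : NCK K D ⊗[K] NCK K D,
      (Algebra.TensorProduct.comm K (NCK K D) (NCK K D)).toAlgHom
        ((NCK.graftMap d).lTensor (NCK K D) z) = (NCK.graftMap d).rTensor (NCK K D)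
          ((Algebra.TensorProduct.comm K (NCK K D) (NCK K D)).toAlgHom z) := by
    intro z
    induction z using TensorProduct.induction_on with
    | zero => simp
    | tmul a b => simp
    | add a b ha hb => simp only [map_add, ha, hb]
  rw [comulOppHom, AlgHom.comp_apply, NCK.comulHom_graftMap, map_add, h]
  simp

/-- Leaf deletion sends the leaf to `1` and the node operator to grafting, so it matches the two
cocycle identities term by term. -/
theorem comulOppHom_wordToNCK (x : WordAlg K (Term (sigD D))) :
    comulOppHom K D (wordToNCK K D x) =
      Algebra.TensorProduct.map (wordToNCK K D) (wordToNCK K D) (wordComul K (sigD D) x) := by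
  have leaf : wordToNCK K D (word (FreeMonoid.of Term.leaf)) = 1 := by
    rw [← toNCK_reduction, reduction_leaf, map_one]
  suffices H : (comulOppHom K D).comp (wordToNCK K D) = (Algebra.TensorProduct.map (wordToNCK K D)
      (wordToNCK K D)).comp (wordComul K (sigD D)) from DFunLike.congr_fun H x
  refine wordAlg_term_ext ?_ fun n g c hc => ?_
  · simp [wordComul_leaf, leaf, Algebra.TensorProduct.one_def]
  · simp only [AlgHom.comp_apply] at hc ⊢
    rw [wordToNCK_node, comulOppHom_graftMap, hc, wordComul_node, map_add,
      Algebra.TensorProduct.map_tmul, leaf, wordToNCK_node]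
    congr 1
    rw [wordComul_ofFn]
    simp only [map_sum, LinearMap.rTensor_tmul, Algebra.TensorProduct.map_tmul, nodeMap_ofFn]
    exact Finset.sum_congr rfl fun p _ => by rw [wordToNCK_node]

theorem comulOpp_toNCK (x : NatHopf K (sigD D)) :
    NCK.comulOpp K D (toNCK K D x) =
      TensorProduct.map (toNCK K D).toLinearMap (toNCK K D).toLinearMap
        (CoalgebraStruct.comul (R := K) x) := by
  suffices H : (comulOppHom K D).comp (toNCK K D) = (Algebra.TensorProduct.map (toNCK K D)
      (toNCK K D)).comp (comulHom K (sigD D)) from DFunLike.congr_fun H x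
  refine algHom_ext_reduction (AlgHom.ext fun y => ?_)
  simp only [AlgHom.comp_apply, toNCK_reduction, comulOppHom_wordToNCK, comulHom_reduction]
  generalize wordComul K (sigD D) y = z
  induction z using TensorProduct.induction_on with
  | zero => simp
  | tmul a b => simp [toNCK_reduction]
  | add a b ha hb => simp only [map_add, ha, hb]

theorem counit_toNCK (x : NatHopf K (sigD D)) :
    CoalgebraStruct.counit (R := K) (toNCK K D x) = CoalgebraStruct.counit (R := K) x := by
  suffices H : (NCK.counitHom K D).comp (toNCK K D) = counitHom K (sigD D) from
    DFunLike.congr_fun H x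
  refine algHom_ext fun t => ?_
  obtain ⟨t, ht⟩ := t
  cases t with
  | leaf => exact absurd rfl ht
  | node n d c =>
    rw [AlgHom.comp_apply, counitHom_of, toNCK, lift_E_of]
    exact NCK.lift_E_of _ _

end NatHopf

/-! ## Compatibility of words with lists of terms -/

section Slices

theorem sum_Iio_succ {n : ℕ} (m : Fin (n + 1) → ℕ) (i : Fin n) :
    ∑ k ∈ Finset.Iio i.succ, m k = m 0 + ∑ k ∈ Finset.Iio i, m k.succ := by
  have : Finset.Iio i.succ = insert 0 ((Finset.Iio i).map (Fin.succEmb n)) := by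
    ext k
    refine Fin.cases ?_ (fun k => ?_) k <;> simp
  rw [this, Finset.sum_insert (by simp), Finset.sum_map]
  rfl

theorem sum_Iio_zero {n : ℕ} (m : Fin (n + 1) → ℕ) :
    ∑ k ∈ Finset.Iio (0 : Fin (n + 1)), m k = 0 := by
  have : Finset.Iio (0 : Fin (n + 1)) = ∅ := by ext k; simp
  rw [this, Finset.sum_empty]

theorem sum_Iio_add_le {n : ℕ} (m : Fin n → ℕ) (i : Fin n) :
    ∑ k ∈ Finset.Iio i, m k + m i ≤ ∑ k, m k := by
  have h : ∑ k ∈ insert i (Finset.Iio i), m k ≤ ∑ k, m k :=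
    Finset.sum_le_sum_of_subset (Finset.subset_univ _)
  rw [Finset.sum_insert (by simp)] at h
  omega

theorem exists_block {n : ℕ} (m : Fin n → ℕ) (p : ℕ) (hp : p < ∑ i, m i) :
    ∃ (i : Fin n) (q : ℕ), q < m i ∧ p = ∑ k ∈ Finset.Iio i, m k + q := by
  induction n generalizing p with
  | zero => simp at hp
  | succ n ih =>
    rw [Fin.sum_univ_succ] at hp
    by_cases h : p < m 0
    · exact ⟨0, p, h, by rw [sum_Iio_zero, zero_add]⟩
    · obtain ⟨i, q, hq, hpq⟩ := ih (fun i => m i.succ) (p - m 0) (by omega)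
      exact ⟨i.succ, q, hq, by rw [sum_Iio_succ]; omega⟩

theorem getElem?_slice {X : Type*} (w : List X) (p m q : ℕ) (hq : q < m) :
    ((w.drop p).take m)[q]? = w[p + q]? := by
  rw [List.getElem?_take_of_lt hq, List.getElem?_drop]

theorem getElem?_flatten_ofFn {X : Type*} {n : ℕ} (l : Fin n → List X) (i : Fin n) (q : ℕ)
    (hq : q < (l i).length) :
    (List.ofFn l).flatten[∑ k ∈ Finset.Iio i, (l k).length + q]? = (l i)[q]? := by
  rw [← getElem?_slice _ _ _ _ hq, Term.slice_flatten]

end Slices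

namespace Term

variable {S : ℕ → Type u}

theorem length_decs (t : Term S) : t.decs.length = t.dg := by
  induction t with
  | leaf => rfl
  | node n g c ih =>
    simp only [decs, dg, List.length_cons, List.length_flatten, List.map_ofFn, List.sum_ofFn,
      Function.comp_apply, ih]
    omega

theorem Edge.lt {t : Term S} {j a b : ℕ} (h : t.Edge j a b) : a < t.dg ∧ b < t.dg := by
  induction t generalizing j a b with
  | leaf => exact h.elim
  | node n g c ih =>
    rw [dg]
    rcases h with ⟨i, _, hi, rfl, rfl⟩ | ⟨i, a', b', h, rfl, rfl⟩
    · have := sum_Iio_add_le (fun k => (c k).dg) i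
      have hpos : 0 < (c i).dg := by
        cases hc : c i with
        | leaf => exact absurd hc hi
        | node => rw [dg]; omega
      rw [childPos]
      omega
    · have := sum_Iio_add_le (fun k => (c k).dg) i
      have := ih i h
      rw [childPos]
      omega

end Term

namespace ForestLike

variable {S : ℕ → Type u} {A : Type u}

/-- The word `w` is compatible with the term `t`, with the condition `R` on its root. -/
structure TermCompatible (B : ForestLike S A) (R : A → Prop) (t : Term S) (w : List A) : Prop where
  length_eq : w.length = t.dg
  root : ∀ x : A, w[0]? = some x → R x
  dec : ∀ (i : ℕ) (x : A) (n : ℕ) (g : S n),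
    w[i]? = some x → t.decs[i]? = some ⟨n, g⟩ → B.dec n g x
  edge : ∀ (j i i' : ℕ) (x x' : A),
    w[i]? = some x → w[i']? = some x' → t.Edge j i i' → B.edge j x x'

/-- Compatibility of a word with a list of terms, with a condition on each of the roots. -/
def ListCompatible (B : ForestLike S A) : List ((A → Prop) × Term S) → List A → Prop
  | [], w => w = []
  | (R, t) :: st, w => B.TermCompatible R t (w.take t.dg) ∧ B.ListCompatible st (w.drop t.dg)

theorem termCompatible_leaf (B : ForestLike S A) (R : A → Prop) (w : List A) :
    B.TermCompatible R Term.leaf w ↔ w = [] := by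
  constructor
  · intro h; exact List.length_eq_zero_iff.mp h.length_eq
  · rintro rfl
    exact ⟨rfl, by simp, by simp, by simp⟩

theorem ListCompatible.length_eq {B : ForestLike S A} {st : List ((A → Prop) × Term S)}
    {w : List A} (h : B.ListCompatible st w) : w.length = (st.map fun p => p.2.dg).sum := by
  induction st generalizing w with
  | nil => rw [ListCompatible] at h; rw [h]; rfl
  | cons p st ih =>
    obtain ⟨R, t⟩ := p
    have h1 := h.1.length_eq
    have h2 := ih h.2
    rw [List.length_take] at h1
    rw [List.length_drop] at h2
    rw [List.map_cons, List.sum_cons, ← h2]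
    change _ = t.dg + _
    omega

theorem listCompatible_append (B : ForestLike S A) (st st' : List ((A → Prop) × Term S))
    (w : List A) : B.ListCompatible (st ++ st') w ↔
      B.ListCompatible st (w.take (st.map fun p => p.2.dg).sum) ∧
        B.ListCompatible st' (w.drop (st.map fun p => p.2.dg).sum) := by
  induction st generalizing w with
  | nil => simp [ListCompatible]
  | cons p st ih =>
    obtain ⟨R, t⟩ := p
    simp only [List.cons_append, ListCompatible, ih, List.map_cons, List.sum_cons,
      List.take_take, List.drop_drop, List.drop_take, and_assoc]
    rw [min_eq_left (Nat.le_add_right _ _), Nat.add_sub_cancel_left]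

theorem listCompatible_ofFn (B : ForestLike S A) {n : ℕ} (R : Fin n → A → Prop)
    (c : Fin n → Term S) (w : List A) :
    B.ListCompatible (List.ofFn fun i => (R i, c i)) w ↔ w.length = ∑ i, (c i).dg ∧
      ∀ i, B.TermCompatible (R i) (c i)
        ((w.drop (∑ k ∈ Finset.Iio i, (c k).dg)).take (c i).dg) := by
  induction n generalizing w with
  | zero => simp [ListCompatible]
  | succ n ih =>
    rw [List.ofFn_succ, ListCompatible, ih (fun i => R i.succ) (fun i => c i.succ),
      Fin.forall_fin_succ, sum_Iio_zero, List.drop_zero, List.length_drop, Fin.sum_univ_succ]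
    simp only [sum_Iio_succ, List.drop_drop]
    constructor
    · rintro ⟨h1, h2, h3⟩
      have := h1.length_eq
      rw [List.length_take] at this
      exact ⟨by omega, h1, h3⟩
    · rintro ⟨h1, h2, h3⟩
      exact ⟨h2, by omega, h3⟩

/-- Once the letter `a` of the root is read, the edge relation from the root to its `i`-th child is
a condition on the child's letter alone. It becomes the root condition of that subterm, which is why
`TermCompatible` has an arbitrary one. -/
theorem termCompatible_node (B : ForestLike S A) (R : A → Prop) {n : ℕ} (g : S n)
    (c : Fin n → Term S) (a : A) (w : List A) :
    B.TermCompatible R (Term.node n g c) (a :: w) ↔ R a ∧ B.dec n g a ∧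
      B.ListCompatible (List.ofFn fun i => (B.edge i a, c i)) w := by
  have hdecs : ∀ (i : Fin n) (q : ℕ), q < (c i).dg →
      (Term.node n g c).decs[1 + (∑ k ∈ Finset.Iio i, (c k).dg) + q]? = (c i).decs[q]? := by
    intro i q hq
    have := getElem?_flatten_ofFn (fun i => (c i).decs) i q (by rwa [Term.length_decs])
    simp only [Term.length_decs] at this
    rw [← this, Term.decs, add_assoc, add_comm 1, List.getElem?_cons_succ]
  have hw : ∀ (i : Fin n) (q : ℕ), q < (c i).dg →
      ((w.drop (∑ k ∈ Finset.Iio i, (c k).dg)).take (c i).dg)[q]? =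
        (a :: w)[1 + (∑ k ∈ Finset.Iio i, (c k).dg) + q]? := by
    intro i q hq
    rw [getElem?_slice _ _ _ _ hq, add_assoc, add_comm 1, List.getElem?_cons_succ]
  have hlt : ∀ (i : Fin n) (q : ℕ) (x : A),
      ((w.drop (∑ k ∈ Finset.Iio i, (c k).dg)).take (c i).dg)[q]? = some x → q < (c i).dg := by
    intro i q x hx
    have := (List.getElem?_eq_some_iff.mp hx).1
    rw [List.length_take] at this
    omega
  rw [listCompatible_ofFn]
  constructor
  · intro h
    have hl := h.length_eq
    rw [List.length_cons, Term.dg] at hl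
    refine ⟨h.root a rfl, h.dec 0 a n g rfl rfl, by omega, fun i => ⟨?_, ?_, ?_, ?_⟩⟩
    · have := sum_Iio_add_le (fun k => (c k).dg) i
      rw [List.length_take, List.length_drop]
      omega
    · intro x hx
      have hq := hlt i 0 x hx
      rw [hw i 0 hq] at hx
      -- The slice has a letter at position `0`, so the subterm has positive degree and is not a
      -- leaf, as the edge from the root requires.
      refine h.edge i 0 _ a x rfl hx (Or.inl ⟨i, rfl, ?_, rfl, rfl⟩)
      intro hc
      rw [hc, Term.dg] at hq
      exact absurd hq (lt_irrefl _)
    · intro q x m g' hx hd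
      have hq := hlt i q x hx
      rw [hw i q hq] at hx
      rw [← hdecs i q hq] at hd
      exact h.dec _ x m g' hx hd
    · intro j q q' x x' hx hx' he
      have hq := hlt i q x hx
      have hq' := hlt i q' x' hx'
      rw [hw i q hq] at hx
      rw [hw i q' hq'] at hx'
      exact h.edge j _ _ x x' hx hx' (Or.inr ⟨i, q, q', he, rfl, rfl⟩)
  · rintro ⟨hR, hg, hl, h⟩
    refine ⟨?_, ?_, ?_, ?_⟩
    · rw [List.length_cons, hl, Term.dg, add_comm]
    · intro x hx
      simp only [List.getElem?_cons_zero, Option.some.injEq] at hx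
      rwa [← hx]
    · intro p x m g' hx hd
      rcases p with _ | p
      · simp only [List.getElem?_cons_zero, Option.some.injEq] at hx
        rw [Term.decs, List.getElem?_cons_zero, Option.some.injEq] at hd
        obtain ⟨rfl, h2⟩ := Sigma.mk.inj hd
        obtain rfl := eq_of_heq h2
        rwa [← hx]
      · have hp := (List.getElem?_eq_some_iff.mp hx).1
        -- A position other than the root's falls in the block of exactly one subterm; the shift by
        -- one accounts for the root.
        obtain ⟨i, q, hq, rfl⟩ := exists_block (fun i => (c i).dg) p (by
          rw [List.length_cons] at hp; omega)
        have e : ∑ k ∈ Finset.Iio i, (c k).dg + q + 1 = 1 + ∑ k ∈ Finset.Iio i, (c k).dg + q := by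
          omega
        rw [e] at hx hd
        rw [← hw i q hq] at hx
        rw [hdecs i q hq] at hd
        exact (h i).dec q x m g' hx hd
    · intro j p p' x x' hx hx' he
      rcases he with ⟨i, rfl, hi, rfl, rfl⟩ | ⟨i, q, q', he, rfl, rfl⟩
      · simp only [List.getElem?_cons_zero, Option.some.injEq] at hx
        have hpos : 0 < (c i).dg := by
          cases hc : c i with
          | leaf => exact absurd hc hi
          | node => rw [Term.dg]; omega
        rw [← hx]
        refine (h i).root x' ?_
        rw [hw i 0 hpos]
        exact hx'
      · have hq := he.lt
        rw [Term.childPos] at hx hx'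
        rw [← hw i q hq.1] at hx
        rw [← hw i q' hq.2] at hx'
        exact (h i).edge j q q' x x' hx hx' he

/-- Preorder as a stack: reading a letter pops the first root and pushes its subterms. Compatibility
can thus be tested letter by letter, without positions. -/
theorem listCompatible_node_cons (B : ForestLike S A) (R : A → Prop) {n : ℕ} (g : S n)
    (c : Fin n → Term S) (st : List ((A → Prop) × Term S)) (a : A) (w : List A) :
    B.ListCompatible ((R, Term.node n g c) :: st) (a :: w) ↔ R a ∧ B.dec n g a ∧
      B.ListCompatible ((List.ofFn fun i : Fin n => (B.edge i a, c i)) ++ st) w := by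
  rw [ListCompatible, Term.dg, add_comm 1, List.take_succ_cons, List.drop_succ_cons,
    termCompatible_node, listCompatible_append, List.map_ofFn, List.sum_ofFn]
  simp only [Function.comp_apply, and_assoc]

/-- In preorder the nodes of `t` come first and those of `f` are shifted by the degree of `t`; no
edge joins the two blocks, so all conditions split. -/
theorem compatible_of_mul (B : ForestLike S A) (t : ProperTerm S) (f : RForest S) (w : List A) :
    B.Compatible (FreeMonoid.of t * f) w ↔
      B.TermCompatible B.root t.1 (w.take t.1.dg) ∧ B.Compatible f (w.drop t.1.dg) := by
  have hterms : RForest.terms (FreeMonoid.of t * f) = t.1 :: f.terms := by simp [RForest.terms]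
  have hdg : RForest.dg (FreeMonoid.of t * f) = t.1.dg + f.dg := by
    simp [RForest.dg, hterms]
  have hdecs : RForest.decs (FreeMonoid.of t * f) = t.1.decs ++ f.decs := by
    simp [RForest.decs, hterms]
  have hpos0 : RForest.pos (FreeMonoid.of t * f) 0 = 0 := by simp [RForest.pos]
  have hpos : ∀ k, RForest.pos (FreeMonoid.of t * f) (k + 1) = t.1.dg + f.pos k := by
    intro k; simp [RForest.pos, hterms]
  have hroot : ∀ a, RForest.IsRoot (FreeMonoid.of t * f) a ↔
      a = 0 ∨ ∃ a', f.IsRoot a' ∧ a = t.1.dg + a' := by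
    intro a
    rw [RForest.IsRoot, hterms, List.length_cons]
    constructor
    · rintro ⟨k, hk, rfl⟩
      rcases k with _ | k
      · exact Or.inl hpos0
      · exact Or.inr ⟨f.pos k, ⟨k, by omega, rfl⟩, hpos k⟩
    · rintro (rfl | ⟨a', ⟨k, hk, rfl⟩, rfl⟩)
      · exact ⟨0, by omega, hpos0.symm⟩
      · exact ⟨k + 1, by omega, (hpos k).symm⟩
  have hedge : ∀ j a b, RForest.Edge (FreeMonoid.of t * f) j a b ↔
      t.1.Edge j a b ∨ ∃ a' b', f.Edge j a' b' ∧ a = t.1.dg + a' ∧ b = t.1.dg + b' := by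
    intro j a b
    rw [RForest.Edge, hterms]
    constructor
    · rintro ⟨k, s, a', b', hk, he, rfl, rfl⟩
      rcases k with _ | k
      · simp only [List.getElem?_cons_zero, Option.some.injEq] at hk
        rw [hpos0, zero_add, zero_add, hk]
        exact Or.inl he
      · rw [List.getElem?_cons_succ] at hk
        rw [hpos]
        exact Or.inr ⟨f.pos k + a', f.pos k + b', ⟨k, s, a', b', hk, he, rfl, rfl⟩,
          by omega, by omega⟩
    · rintro (he | ⟨_, _, ⟨k, s, a', b', hk, he, rfl, rfl⟩, rfl, rfl⟩)
      · exact ⟨0, t.1, a, b, rfl, he, by rw [hpos0, zero_add], by rw [hpos0, zero_add]⟩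
      · exact ⟨k + 1, s, a', b', hk, he, by rw [hpos]; omega, by rw [hpos]; omega⟩
  have hlt : ∀ (i : ℕ) (x : A), (w.take t.1.dg)[i]? = some x → i < t.1.dg ∧ w[i]? = some x := by
    intro i x hx
    have := (List.getElem?_eq_some_iff.mp hx).1
    rw [List.length_take] at this
    rw [List.getElem?_take_of_lt (by omega)] at hx
    exact ⟨by omega, hx⟩
  have hpt : 0 < t.1.dg := by
    obtain ⟨t, ht⟩ := t
    cases t with
    | leaf => exact absurd rfl ht
    | node => simp [Term.dg]
  constructor
  · intro h
    have hl := h.length_eq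
    rw [hdg] at hl
    refine ⟨⟨?_, ?_, ?_, ?_⟩, ?_, ?_, ?_, ?_⟩
    · rw [List.length_take]; omega
    · intro x hx
      exact h.root 0 x (hlt 0 x hx).2 ((hroot 0).mpr (Or.inl rfl))
    · intro i x n g hx hd
      refine h.dec i x n g (hlt i x hx).2 ?_
      rw [hdecs, List.getElem?_append_left (by rw [Term.length_decs]; exact (hlt i x hx).1)]
      exact hd
    · intro j i i' x x' hx hx' he
      exact h.edge j i i' x x' (hlt i x hx).2 (hlt i' x' hx').2 ((hedge _ _ _).mpr (Or.inl he))
    · rw [List.length_drop]; omega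
    · intro i x hx hr
      rw [List.getElem?_drop] at hx
      exact h.root _ x hx ((hroot _).mpr (Or.inr ⟨i, hr, rfl⟩))
    · intro i x n g hx hd
      rw [List.getElem?_drop] at hx
      refine h.dec _ x n g hx ?_
      rw [hdecs, List.getElem?_append_right (by rw [Term.length_decs]; omega), Term.length_decs,
        Nat.add_sub_cancel_left]
      exact hd
    · intro j i i' x x' hx hx' he
      rw [List.getElem?_drop] at hx hx'
      exact h.edge j _ _ x x' hx hx' ((hedge _ _ _).mpr (Or.inr ⟨i, i', he, rfl, rfl⟩))
  · rintro ⟨h1, h2⟩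
    have hl1 := h1.length_eq
    have hl2 := h2.length_eq
    rw [List.length_take] at hl1
    rw [List.length_drop] at hl2
    refine ⟨by rw [hdg]; omega, ?_, ?_, ?_⟩
    · intro i x hx hr
      rcases (hroot i).mp hr with rfl | ⟨a', hr', rfl⟩
      · exact h1.root x (by rwa [List.getElem?_take_of_lt hpt])
      · exact h2.root a' x (by rwa [List.getElem?_drop]) hr'
    · intro i x n g hx hd
      rw [hdecs] at hd
      by_cases hi : i < t.1.dg
      · rw [List.getElem?_append_left (by rwa [Term.length_decs])] at hd
        exact h1.dec i x n g (by rwa [List.getElem?_take_of_lt hi]) hd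
      · rw [List.getElem?_append_right (by rw [Term.length_decs]; omega), Term.length_decs] at hd
        refine h2.dec _ x n g ?_ hd
        rw [List.getElem?_drop, Nat.add_sub_cancel' (by omega)]
        exact hx
    · intro j i i' x x' hx hx' he
      rcases (hedge _ _ _).mp he with he | ⟨a', b', he', rfl, rfl⟩
      · refine h1.edge j i i' x x' ?_ ?_ he
        · rwa [List.getElem?_take_of_lt he.lt.1]
        · rwa [List.getElem?_take_of_lt he.lt.2]
      · exact h2.edge j a' b' x x' (by rwa [List.getElem?_drop]) (by rwa [List.getElem?_drop])
          he'

theorem compatible_one (B : ForestLike S A) (w : List A) :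
    B.Compatible (1 : RForest S) w ↔ w = [] := by
  constructor
  · intro h; exact List.length_eq_zero_iff.mp h.length_eq
  · rintro rfl
    exact ⟨rfl, by simp, by simp, by simp⟩

theorem compatible_iff_listCompatible (B : ForestLike S A) (f : RForest S) (w : List A) :
    B.Compatible f w ↔ B.ListCompatible (f.terms.map fun t => (B.root, t)) w := by
  induction f using FreeMonoid.inductionOn' generalizing w with
  | one => rw [compatible_one]; rfl
  | of_mul t f ih =>
    rw [compatible_of_mul, ih]
    have : RForest.terms (FreeMonoid.of t * f) = t.1 :: RForest.terms f := by simp [RForest.terms]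
    rw [this]
    rfl

theorem compatible_mul (B : ForestLike S A) (f f' : RForest S) (w : List A) :
    B.Compatible (f * f') w ↔ B.Compatible f (w.take f.dg) ∧ B.Compatible f' (w.drop f.dg) := by
  have h : RForest.terms (f * f') = f.terms ++ f'.terms := by simp [RForest.terms]
  rw [compatible_iff_listCompatible, compatible_iff_listCompatible, compatible_iff_listCompatible,
    h, List.map_append, listCompatible_append, List.map_map]
  rfl

end ForestLike

/-! ## The realization maps are algebra morphisms -/

namespace ForestLike

variable (K : Type v) [Field K] {S : ℕ → Type u} {A : Type u}

open Classical in
theorem coeff_forestPoly (B : ForestLike S A) (f : RForest S) (w : List A) :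
    NCPoly.coeff (B.forestPoly K f) w = if B.Compatible f w then 1 else 0 := rfl

theorem realize_E (B : ForestLike S A) (f : RForest S) :
    B.realize K (NatHopf.E K S f) = B.forestPoly K f := (NatHopf.E K S).constr_basis K _ f

theorem forestPoly_one (B : ForestLike S A) : B.forestPoly K (1 : RForest S) = 1 := by
  refine Subtype.ext (funext fun w => ?_)
  refine (coeff_forestPoly K B 1 w).trans ?_
  rw [compatible_one]
  cases w with
  | nil => exact if_pos rfl
  | cons a w => exact if_neg (by simp)

/-- A compatible word has length the degree of its forest. Hence at most one factorization of `w`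
contributes to the Cauchy product, the one cut at `f.dg`. -/
theorem forestPoly_mul (B : ForestLike S A) (f f' : RForest S) :
    B.forestPoly K (f * f') = B.forestPoly K f * B.forestPoly K f' := by
  classical
  refine Subtype.ext (funext fun w => ?_)
  refine (coeff_forestPoly K B (f * f') w).trans ?_
  refine Eq.trans ?_ (NCSeries.mul_apply _ _ _).symm
  have h0 : ∀ i, (B.forestPoly K f).1 (w.take i) * (B.forestPoly K f').1 (w.drop i) =
      if B.Compatible f (w.take i) ∧ B.Compatible f' (w.drop i) then 1 else 0 := by
    intro i
    change NCPoly.coeff _ _ * NCPoly.coeff _ _ = _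
    rw [coeff_forestPoly, coeff_forestPoly, ite_and, ite_mul, one_mul, zero_mul]
  simp only [h0]
  rw [compatible_mul]
  split_ifs with h
  · have hl := h.1.length_eq
    rw [List.length_take] at hl
    rw [Finset.sum_eq_single f.dg]
    · rw [if_pos h]
    · intro i hi hne
      refine if_neg fun h' => hne ?_
      have := h'.1.length_eq
      rw [List.length_take] at this
      rw [Finset.mem_range] at hi
      omega
    · intro hi
      rw [Finset.mem_range] at hi
      omega
  · refine (Finset.sum_eq_zero fun i hi => if_neg fun h' => h ?_).symm
    have := h'.1.length_eq
    rw [List.length_take] at this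
    rw [Finset.mem_range] at hi
    have : i = f.dg := by omega
    rwa [← this]

/-- The realization map, as an algebra morphism. -/
def realizeHom (B : ForestLike S A) : NatHopf K S →ₐ[K] NCPoly K A :=
  AlgHom.ofLinearMap (B.realize K) (by rw [← NatHopf.E_one, realize_E, forestPoly_one]) (by
    have : (LinearMap.mul K (NatHopf K S)).compr₂ (B.realize K) =
        (LinearMap.mul K (NCPoly K A)).compl₁₂ (B.realize K) (B.realize K) :=
      (NatHopf.E K S).ext fun f => (NatHopf.E K S).ext fun f' => by
        simp only [LinearMap.compr₂_apply, LinearMap.mul_apply', LinearMap.compl₁₂_apply]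
        rw [← NatHopf.E_mul, realize_E, realize_E, realize_E, forestPoly_mul]
    exact fun x y => LinearMap.congr_fun₂ this x y)

end ForestLike

/-! ## The realization of planar forests on uniform alphabets -/

section Uniform

variable {D A : Type u}

/-- Compatibility of a word with a list of planar trees, with a condition on each of the roots,
for a uniform alphabet. -/
def Fits (B : ForestLike (sigD D) A) : List A → List ((A → Prop) × PTree D) → Prop
  | [], [] => True
  | [], _ :: _ => False
  | _ :: _, [] => False
  | a :: w, (R, .node d _ c) :: st => R a ∧ B.dec 0 (generator 0 d) a ∧
      Fits B w ((List.ofFn fun i => (B.edge 0 a, c i)) ++ st)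

theorem fits_nil_left (B : ForestLike (sigD D) A) (st : List ((A → Prop) × PTree D)) :
    Fits B [] st ↔ st = [] := by
  cases st <;> simp [Fits]

theorem fits_nil_right (B : ForestLike (sigD D) A) (w : List A) : Fits B w [] ↔ w = [] := by
  cases w <;> simp [Fits]

theorem fits_cons (B : ForestLike (sigD D) A) (a : A) (w : List A) (R : A → Prop) (d : D)
    (l : List (PTree D)) (st : List ((A → Prop) × PTree D)) :
    Fits B (a :: w) ((R, PTree.graft d l) :: st) ↔ R a ∧ B.dec 0 (generator 0 d) a ∧
      Fits B w (l.map (Prod.mk (B.edge 0 a)) ++ st) := by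
  have h : (List.ofFn fun i => (B.edge 0 a, l.get i)) = l.map (Prod.mk (B.edge 0 a)) := by
    conv_rhs => rw [← List.ofFn_get l, List.map_ofFn]
    rfl
  rw [PTree.graft, Fits, h]

/-- Leaves consume no letter, and uniformity makes arities and child indices irrelevant, the index
`0` in `Fits` being a representative. An inner induction on the list is needed because a leaf at its
head leaves the word unchanged. -/
theorem listCompatible_iff_fits {B : ForestLike (sigD D) A} (hB : IsUniform B) (w : List A)
    (st : List ((A → Prop) × Term (sigD D))) :
    B.ListCompatible st w ↔
      Fits B w (st.flatMap fun p => p.2.toForest.map (Prod.mk p.1)) := by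
  induction w generalizing st with
  | nil =>
    induction st with
    | nil => simp [ForestLike.ListCompatible, Fits]
    | cons p st ih =>
      obtain ⟨R, t⟩ := p
      cases t with
      | leaf =>
        rw [ForestLike.ListCompatible, List.flatMap_cons]
        simp only [Term.dg, List.take_zero, List.drop_zero, ForestLike.termCompatible_leaf,
          true_and]
        exact ih
      | node n g c =>
        rw [List.flatMap_cons, Term.toForest_node]
        simp only [List.map_cons, List.map_nil, List.cons_append, fits_nil_left,
          reduceCtorEq, iff_false]
        intro h
        have := h.length_eq
        simp [Term.dg] at this
        omega
  | cons a w ihw =>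
    induction st with
    | nil => simp [ForestLike.ListCompatible, Fits]
    | cons p st ih =>
      obtain ⟨R, t⟩ := p
      cases t with
      | leaf =>
        rw [ForestLike.ListCompatible, List.flatMap_cons]
        simp only [Term.dg, List.take_zero, List.drop_zero, ForestLike.termCompatible_leaf,
          true_and]
        exact ih
      | node n g c =>
        rw [ForestLike.listCompatible_node_cons, ihw, List.flatMap_cons, Term.toForest_node,
          List.map_singleton, List.singleton_append, fits_cons, List.flatMap_append]
        have h1 : B.dec n g = B.dec 0 (generator 0 (decoration g)) := hB.1 g n 0
        have h2 : ((List.ofFn fun i : Fin n => (B.edge i a, c i)).flatMap fun p =>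
            p.2.toForest.map (Prod.mk p.1)) =
            (List.ofFn fun i => (c i).toForest).flatten.map (Prod.mk (B.edge 0 a)) := by
          rw [List.flatMap_def, List.map_ofFn, List.map_flatten, List.map_ofFn]
          congr 2
          funext i
          simp only [Function.comp_apply]
          rw [hB.2 i 0]
        rw [h1, h2]

theorem compatible_iff_fits {B : ForestLike (sigD D) A} (hB : IsUniform B) (f : RForest (sigD D))
    (w : List A) : B.Compatible f w ↔
      Fits B w ((RForest.toPForest f).toList.map (Prod.mk B.root)) := by
  rw [ForestLike.compatible_iff_listCompatible, listCompatible_iff_fits hB]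
  have h : ∀ f : RForest (sigD D), (f.terms.map fun t => (B.root, t)).flatMap
      (fun p => p.2.toForest.map (Prod.mk p.1)) =
      (RForest.toPForest f).toList.map (Prod.mk B.root) := by
    intro f
    induction f using FreeMonoid.inductionOn' with
    | one => rfl
    | of_mul t f ih =>
      have : RForest.terms (FreeMonoid.of t * f) = t.1 :: RForest.terms f := by
        simp [RForest.terms]
      rw [this, List.map_cons, List.flatMap_cons, ih, map_mul, FreeMonoid.toList_mul,
        List.map_append]
      congr 1
  rw [h]

theorem PForest.compatible_toRForest_iff {B : ForestLike (sigD D) A} (hB : IsUniform B)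
    (F : PForest D) (w : List A) :
    B.Compatible (PForest.toRForest F) w ↔ Fits B w (F.toList.map (Prod.mk B.root)) := by
  rw [compatible_iff_fits hB, PForest.toPForest_toRForest]

variable (K : Type v) [Field K]

theorem realizeNCK_E (B : ForestLike (sigD D) A) (F : PForest D) :
    realizeNCK K B (NCK.E K D F) = B.forestPoly K (PForest.toRForest F) := by
  rw [← ForestLike.realize_E]
  exact (NCK.E K D).constr_basis K _ F

open Classical in
theorem coeff_realizeNCK_E {B : ForestLike (sigD D) A} (hB : IsUniform B) (F : PForest D)
    (w : List A) : NCPoly.coeff (realizeNCK K B (NCK.E K D F)) w =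
      if Fits B w (F.toList.map (Prod.mk B.root)) then 1 else 0 := by
  rw [realizeNCK_E, ForestLike.coeff_forestPoly]
  simp only [PForest.compatible_toRForest_iff hB]

/-- The realization map of planar forests, as an algebra morphism. -/
def realizeNCKHom (B : ForestLike (sigD D) A) : NCK K D →ₐ[K] NCPoly K A :=
  NCK.algHomOfBasis (realizeNCK K B)
    (by rw [realizeNCK_E, map_one, ForestLike.forestPoly_one])
    (fun F G => by
      rw [realizeNCK_E, realizeNCK_E, realizeNCK_E, map_mul, ForestLike.forestPoly_mul])

/-- A reduced forest and the forest obtained from it by deleting leaves and restoring generators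
have the same planar forest, hence the same compatible words. -/
theorem realizeNCK_toNCK {B : ForestLike (sigD D) A} (hB : IsUniform B)
    (x : NatHopf K (sigD D)) : realizeNCK K B (NatHopf.toNCK K D x) = B.realize K x := by
  suffices H : realizeNCK K B ∘ₗ (NatHopf.toNCK K D).toLinearMap = B.realize K from
    LinearMap.congr_fun H x
  refine (NatHopf.E K (sigD D)).ext fun f => ?_
  rw [LinearMap.comp_apply, AlgHom.toLinearMap_apply, NatHopf.toNCK_E, realizeNCK_E,
    ForestLike.realize_E]
  refine Subtype.ext (funext fun w => ?_)
  refine (ForestLike.coeff_forestPoly K B _ w).trans ?_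
  refine Eq.trans ?_ (ForestLike.coeff_forestPoly K B _ w).symm
  classical
  exact if_congr (by
    rw [compatible_iff_fits hB, compatible_iff_fits hB, PForest.toPForest_toRForest]) rfl rfl

theorem realizeNCK_isHomogeneous (B : ForestLike (sigD D) A) (n : ℕ) (x : NCK K D)
    (hx : x ∈ NCK.component K D n) : NCPoly.IsHomogeneous (realizeNCK K B x) n := by
  have hdg : ∀ F : PForest D, (PForest.toRForest F).dg = F.size := by
    have tree : ∀ t : PTree D, t.toTerm.dg = t.size := by
      intro t
      induction t with
      | node d n c ih => rw [PTree.toTerm_node, Term.dg, PTree.size]; simp only [ih]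
    intro F
    induction F using FreeMonoid.inductionOn' with
    | one => rfl
    | of_mul t F ih =>
      rw [map_mul, RForest.dg_mul, ih, PForest.size_mul, PForest.size_of, PForest.toRForest,
        FreeMonoid.map_of, RForest.dg_of, tree]
  rw [NCK.component] at hx
  intro w hw
  by_contra hne
  refine hw ?_
  clear hw
  induction hx using Submodule.span_induction with
  | zero => rw [map_zero]; rfl
  | add x y _ _ hx hy =>
    rw [map_add]
    exact (congrArg₂ (· + ·) hx hy).trans (add_zero 0)
  | smul a x _ hx =>
    rw [map_smul]
    exact (congrArg (a * ·) hx).trans (mul_zero a)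
  | mem x hx =>
    obtain ⟨F, hF, rfl⟩ := hx
    classical
    rw [realizeNCK_E, ForestLike.coeff_forestPoly]
    exact if_neg fun h => hne (by rw [h.length_eq, hdg]; exact hF)

end Uniform

/-! ## Sums over the admissible cuts of tagged forests -/

section CutSum

variable {D : Type u} {X Y M : Type*} [AddCommMonoid M]

/-- The tagged pruned part: a pruned tree is tagged by `r'` if the cut is total, and by `q`
otherwise. -/
def prunedTagged (q r' : Y) : (t : PTree D) → PTree.Cut t → List (Y × PTree D)
  | .node d n c, none => [(r', .node d n c)]
  | .node d n c, some k => (PTree.pruned (.node d n c) (some k)).map (Prod.mk q)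

theorem prunedTagged_self (q : Y) (t : PTree D) (k : PTree.Cut t) :
    prunedTagged q q t k = (PTree.pruned t k).map (Prod.mk q) := by
  cases t with
  | node d n c => cases k <;> rfl

/-- The sum of the values of `Φ` at the trunks and at the pruned parts of the cuts of a forest, the
trees of which carry tags for the trunks and tags for the total cuts. -/
def cutSum (q : Y) : List (X × Y × PTree D) →
    (List (X × PTree D) → List (Y × PTree D) → M) → M
  | [], Φ => Φ [] []
  | (r, r', t) :: st, Φ => ∑ k : PTree.Cut t, cutSum q st fun l l' =>
      Φ ((PTree.trunk t k).map (Prod.mk r) ++ l) (prunedTagged q r' t k ++ l')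

theorem cutSum_append (q : Y) (st st' : List (X × Y × PTree D))
    (Φ : List (X × PTree D) → List (Y × PTree D) → M) :
    cutSum q (st ++ st') Φ =
      cutSum q st fun l l' => cutSum q st' fun m m' => Φ (l ++ m) (l' ++ m') := by
  induction st generalizing Φ with
  | nil => simp [cutSum]
  | cons p st ih =>
    obtain ⟨r, r', t⟩ := p
    simp only [List.cons_append, cutSum, ih, List.append_assoc]

/-- When total cuts carry the same tag `q` as the other pruned trees, tags no longer distinguish
cuts, and the sum has the shape of the coproduct of a forest. -/
theorem cutSum_ofFn (q : Y) (r : X) {n : ℕ} (c : Fin n → PTree D)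
    (Φ : List (X × PTree D) → List (Y × PTree D) → M) :
    cutSum q (List.ofFn fun i => (r, q, c i)) Φ = ∑ k : ∀ i, PTree.Cut (c i),
      Φ ((List.ofFn fun i => PTree.trunk (c i) (k i)).flatten.map (Prod.mk r))
        ((List.ofFn fun i => PTree.pruned (c i) (k i)).flatten.map (Prod.mk q)) := by
  induction n generalizing Φ with
  | zero => simp [cutSum]
  | succ n ih =>
    rw [List.ofFn_succ, cutSum, ← (Fin.consEquiv fun i => PTree.Cut (c i)).sum_comp,
      Fintype.sum_prod_type]
    refine Finset.sum_congr rfl fun k _ => ?_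
    rw [ih]
    refine Finset.sum_congr rfl fun k' _ => ?_
    simp [Fin.consEquiv, prunedTagged_self]

theorem cutSum_zero (q : Y) (st : List (X × Y × PTree D)) :
    cutSum q st (fun _ _ => (0 : M)) = 0 := by
  induction st with
  | nil => rfl
  | cons p st ih =>
    obtain ⟨r, r', t⟩ := p
    simp only [cutSum, ih, Finset.sum_const_zero]

theorem cutSum_graft_cons (q : Y) (r : X) (r' : Y) (d : D) (l : List (PTree D))
    (st : List (X × Y × PTree D)) (Φ : List (X × PTree D) → List (Y × PTree D) → M) :
    cutSum q ((r, r', PTree.graft d l) :: st) Φ =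
      cutSum q st (fun m m' => Φ m ((r', PTree.graft d l) :: m')) +
      ∑ k : ∀ i : Fin l.length, PTree.Cut (l.get i), cutSum q st fun m m' =>
        Φ ((r, PTree.graft d (List.ofFn fun i => PTree.trunk (l.get i) (k i)).flatten) :: m)
          ((List.ofFn fun i => PTree.pruned (l.get i) (k i)).flatten.map (Prod.mk q) ++ m') := by
  rw [cutSum]
  exact Fintype.sum_option (α := ∀ i : Fin l.length, PTree.Cut (l.get i)) _

theorem cutSum_map_append (q : Y) (r : X) (l : List (PTree D)) (st : List (X × Y × PTree D))
    (Φ : List (X × PTree D) → List (Y × PTree D) → M) :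
    cutSum q (l.map (fun t => (r, q, t)) ++ st) Φ =
      ∑ k : ∀ i : Fin l.length, PTree.Cut (l.get i), cutSum q st fun m m' =>
        Φ ((List.ofFn fun i => PTree.trunk (l.get i) (k i)).flatten.map (Prod.mk r) ++ m)
          ((List.ofFn fun i => PTree.pruned (l.get i) (k i)).flatten.map (Prod.mk q) ++ m') := by
  have h : l.map (fun t => (r, q, t)) = List.ofFn fun i => (r, q, l.get i) := by
    conv_lhs => rw [← List.ofFn_get l, List.map_ofFn]
    rfl
  rw [cutSum_append, h, cutSum_ofFn]

/-- If `Φ` vanishes on the trunks with a tag `r`, then the trees with the tag `r` are cut totally. -/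
theorem cutSum_of_vanishing (q : Y) (r : X) (r' : Y) (l : List (PTree D))
    (st : List (X × Y × PTree D)) (Φ : List (X × PTree D) → List (Y × PTree D) → M)
    (hΦ : ∀ m m' t, (r, t) ∈ m → Φ m m' = 0) :
    cutSum q (l.map (fun t => (r, r', t)) ++ st) Φ =
      cutSum q st fun m m' => Φ m (l.map (Prod.mk r') ++ m') := by
  induction l generalizing Φ with
  | nil => rfl
  | cons t l ih =>
    obtain ⟨d, n, c⟩ := t
    -- A non-total cut leaves a trunk tagged by `r`, on which `Φ` vanishes; only the total cut of
    -- the first tree survives.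
    rw [PTree.node_eq_graft, List.map_cons, List.cons_append, cutSum_graft_cons,
      Finset.sum_eq_zero, add_zero, ih]
    · rfl
    · intro m m' t ht
      exact hΦ _ _ t ht
    · intro k _
      simp only [hΦ _ _ _ List.mem_cons_self]
      exact cutSum_zero q _

end CutSum

/-! ## Splitting words on a disjoint sum of alphabets -/

section Split

variable {K : Type v} [Field K] {A A' : Type u}

/-- The sum of the values of `f` at the words with given restrictions. -/
def splitSum (f : List (A ⊕ A') → K) (p : List A × List A') : K :=
  ∑ w ∈ (finite_restrictions p).toFinset, f w

/-- Words with prescribed restrictions are sorted by their first letter: none, the head of `u`, or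
the head of `v`. -/
theorem splitSum_rec (f : List (A ⊕ A') → K) (u : List A) (v : List A') :
    splitSum f (u, v) = (match u, v with | [], [] => f [] | _, _ => 0) +
      ((match u with
        | [] => 0
        | a :: u => splitSum (fun w => f (.inl a :: w)) (u, v)) +
      (match v with
        | [] => 0
        | b :: v => splitSum (fun w => f (.inr b :: w)) (u, v))) := by
  classical
  have memfib : ∀ (p : List A × List A') (w : List (A ⊕ A')),
      w ∈ (finite_restrictions p).toFinset ↔ leftPart w = p.1 ∧ rightPart w = p.2 := by
    intro p w; simp
  have inlinj : ∀ a : A, Function.Injective (List.cons (Sum.inl a : A ⊕ A')) :=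
    fun a => List.cons_injective
  have inrinj : ∀ b : A', Function.Injective (List.cons (Sum.inr b : A ⊕ A')) :=
    fun b => List.cons_injective
  have imgl : ∀ (a : A) (u : List A) (v : List A'),
      splitSum (fun w => f (.inl a :: w)) (u, v) =
        ∑ w ∈ ((finite_restrictions (u, v)).toFinset.image (List.cons (Sum.inl a))), f w :=
    fun a u v => (Finset.sum_image fun x _ y _ h => inlinj a h).symm
  have imgr : ∀ (b : A') (u : List A) (v : List A'),
      splitSum (fun w => f (.inr b :: w)) (u, v) =
        ∑ w ∈ ((finite_restrictions (u, v)).toFinset.image (List.cons (Sum.inr b))), f w :=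
    fun b u v => (Finset.sum_image fun x _ y _ h => inrinj b h).symm
  rcases u with _ | ⟨a, u⟩ <;> rcases v with _ | ⟨b, v⟩
  · have : (finite_restrictions (([], []) : List A × List A')).toFinset = {[]} := by
      ext w
      rw [memfib, Finset.mem_singleton]
      rcases w with _ | ⟨x | x, w⟩ <;> simp [leftPart, rightPart]
    rw [splitSum, this, Finset.sum_singleton]
    simp
  · have : (finite_restrictions (([], b :: v) : List A × List A')).toFinset =
        (finite_restrictions (([], v) : List A × List A')).toFinset.image
          (List.cons (Sum.inr b)) := by
      ext w
      rw [memfib, Finset.mem_image]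
      rcases w with _ | ⟨x | x, w⟩ <;> simp [leftPart, rightPart]
      tauto
    rw [splitSum, this]
    simp only [zero_add, imgr]
  · have : (finite_restrictions ((a :: u, []) : List A × List A')).toFinset =
        (finite_restrictions ((u, []) : List A × List A')).toFinset.image
          (List.cons (Sum.inl a)) := by
      ext w
      rw [memfib, Finset.mem_image]
      rcases w with _ | ⟨x | x, w⟩ <;> simp [leftPart, rightPart]
      tauto
    rw [splitSum, this]
    simp only [zero_add, add_zero, imgl]
  · have : (finite_restrictions ((a :: u, b :: v) : List A × List A')).toFinset =
        (finite_restrictions ((u, b :: v) : List A × List A')).toFinset.image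
          (List.cons (Sum.inl a)) ∪
        (finite_restrictions ((a :: u, v) : List A × List A')).toFinset.image
          (List.cons (Sum.inr b)) := by
      ext w
      rw [memfib, Finset.mem_union, Finset.mem_image, Finset.mem_image]
      rcases w with _ | ⟨x | x, w⟩ <;> simp [leftPart, rightPart] <;> tauto
    rw [splitSum, this, Finset.sum_union]
    · simp only [zero_add, imgl, imgr]
    · rw [Finset.disjoint_left]
      intro w h1 h2
      rw [Finset.mem_image] at h1 h2
      obtain ⟨w1, _, rfl⟩ := h1
      obtain ⟨w2, _, h⟩ := h2
      simp at h

end Split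

/-! ## Doubling alphabets -/

section Doubling

variable {K : Type v} [Field K] {D A A' : Type u}

/-- A fitting word eventually reads the root of every listed tree, and no letter satisfies the false
condition. This expresses that nodes above a letter of `A'` cannot return to `A`. -/
theorem not_fits_of_mem (B : ForestLike (sigD D) A) (w : List A)
    (st : List ((A → Prop) × PTree D)) (t : PTree D) (ht : ((fun _ => False), t) ∈ st) :
    ¬ Fits B w st := by
  induction w generalizing st with
  | nil =>
    rw [fits_nil_left]
    rintro rfl
    exact absurd ht List.not_mem_nil
  | cons a w ih =>
    rcases st with _ | ⟨⟨R, s⟩, st⟩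
    · exact absurd ht List.not_mem_nil
    · obtain ⟨d, n, c⟩ := s
      rw [PTree.node_eq_graft, fits_cons]
      rintro ⟨hR, _, h⟩
      rcases List.mem_cons.mp ht with h' | h'
      · have := congrArg Prod.fst h'
        simp only at this
        rw [← this] at hR
        exact hR
      · exact ih _ (List.mem_append_right _ h') h

/-- The root condition on a disjoint sum of alphabets. -/
def sumTag (p : (A → Prop) × (A' → Prop) × PTree D) : (A ⊕ A' → Prop) × PTree D :=
  (Sum.elim p.1 p.2.1, p.2.2)

theorem sum_root (B : ForestLike (sigD D) A) (B' : ForestLike (sigD D) A') :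
    (B.sum B').root = Sum.elim B.root B'.root := by
  funext x; cases x <;> rfl

theorem sum_edge_inl (B : ForestLike (sigD D) A) (B' : ForestLike (sigD D) A') (j : ℕ) (a : A) :
    (B.sum B').edge j (.inl a) = Sum.elim (B.edge j a) B'.root := by
  funext x; cases x <;> rfl

theorem sum_edge_inr (B : ForestLike (sigD D) A) (B' : ForestLike (sigD D) A') (j : ℕ) (b : A') :
    (B.sum B').edge j (.inr b) = Sum.elim (fun _ => False) (B'.edge j b) := by
  funext x; cases x <;> rfl

-- The combinatorial core of doubling. Each tree carries two root conditions, one for a root letter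
-- in `A` and one for a root letter in `A'`. If the first root gets a letter `a` of `A`, it stays in
-- the trunk, and each child must be either in relation with `a` or a root in `A'`. If it gets a
-- letter of `A'`, the whole tree is pruned. These two cases are the two terms of
-- `cutSum_graft_cons`, and the remaining words are shorter.
open Classical in
theorem splitSum_fits (B : ForestLike (sigD D) A) (B' : ForestLike (sigD D) A') (n : ℕ) :
    ∀ (u : List A) (v : List A') (st : List ((A → Prop) × (A' → Prop) × PTree D)),
      u.length + v.length = n →
      splitSum (fun w => if Fits (B.sum B') w (st.map sumTag) then (1 : K) else 0) (u, v) =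
        cutSum B'.root st fun m m' =>
          (if Fits B u m then (1 : K) else 0) * (if Fits B' v m' then 1 else 0) := by
  induction n using Nat.strong_induction_on with
  | _ n ih =>
    intro u v st hn
    rw [splitSum_rec]
    rcases st with _ | ⟨⟨R, R', t⟩, st⟩
    · have hz : ∀ p : List A × List A', splitSum (fun _ => (0 : K)) p = 0 :=
        fun p => Finset.sum_const_zero
      simp only [List.map_nil, fits_nil_right, cutSum, reduceCtorEq, if_false, hz]
      rcases u with _ | ⟨a, u⟩ <;> rcases v with _ | ⟨b, v⟩ <;> simp
    · obtain ⟨d, k, c⟩ := t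
      rw [PTree.node_eq_graft]
      generalize List.ofFn c = l
      have h0 : (match u, v with
          | [], [] => if Fits (B.sum B') [] (((R, R', PTree.graft d l) :: st).map sumTag)
            then (1 : K) else 0
          | _, _ => 0) = 0 := by
        rcases u with _ | ⟨a, u⟩ <;> rcases v with _ | ⟨b, v⟩ <;> simp [fits_nil_left]
      -- The order is changed so that a first letter in `A'` is paired with the total cut, and a
      -- first letter in `A` with the cuts that keep the root.
      rw [h0, zero_add, cutSum_graft_cons, add_comm]
      congr 1
      · rcases v with _ | ⟨b, v⟩
        · simp only [fits_nil_left, reduceCtorEq, if_false, mul_zero]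
          exact (cutSum_zero _ _).symm
        · have hf : ∀ w, Fits (B.sum B') (.inr b :: w)
              (((R, R', PTree.graft d l) :: st).map sumTag) ↔
              (R' b ∧ B'.dec 0 (generator 0 d) b) ∧ Fits (B.sum B') w
                ((l.map (fun t => ((fun _ => False), B'.edge 0 b, t)) ++ st).map sumTag) := by
            intro w
            rw [List.map_cons, sumTag, fits_cons, sum_edge_inr, List.map_append, List.map_map,
              and_assoc]
            rfl
          simp only [hf, fits_cons, ← and_assoc]
          by_cases hb : R' b ∧ B'.dec 0 (generator 0 d) b
          · simp only [hb, true_and, and_self]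
            -- The children now carry the false condition for `A`, so every cut leaving a part of
            -- them in the trunk contributes zero.
            rw [ih _ (by simp at hn; omega) u v _ rfl, cutSum_of_vanishing]
            intro m m' t ht
            rw [if_neg (not_fits_of_mem B u m t ht), zero_mul]
          · simp only [hb, false_and, if_false, mul_zero]
            exact Finset.sum_const_zero.trans (cutSum_zero _ _).symm
      · rcases u with _ | ⟨a, u⟩
        · simp only [fits_nil_left, reduceCtorEq, if_false, zero_mul, cutSum_zero,
            Finset.sum_const_zero]
        · have hf : ∀ w, Fits (B.sum B') (.inl a :: w)
              (((R, R', PTree.graft d l) :: st).map sumTag) ↔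
              (R a ∧ B.dec 0 (generator 0 d) a) ∧ Fits (B.sum B') w
                ((l.map (fun t => (B.edge 0 a, B'.root, t)) ++ st).map sumTag) := by
            intro w
            rw [List.map_cons, sumTag, fits_cons, sum_edge_inl, List.map_append, List.map_map,
              and_assoc]
            rfl
          simp only [hf, fits_cons, ← and_assoc]
          by_cases ha : R a ∧ B.dec 0 (generator 0 d) a
          · simp only [ha, true_and, and_self]
            rw [ih _ (by simp at hn; omega) u v _ rfl, cutSum_map_append]
          · simp only [ha, false_and, if_false, zero_mul, cutSum_zero]
            exact Finset.sum_const_zero.trans Finset.sum_const_zero.symm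

theorem isUniform_sum {B : ForestLike (sigD D) A} {B' : ForestLike (sigD D) A'}
    (hB : IsUniform B) (hB' : IsUniform B') : IsUniform (B.sum B') := by
  refine ⟨fun d n n' => ?_, fun j j' => ?_⟩
  · funext x
    cases x with
    | inl a => exact congrFun (hB.1 d n n') a
    | inr a => exact congrFun (hB'.1 d n n') a
  · funext x y
    cases x with
    | inl a =>
      cases y with
      | inl b => exact congrFun₂ (hB.2 j j') a b
      | inr b => rfl
    | inr a =>
      cases y with
      | inl b => rfl
      | inr b => exact congrFun₂ (hB'.2 j j') a b

theorem evalTensor_tmul (f : NCPoly K A) (g : NCPoly K A') (p : List A × List A') :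
    evalTensor (f ⊗ₜ[K] g) p = NCPoly.coeff f p.1 * NCPoly.coeff g p.2 := rfl

/-- Realizing on a disjoint sum of alphabets doubles the forests. -/
theorem theta_realizeNCK_sum {B : ForestLike (sigD D) A} {B' : ForestLike (sigD D) A'}
    (hB : IsUniform B) (hB' : IsUniform B') (x : NCK K D) :
    theta (realizeNCK K (B.sum B') x) =
      evalTensor (TensorProduct.map (realizeNCK K B) (realizeNCK K B') (NCK.comulOpp K D x)) := by
  classical
  let thetaMap : NCPoly K (A ⊕ A') →ₗ[K] (List A × List A' → K) :=
    { toFun := theta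
      map_add' := fun f g => funext fun p => Finset.sum_add_distrib
      map_smul' := fun a f => funext fun p => (Finset.mul_sum _ _ _).symm }
  suffices H : thetaMap ∘ₗ realizeNCK K (B.sum B') = evalTensor ∘ₗ
      TensorProduct.map (realizeNCK K B) (realizeNCK K B') ∘ₗ NCK.comulOpp K D from
    LinearMap.congr_fun H x
  refine NCK.linearMap_ext fun F => funext fun p => ?_
  obtain ⟨u, v⟩ := p
  simp only [LinearMap.comp_apply]
  change splitSum (NCPoly.coeff (realizeNCK K (B.sum B') (NCK.E K D F))) (u, v) = _
  have h1 : NCPoly.coeff (realizeNCK K (B.sum B') (NCK.E K D F)) = fun w =>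
      if Fits (B.sum B') w
        (((List.ofFn fun i => (B.root, B'.root, List.get F.toList i))).map sumTag)
      then (1 : K) else 0 := by
    funext w
    rw [coeff_realizeNCK_E K (isUniform_sum hB hB'), sum_root, List.map_ofFn]
    have : F.toList.map (Prod.mk (Sum.elim B.root B'.root)) =
        List.ofFn (sumTag ∘ fun i => (B.root, B'.root, List.get F.toList i)) := by
      conv_lhs => rw [← List.ofFn_get F.toList, List.map_ofFn]
      rfl
    rw [this]
  have h2 : NCK.comulOpp K D (NCK.E K D F) =
      ∑ k : ∀ i, PTree.Cut (List.get F.toList i),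
        NCK.E K D (FreeMonoid.ofList
          (List.ofFn fun i => PTree.trunk (List.get F.toList i) (k i)).flatten) ⊗ₜ[K]
        NCK.E K D (FreeMonoid.ofList
          (List.ofFn fun i => PTree.pruned (List.get F.toList i) (k i)).flatten) := by
    have h := NCK.comulHom_ofFn (K := K) (List.get F.toList)
    rw [List.ofFn_get, FreeMonoid.ofList_toList] at h
    rw [NCK.comulOpp, LinearMap.comp_apply, NCK.comul_apply, h, map_sum]
    rfl
  -- At the top level a totally cut tree must start with a root letter of `A'`, the same condition
  -- as for every other pruned tree, so the two tags agree.
  rw [h1, splitSum_fits B B' _ u v _ rfl, cutSum_ofFn, h2, map_sum, map_sum, Finset.sum_apply]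
  refine Finset.sum_congr rfl fun k _ => ?_
  rw [TensorProduct.map_tmul, evalTensor_tmul, coeff_realizeNCK_E K hB, coeff_realizeNCK_E K hB']
  rfl

end Doubling

/-! ## Injectivity of the realization -/

section Injectivity

variable {D : Type u}

/-- The word of the decorations and of the depths of the nodes of a tree, in preorder, where the
depth of the root is given. -/
def PTree.depthWord : PTree D → ℕ → List (D × ℕ)
  | node d _ c, h => (d, h) :: (List.ofFn fun i => depthWord (c i) (h + 1)).flatten

/-- The word of the decorations and of the depths of the nodes of a list of trees. -/
def depthWord (st : List (ℕ × PTree D)) : List (D × ℕ) := st.flatMap fun p => p.2.depthWord p.1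

/-- The same stack recursion as `fits_cons`, with depths in place of root conditions; this allows
the two to be compared by induction on words. -/
theorem depthWord_cons (h : ℕ) (d : D) (l : List (PTree D)) (st : List (ℕ × PTree D)) :
    depthWord ((h, PTree.graft d l) :: st) =
      (d, h) :: depthWord (l.map (Prod.mk (h + 1)) ++ st) := by
  have hl : (List.ofFn fun i => (l.get i).depthWord (h + 1)) =
      l.map fun t => t.depthWord (h + 1) := by
    conv_rhs => rw [← List.ofFn_get l, List.map_ofFn]
    rfl
  rw [depthWord, depthWord, List.flatMap_cons, PTree.graft, PTree.depthWord, hl,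
    List.flatMap_append, List.flatMap_map, List.flatMap_def (l := l)]
  rfl

/-- The labels of a word compatible with a forest are at least the depths. -/
theorem depthWord_le_of_fits (w : List (D × ℕ)) :
    ∀ s : List ((D × ℕ → Prop) × ℕ × PTree D), (∀ p ∈ s, ∀ a, p.1 a → p.2.1 ≤ a.2) →
      Fits (alphD D) w (s.map fun p => (p.1, p.2.2)) →
      List.Forall₂ (fun x y => x.1 = y.1 ∧ x.2 ≤ y.2) (depthWord (s.map Prod.snd)) w := by
  induction w with
  | nil =>
    intro s _ h
    rw [fits_nil_left, List.map_eq_nil_iff] at h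
    rw [h]
    exact List.Forall₂.nil
  | cons a w ih =>
    intro s hs h
    rcases s with _ | ⟨⟨R, m, t⟩, s⟩
    · exact absurd ((fits_nil_right _ _).mp h) (by simp)
    · obtain ⟨d, n, c⟩ := t
      rw [PTree.node_eq_graft] at *
      generalize List.ofFn c = l at *
      rw [List.map_cons, fits_cons] at h
      obtain ⟨hR, hd, h⟩ := h
      have hm : m ≤ a.2 := hs _ List.mem_cons_self a hR
      rw [List.map_cons, depthWord_cons]
      refine List.Forall₂.cons ⟨hd.symm, hm⟩ ?_
      have := ih (l.map (fun t => ((alphD D).edge 0 a, m + 1, t)) ++ s) ?_ ?_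
      · rw [List.map_append, List.map_map] at this
        exact this
      · intro p hp b hb
        rcases List.mem_append.mp hp with hp | hp
        · obtain ⟨t, _, rfl⟩ := List.mem_map.mp hp
          have hb' : a.2 < b.2 := hb
          change m + 1 ≤ b.2
          omega
        · exact hs p (List.mem_cons_of_mem _ hp) b hb
      · rw [List.map_append, List.map_map]
        exact h

/-- A forest is compatible with its word of depths. -/
theorem fits_depthWord (w : List (D × ℕ)) :
    ∀ s : List ((D × ℕ → Prop) × ℕ × PTree D), (∀ p ∈ s, ∀ d, p.1 (d, p.2.1)) →
      depthWord (s.map Prod.snd) = w → Fits (alphD D) w (s.map fun p => (p.1, p.2.2)) := by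
  induction w with
  | nil =>
    intro s _ h
    rcases s with _ | ⟨⟨R, m, t⟩, s⟩
    · rw [fits_nil_left]; rfl
    · obtain ⟨d, n, c⟩ := t
      rw [PTree.node_eq_graft, List.map_cons, depthWord_cons] at h
      exact absurd h (by simp)
  | cons a w ih =>
    intro s hs h
    rcases s with _ | ⟨⟨R, m, t⟩, s⟩
    · exact absurd h (by simp [depthWord])
    · obtain ⟨d, n, c⟩ := t
      rw [PTree.node_eq_graft] at *
      generalize List.ofFn c = l at *
      rw [List.map_cons, depthWord_cons, List.cons.injEq] at h
      obtain ⟨rfl, h⟩ := h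
      rw [List.map_cons, fits_cons]
      refine ⟨hs _ List.mem_cons_self d, rfl, ?_⟩
      have := ih (l.map (fun t => ((alphD D).edge 0 (d, m), m + 1, t)) ++ s) ?_ ?_
      · rw [List.map_append, List.map_map] at this
        exact this
      · intro p hp b
        rcases List.mem_append.mp hp with hp | hp
        · obtain ⟨t, _, rfl⟩ := List.mem_map.mp hp
          exact Nat.lt_succ_self m
        · exact hs p (List.mem_cons_of_mem _ hp) b
      · rw [List.map_append, List.map_map]
        exact h

/-- A list of trees at nonincreasing depths is determined by its word of depths. -/
theorem depthWord_injective (w : List (D × ℕ)) : ∀ st st' : List (ℕ × PTree D),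
    st.Pairwise (fun p q => q.1 ≤ p.1) → st'.Pairwise (fun p q => q.1 ≤ p.1) →
    depthWord st = w → depthWord st' = w → st = st' := by
  induction w with
  | nil =>
    have hnil : ∀ st : List (ℕ × PTree D), depthWord st = [] → st = [] := by
      intro st h
      rcases st with _ | ⟨⟨m, t⟩, s⟩
      · rfl
      · obtain ⟨d, n, c⟩ := t
        rw [PTree.node_eq_graft, depthWord_cons] at h
        exact absurd h (by simp)
    intro st st' _ _ h h'
    rw [hnil st h, hnil st' h']
  | cons a w ih =>
    have hcons : ∀ st : List (ℕ × PTree D), depthWord st = a :: w →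
        ∃ l s, st = (a.2, PTree.graft a.1 l) :: s ∧
          depthWord (l.map (Prod.mk (a.2 + 1)) ++ s) = w := by
      intro st h
      rcases st with _ | ⟨⟨m, t⟩, s⟩
      · exact absurd h (by simp [depthWord])
      · obtain ⟨d, n, c⟩ := t
        rw [PTree.node_eq_graft, depthWord_cons, List.cons.injEq] at h
        obtain ⟨rfl, h⟩ := h
        exact ⟨_, s, by rw [PTree.node_eq_graft], h⟩
    intro st st' hst hst' h h'
    obtain ⟨l, s, rfl, hw⟩ := hcons st h
    obtain ⟨l', s', rfl, hw'⟩ := hcons st' h'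
    have hpair : ∀ (l : List (PTree D)) (s : List (ℕ × PTree D)) (t : PTree D),
        ((a.2, t) :: s).Pairwise (fun p q => q.1 ≤ p.1) →
        (l.map (Prod.mk (a.2 + 1)) ++ s).Pairwise (fun p q => q.1 ≤ p.1) := by
      intro l s t hs
      rw [List.pairwise_cons] at hs
      rw [List.pairwise_append, List.pairwise_map]
      refine ⟨List.pairwise_of_forall fun _ _ => le_rfl, hs.2, fun p hp q hq => ?_⟩
      obtain ⟨t, _, rfl⟩ := List.mem_map.mp hp
      have := hs.1 q hq
      simp only at this ⊢
      omega
    have heq := ih _ _ (hpair l s _ hst) (hpair l' s' _ hst') hw hw'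
    -- Entries below the popped tree have depth at most `a.2`, so those of depth `a.2 + 1` are
    -- exactly its children. Filtering by depth thus recovers where the children end in the merged
    -- list.
    have hfilter : ∀ (l : List (PTree D)) (s : List (ℕ × PTree D)) (t : PTree D),
        ((a.2, t) :: s).Pairwise (fun p q => q.1 ≤ p.1) →
        (l.map (Prod.mk (a.2 + 1)) ++ s).filter (fun p => p.1 = a.2 + 1) =
          l.map (Prod.mk (a.2 + 1)) := by
      intro l s t hs
      rw [List.pairwise_cons] at hs
      rw [List.filter_append, List.filter_eq_self.mpr, List.filter_eq_nil_iff.mpr, List.append_nil]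
      · intro p hp
        have := hs.1 p hp
        simp only at this
        simp only [decide_eq_true_eq]
        omega
      · intro p hp
        obtain ⟨t, _, rfl⟩ := List.mem_map.mp hp
        simp
    have hl : l.map (Prod.mk (a.2 + 1)) = l'.map (Prod.mk (a.2 + 1)) := by
      rw [← hfilter l s _ hst, ← hfilter l' s' _ hst', heq]
    rw [hl, List.append_cancel_left_eq] at heq
    have hll : l = l' := List.map_injective_iff.mpr (Prod.mk_right_injective _) hl
    rw [heq, hll]

/-- Comparing sums of labels makes the termwise order usable for a minimality argument: among
comparable words, equal sums force equality. -/
theorem sum_snd_le {x y : List (D × ℕ)}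
    (h : List.Forall₂ (fun x y => x.1 = y.1 ∧ x.2 ≤ y.2) x y) :
    (x.map Prod.snd).sum ≤ (y.map Prod.snd).sum ∧
      ((x.map Prod.snd).sum = (y.map Prod.snd).sum → x = y) := by
  induction h with
  | nil => exact ⟨le_rfl, fun _ => rfl⟩
  | cons hab _ ih =>
    simp only [List.map_cons, List.sum_cons]
    refine ⟨by omega, fun h => ?_⟩
    rw [ih.2 (by omega), Prod.ext hab.1 (by omega)]

/-- The word of depths of a planar forest. -/
def PForest.depthWord (F : PForest D) : List (D × ℕ) :=
  ForestHopf.depthWord (F.toList.map (Prod.mk 0))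

theorem PForest.fits_depthWord (F : PForest D) :
    Fits (alphD D) F.depthWord (F.toList.map (Prod.mk (alphD D).root)) := by
  have := ForestHopf.fits_depthWord _ (F.toList.map fun t => ((alphD D).root, 0, t))
    (fun p hp d => by
      obtain ⟨t, _, rfl⟩ := List.mem_map.mp hp
      trivial) rfl
  rw [List.map_map, List.map_map] at this
  exact this

/-- Labels strictly increase along edges, so the depth word of `G` lies termwise below any word
compatible with `G`, in particular below that of `F`. The assumption on sums forces equality, and
depth words determine forests. -/
theorem PForest.eq_of_fits_depthWord {F G : PForest D}
    (h : Fits (alphD D) F.depthWord (G.toList.map (Prod.mk (alphD D).root)))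
    (hle : (F.depthWord.map Prod.snd).sum ≤ (G.depthWord.map Prod.snd).sum) : G = F := by
  have h1 := depthWord_le_of_fits F.depthWord (G.toList.map fun t => ((alphD D).root, 0, t))
    (fun p hp a _ => by
      obtain ⟨t, _, rfl⟩ := List.mem_map.mp hp
      exact Nat.zero_le _) (by rw [List.map_map]; exact h)
  rw [List.map_map] at h1
  have h2 := sum_snd_le h1
  have h3 : G.depthWord = F.depthWord := h2.2 (le_antisymm h2.1 hle)
  have hp : ∀ F : PForest D, (F.toList.map (Prod.mk 0)).Pairwise (fun p q => q.1 ≤ p.1) := by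
    intro F
    rw [List.pairwise_map]
    exact List.pairwise_of_forall fun _ _ => le_rfl
  have h4 := depthWord_injective _ _ _ (hp G) (hp F) h3 rfl
  exact List.map_injective_iff.mpr (Prod.mk_right_injective _) h4

theorem isUniform_alphD : IsUniform (alphD D) := ⟨fun _ _ _ => rfl, fun _ _ => rfl⟩

/-- Triangularity: for `F` in the support of `x` with least sum of depths, no other forest of the
support is compatible with the depth word of `F`. The coefficient of this word in the realization is
therefore that of `F` in `x`. -/
theorem realizeNCK_alphD_injective (K : Type v) [Field K] :
    Function.Injective (realizeNCK K (alphD D)) := by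
  classical
  rw [injective_iff_map_eq_zero]
  intro x hx
  by_contra hne
  have hsupp : ((NCK.E K D).repr x).support.Nonempty := by
    rw [Finsupp.support_nonempty_iff]
    exact fun h => hne ((NCK.E K D).repr.map_eq_zero_iff.mp h)
  obtain ⟨F, hF, hmin⟩ := Finset.exists_min_image _
    (fun F : PForest D => (F.depthWord.map Prod.snd).sum) hsupp
  let c : NCPoly K (D × ℕ) →ₗ[K] K :=
    { toFun := fun f => NCPoly.coeff f F.depthWord
      map_add' := fun _ _ => rfl
      map_smul' := fun _ _ => rfl }
  have h1 : c (realizeNCK K (alphD D) x) = (NCK.E K D).repr x F := by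
    conv_lhs => rw [← (NCK.E K D).linearCombination_repr x]
    rw [Finsupp.linearCombination_apply, Finsupp.sum, map_sum, map_sum, Finset.sum_eq_single F]
    · rw [map_smul, map_smul]
      change _ • NCPoly.coeff _ _ = _
      rw [coeff_realizeNCK_E K isUniform_alphD, if_pos F.fits_depthWord, smul_eq_mul, mul_one]
    · intro G hG hGF
      rw [map_smul, map_smul]
      change _ • NCPoly.coeff _ _ = _
      rw [coeff_realizeNCK_E K isUniform_alphD, if_neg, smul_zero]
      exact fun h => hGF (PForest.eq_of_fits_depthWord h (hmin G hG))
    · intro h; exact absurd hF h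
  rw [hx, map_zero] at h1
  exact Finsupp.mem_support_iff.mp hF h1.symm

end Injectivity

/-! ## The disjoint sum in the opposite order -/

section Opposite

variable {K : Type v} [Field K] {D A A' : Type u}

theorem compatible_sumOpp_iff {S : ℕ → Type u} (B : ForestLike S A) (B' : ForestLike S A')
    (f : RForest S) (w : List (A ⊕ A')) :
    (B.sumOpp B').Compatible f w ↔ (B'.sum B).Compatible f (w.map Sum.swap) := by
  constructor
  · intro h
    refine ⟨by rw [List.length_map, h.length_eq], ?_, ?_, ?_⟩
    · intro i x hx hr
      obtain ⟨y, hy, rfl⟩ := Option.map_eq_some_iff.mp ((List.getElem?_map ..).symm.trans hx)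
      exact h.root i y hy hr
    · intro i x n g hx hd
      obtain ⟨y, hy, rfl⟩ := Option.map_eq_some_iff.mp ((List.getElem?_map ..).symm.trans hx)
      exact h.dec i y n g hy hd
    · intro j i i' x x' hx hx' he
      obtain ⟨y, hy, rfl⟩ := Option.map_eq_some_iff.mp ((List.getElem?_map ..).symm.trans hx)
      obtain ⟨y', hy', rfl⟩ := Option.map_eq_some_iff.mp ((List.getElem?_map ..).symm.trans hx')
      exact h.edge j i i' y y' hy hy' he
  · intro h
    have hm : ∀ (i : ℕ) (x : A ⊕ A'), w[i]? = some x → (w.map Sum.swap)[i]? = some x.swap := by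
      intro i x hx
      rw [List.getElem?_map, hx]; rfl
    refine ⟨by rw [← h.length_eq, List.length_map], ?_, ?_, ?_⟩
    · intro i x hx hr
      exact h.root i _ (hm i x hx) hr
    · intro i x n g hx hd
      exact h.dec i _ n g (hm i x hx) hd
    · intro j i i' x x' hx hx' he
      exact h.edge j i i' _ _ (hm i x hx) (hm i' x' hx') he

theorem coeff_realizeNCK_sumOpp (B : ForestLike (sigD D) A) (B' : ForestLike (sigD D) A')
    (x : NCK K D) (w : List (A ⊕ A')) :
    NCPoly.coeff (realizeNCK K (B.sumOpp B') x) w =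
      NCPoly.coeff (realizeNCK K (B'.sum B) x) (w.map Sum.swap) := by
  let c : ∀ {A : Type u}, List A → NCPoly K A →ₗ[K] K := fun w =>
    { toFun := fun f => NCPoly.coeff f w
      map_add' := fun _ _ => rfl
      map_smul' := fun _ _ => rfl }
  suffices H : c w ∘ₗ realizeNCK K (B.sumOpp B') = c (w.map Sum.swap) ∘ₗ realizeNCK K (B'.sum B)
    from LinearMap.congr_fun H x
  refine NCK.linearMap_ext fun F => ?_
  change NCPoly.coeff _ _ = NCPoly.coeff _ _
  classical
  rw [realizeNCK_E, realizeNCK_E, ForestLike.coeff_forestPoly, ForestLike.coeff_forestPoly]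
  exact if_congr (compatible_sumOpp_iff _ _ _ _) rfl rfl

theorem leftPart_map_swap (w : List (A ⊕ A')) : leftPart (w.map Sum.swap) = rightPart w := by
  rw [leftPart, rightPart, List.filterMap_map]
  congr 1
  funext x
  cases x <;> rfl

theorem rightPart_map_swap (w : List (A ⊕ A')) : rightPart (w.map Sum.swap) = leftPart w := by
  rw [leftPart, rightPart, List.filterMap_map]
  congr 1
  funext x
  cases x <;> rfl

/-- Swapping the summands is a bijection from the words with restrictions `(u, v)` to those with
restrictions `(v, u)`. The doubling formula for `B'.sum B` then exchanges the factors of `Δ^op`,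
which gives back `Δ`. -/
theorem theta_realizeNCK_sumOpp {B : ForestLike (sigD D) A} {B' : ForestLike (sigD D) A'}
    (hB : IsUniform B) (hB' : IsUniform B') (x : NCK K D) :
    theta (realizeNCK K (B.sumOpp B') x) = evalTensor (TensorProduct.map (realizeNCK K B)
      (realizeNCK K B') (CoalgebraStruct.comul (R := K) x)) := by
  funext p
  obtain ⟨u, v⟩ := p
  have h1 : theta (realizeNCK K (B.sumOpp B') x) (u, v) =
      theta (realizeNCK K (B'.sum B) x) (v, u) := by
    have hswap : ∀ {A A' : Type u} (w : List (A ⊕ A')),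
        (w.map Sum.swap).map Sum.swap = w := by
      intro A A' w; simp
    refine Finset.sum_bij' (fun w _ => w.map Sum.swap) (fun w _ => w.map Sum.swap) ?_ ?_
      (fun w _ => hswap w) (fun w _ => hswap w) (fun w _ => coeff_realizeNCK_sumOpp B B' x w)
    · intro w hw
      simp only [Set.Finite.mem_toFinset, Set.mem_ofPred_eq, leftPart_map_swap,
        rightPart_map_swap] at hw ⊢
      exact hw.symm
    · intro w hw
      simp only [Set.Finite.mem_toFinset, Set.mem_ofPred_eq, leftPart_map_swap,
        rightPart_map_swap] at hw ⊢
      exact hw.symm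
  rw [h1, theta_realizeNCK_sum hB' hB, NCK.comulOpp, LinearMap.comp_apply]
  generalize CoalgebraStruct.comul (R := K) x = z
  induction z using TensorProduct.induction_on with
  | zero => simp
  | tmul a b =>
    simp only [LinearEquiv.coe_coe, TensorProduct.comm_tmul, TensorProduct.map_tmul,
      evalTensor_tmul]
    rw [mul_comm]
  | add a b ha hb => simp only [map_add, Pi.add_apply, ha, hb]

theorem isUniform_sumOpp {B : ForestLike (sigD D) A} {B' : ForestLike (sigD D) A'}
    (hB : IsUniform B) (hB' : IsUniform B') : IsUniform (B.sumOpp B') := by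
  have h := isUniform_sum hB' hB
  exact ⟨fun d n n' => funext fun x => congrFun (h.1 d n n') x.swap,
    fun j j' => funext fun x => funext fun y => congrFun₂ (h.2 j j') x.swap y.swap⟩

theorem isIso_sumAssoc {S : ℕ → Type u} {A'' : Type u} (B : ForestLike S A)
    (B' : ForestLike S A') (B'' : ForestLike S A'') :
    ForestLike.IsIso (Equiv.sumAssoc A A' A'') ((B.sum B').sum B'') (B.sum (B'.sum B'')) where
  root_iff := by rintro ((a | a) | a) <;> exact Iff.rfl
  dec_iff := by rintro n g ((a | a) | a) <;> exact Iff.rfl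
  edge_iff := by rintro j ((a | a) | a) ((b | b) | b) <;> exact Iff.rfl

theorem isIso_sumAssoc_sumOpp {S : ℕ → Type u} {A'' : Type u} (B : ForestLike S A)
    (B' : ForestLike S A') (B'' : ForestLike S A'') :
    ForestLike.IsIso (Equiv.sumAssoc A A' A'') ((B.sumOpp B').sumOpp B'')
      (B.sumOpp (B'.sumOpp B'')) where
  root_iff := by rintro ((a | a) | a) <;> exact Iff.rfl
  dec_iff := by rintro n g ((a | a) | a) <;> exact Iff.rfl
  edge_iff := by rintro j ((a | a) | a) ((b | b) | b) <;> exact Iff.rfl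

end Opposite

/-! ## The polynomial realizations -/

section Realizations

variable (K : Type v) [Field K] (D : Type u)

theorem isPolynomialRealization_comulOpp :
    IsPolynomialRealization (NCK.comulOpp K D) (NCK.component K D) IsUniform
      ForestLike.sum (realizeNCK K) (alphD D) where
  sum_mem _ _ hB hB' := isUniform_sum hB hB'
  sum_assoc B B' B'' _ _ _ := isIso_sumAssoc B B' B''
  graded B _ n x hx := realizeNCK_isHomogeneous K B n x hx
  doubling _ _ hB hB' x := theta_realizeNCK_sum hB hB' x
  mem := isUniform_alphD
  injective := realizeNCK_alphD_injective K

theorem isPolynomialRealization_comul :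
    IsPolynomialRealization (CoalgebraStruct.comul (R := K) (A := NCK K D)) (NCK.component K D)
      IsUniform ForestLike.sumOpp (realizeNCK K) (alphD D) where
  sum_mem _ _ hB hB' := isUniform_sumOpp hB hB'
  sum_assoc B B' B'' _ _ _ := isIso_sumAssoc_sumOpp B B' B''
  graded B _ n x hx := realizeNCK_isHomogeneous K B n x hx
  doubling _ _ hB hB' x := theta_realizeNCK_sumOpp hB hB' x
  mem := isUniform_alphD
  injective := realizeNCK_alphD_injective K

/-- The realization identifies the algebra of planar forests with the image of the natural Hopf
algebra. -/
theorem exists_equiv_range : ∃ φ : NCK K D ≃ₐ[K] ((alphD D).realizeHom K).range,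
    ∀ x, (φ x : NCPoly K (D × ℕ)) = realizeNCK K (alphD D) x := by
  have hmem : ∀ x, realizeNCKHom K (alphD D) x ∈ ((alphD D).realizeHom K).range := by
    intro x
    obtain ⟨y, rfl⟩ := NatHopf.toNCK_surjective x
    exact ⟨y, (realizeNCK_toNCK K isUniform_alphD y).symm⟩
  refine ⟨AlgEquiv.ofBijective ((realizeNCKHom K (alphD D)).codRestrict _ hmem) ⟨?_, ?_⟩,
    fun x => rfl⟩
  · exact fun x y h => realizeNCK_alphD_injective K (congrArg Subtype.val h)
  · rintro ⟨_, y, rfl⟩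
    exact ⟨NatHopf.toNCK K D y, Subtype.ext (realizeNCK_toNCK K isUniform_alphD y)⟩

end Realizations

/-! ## Morphisms for given coalgebra operations -/

section Morphisms

variable {K : Type v} {H : Type w} {H' : Type u} [Field K] [Ring H] [Ring H'] [Algebra K H]
  [Algebra K H'] [CoalgebraStruct K H] [CoalgebraStruct K H']

theorem exists_bialgHom (f : H →ₐ[K] H')
    (hcounit : ∀ x, CoalgebraStruct.counit (R := K) (f x) = CoalgebraStruct.counit (R := K) x)
    (hcomul : ∀ x, TensorProduct.map f.toLinearMap f.toLinearMap
      (CoalgebraStruct.comul (R := K) x) = CoalgebraStruct.comul (R := K) (f x)) :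
    ∃ π : H →ₐc[K] H', ∀ x, π x = f x :=
  ⟨{ f with
      map_smul' := map_smul f
      counit_comp := LinearMap.ext hcounit
      map_comp_comul := LinearMap.ext hcomul }, fun _ => rfl⟩

theorem nonempty_bialgEquiv (χ : H ≃ₐ[K] H')
    (hcounit : ∀ x, CoalgebraStruct.counit (R := K) (χ x) = CoalgebraStruct.counit (R := K) x)
    (hcomul : ∀ x, CoalgebraStruct.comul (R := K) (χ x) =
      TensorProduct.map χ.toLinearMap χ.toLinearMap (CoalgebraStruct.comul (R := K) x)) :
    Nonempty (H' ≃ₐc[K] H) :=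
  ⟨BialgEquiv.symm
    { χ with
      map_smul' := map_smul χ
      counit_comp := LinearMap.ext hcounit
      map_comp_comul := LinearMap.ext fun x => (hcomul x).symm }⟩

end Morphisms

end ForestHopf

end

theorem mainTheorem6 (K : Type v) [Field K] [CharZero K] (D : Type u) :
    IsHopf K (NatHopf K (sigD D)) ∧ IsHopf K (NCK K D) ∧
    (∃ ρ : NatHopf K (sigD D) →ₐ[K] NCPoly K (D × ℕ),
      ρ.toLinearMap = (alphD D).realize K ∧
      ∃ _ : CoalgebraStruct K ρ.range,
        IsHopf K ρ.range ∧
        (∃ π : NatHopf K (sigD D) →ₐc[K] ρ.range, ∀ x, (π x : NCPoly K (D × ℕ)) = ρ x) ∧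
        Nonempty (ρ.range ≃ₐc[K] NCK K D) ∧
        ∃ φ : NCK K D ≃ₐ[K] ρ.range,
          (∀ x, (φ x : NCPoly K (D × ℕ)) = realizeNCK K (alphD D) x) ∧
          (∀ x, CoalgebraStruct.counit (R := K) (φ x) = CoalgebraStruct.counit (R := K) x) ∧
          ∀ x, CoalgebraStruct.comul (R := K) (φ x) =
            TensorProduct.map φ.toLinearMap φ.toLinearMap (NCK.comulOpp K D x)) ∧
    IsPolynomialRealization (NCK.comulOpp K D) (NCK.component K D) IsUniform
      ForestLike.sum (realizeNCK K) (alphD D) ∧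
    IsPolynomialRealization (CoalgebraStruct.comul (R := K) (A := NCK K D)) (NCK.component K D)
      IsUniform ForestLike.sumOpp (realizeNCK K) (alphD D) := by
  refine ⟨NatHopf.isHopf K (sigD D), NCK.isHopf K D, ⟨(alphD D).realizeHom K, rfl, ?_⟩,
    isPolynomialRealization_comulOpp K D, isPolynomialRealization_comul K D⟩
  obtain ⟨φ, hφ⟩ := exists_equiv_range K D
  obtain ⟨ψ, hψ1, hψ2⟩ := NCK.exists_equiv_coopposite K D
  -- The Hopf structure of the image is transported along `χ`, which carries `Δ` itself. The twist
  -- by `ψ` is what makes `φ` carry `Δ^op`.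
  let χ : NCK K D ≃ₐ[K] ((alphD D).realizeHom K).range := ψ.trans φ
  let co : CoalgebraStruct K ((alphD D).realizeHom K).range := transportCoalgebra χ.toLinearEquiv
  have hχ1 : ∀ x, CoalgebraStruct.counit (R := K) (χ x) = CoalgebraStruct.counit (R := K) x :=
    fun x => congrArg (CoalgebraStruct.counit (R := K)) (χ.symm_apply_apply x)
  have hχ2 : ∀ x, CoalgebraStruct.comul (R := K) (χ x) =
      TensorProduct.map χ.toLinearMap χ.toLinearMap (CoalgebraStruct.comul (R := K) x) :=
    fun x => congrArg (fun y => TensorProduct.map χ.toLinearMap χ.toLinearMap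
      (CoalgebraStruct.comul (R := K) y)) (χ.symm_apply_apply x)
  have hφ1 : ∀ x, CoalgebraStruct.counit (R := K) (φ x) = CoalgebraStruct.counit (R := K) x := by
    intro y
    obtain ⟨x, rfl⟩ := ψ.surjective y
    rw [hψ1]
    exact hχ1 x
  have hφ2 : ∀ x, CoalgebraStruct.comul (R := K) (φ x) =
      TensorProduct.map φ.toLinearMap φ.toLinearMap (NCK.comulOpp K D x) := by
    intro y
    obtain ⟨x, rfl⟩ := ψ.surjective y
    refine (hχ2 x).trans ?_
    -- At `ψ x` the two exchanges of factors cancel, leaving the transported coproduct of `x`.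
    rw [NCK.comulOpp, LinearMap.comp_apply, hψ2, NCK.comulOpp, LinearMap.comp_apply]
    generalize CoalgebraStruct.comul (R := K) x = z
    induction z using TensorProduct.induction_on with
    | zero => simp
    | tmul a b => simp [χ]
    | add a b ha hb => simp only [map_add, ha, hb]
  refine ⟨co, (NCK.isHopf K D).transport χ hχ1 hχ2, ?_, ?_, φ, hφ, hφ1, hφ2⟩
  -- Leaf deletion takes `Δ` to `Δ^op`, and `φ` takes `Δ^op` to the coproduct of the image, so their
  -- composite, which is the realization, is a coalgebra morphism.
  · have hcomul : ∀ x, TensorProduct.map (φ.toAlgHom.comp (NatHopf.toNCK K D)).toLinearMap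
        (φ.toAlgHom.comp (NatHopf.toNCK K D)).toLinearMap (CoalgebraStruct.comul (R := K) x) =
        CoalgebraStruct.comul (R := K) (φ (NatHopf.toNCK K D x)) := by
      intro x
      rw [hφ2, NatHopf.comulOpp_toNCK]
      generalize CoalgebraStruct.comul (R := K) x = z
      induction z using TensorProduct.induction_on with
      | zero => simp
      | tmul a b => simp
      | add a b ha hb => simp only [map_add, ha, hb]
    obtain ⟨π, hπ⟩ := exists_bialgHom (φ.toAlgHom.comp (NatHopf.toNCK K D))
      (fun x => (hφ1 _).trans (NatHopf.counit_toNCK x)) hcomul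
    exact ⟨π, fun x => (congrArg Subtype.val (hπ x)).trans
      ((hφ _).trans (realizeNCK_toNCK K isUniform_alphD x))⟩
  · exact nonempty_bialgEquiv χ hχ1 hχ2
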